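/- **Setting.** Let $\mathbb T=\mathbb R/\mathbb Z$ and let $p(x)=\sum_{k\in\mathbb Z^d}\hat p_k\,\mathrm e^{2\pi\mathrm i k\cdot x}\not\equiv 0$ be a trigonometric polynomial on $\mathbb T^d$, $d\ge 1$, with finite $\operatorname{supp}\hat p=\{k:\hat p_k\ne 0\}$; put $S=|\operatorname{supp}\hat p|$. Let $N\ge 1$, $\hat G_N^d=\{-N,\dots,N\}^d$, $\operatorname{supp}\hat p\subset\Gamma\subset\hat G_N^d$. For $I\subset\mathbb Z^d$ let $\mathcal P_t(I)$ and $\mathcal P_{(1,\dots,t)}(I)$ be its projections to the $t$-th component and to the first $t$ components. $p$ is accessible only as a black box. **Lattice construction** for a finite $J\subset\mathbb Z^t$. Put $L_{\max}=\lceil 2(\ln|J|+\ln 2)\rceil$ and let $p_1<\dots<p_{L_{\max}}$ be the smallest primes $q>2(|J|-1)$ for which the elements of $J$ are pairwise distinct modulo $q$. For $\ell=1,2,\dots$ put $M_\ell=p_\ell$, draw $z_\ell\in\{0,\dots,M_\ell-1\}^t$ uniformly at random, and let $J_\ell$ be the set of all $k\in J$ with $k\cdot z_\ell\not\equiv h\cdot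 z_\ell \pmod{M_\ell}$ for all $h\in J\setminus\{k\}$; stop as soon as $J_1\cup\dots\cup J_\ell=J$ or $\ell=L_{\max}$. The construction succeeds if $\bigcup_\ell J_\ell=J$. **Algorithm** (dimension-incremental sparse FFT with multiple rank-1 lattices; inputs $\Gamma$, $\delta>0$, $s,r,b\in\mathbb N$). *(Components.)* For $t=1,\dots,d$ let $K_t=\max\mathcal P_t(\Gamma)-\min\mathcal P_t(\Gamma)+1$. Do $r$ times: draw the components $x'_j\in\mathbb T$, $j\neq t$, uniformly at random, compute by FFT $$\tilde{\hat p}_{t,k}=\frac1{K_t}\sum_{l=0}^{K_t-1}p(x'_1,\dots,x'_{t-1},l/K_t,x'_{t+1},\dots,x'_d)\,\mathrm e^{-2\pi\mathrm i lk/K_t},\qquad k\in\mathcal P_t(\Gamma),$$ and add to $I^{(t)}$ (initially empty) the (up to) $s$ indices with largest $|\tilde{\hat p}_{t,k}|\ge\delta$. Put $I^{(1,\dots,1)}=I^{(1)}$. *(Increments.)* For $t=2,\dots,d$ let $J=(I^{(1,\dots,t-1)}\times I^{(t)})\cap\mathcal P_{(1,\dots,t)}(\Gamma)$. Run the lattice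 construction for $J$ until it succeeds, at most $b$ times, and keep the last result $(z_\ell,M_\ell)_\ell$. Do $r$ times if $t<d$, and once if $t=d$: draw $x'_{t+1},\dots,x'_d\in\mathbb T$ uniformly at random, sample $p$ at the nodes $(\tfrac j{M_\ell}z_\ell \bmod 1,\,x'_{t+1},\dots,x'_d)$, $0\le j<M_\ell$; for $k\in J$ let $\tilde{\hat p}_{(1,\dots,t),k}$ be the mean over all $\ell$ with $k\in J_\ell$ of $$\frac1{M_\ell}\sum_{j=0}^{M_\ell-1}p\big(\tfrac j{M_\ell}z_\ell,x'_{t+1},\dots,x'_d\big)\,\mathrm e^{-2\pi\mathrm i j\,k\cdot z_\ell/M_\ell}$$ (computed by FFT; $0$ if there is no such $\ell$), and add to $I^{(1,\dots,t)}$ (initially empty) the (up to) $s$ indices with largest $|\tilde{\hat p}_{(1,\dots,t),k}|\ge\delta$. All draws are independent. The output index set is $I=I^{(1,\dots,d)}$. **Theorem.** Let $\varepsilon\in(0,1)$, $0<\delta\le\frac13\min_{h\in\operatorname{supp}\hat p}|\hat p_h|$, $s\ge S$, $$r=\lceil 2S(\log 3+\log d+\log S-\log\varepsilon)\rceil,\qquad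 b=\Big\lceil\frac{\log 3+\log d-\log\varepsilon}{\log 2}\Big\rceil .$$ 1. With probability at least $1-\varepsilon$ the output index set is $I=\operatorname{supp}\hat p$. 2. For all $\kappa>0$ and $\varepsilon_0<1$ there is a constant $C$, depending only on $\kappa$ and $\varepsilon_0$, such that, whenever $S\ge 2$, $N\le\kappa S$, $d\le\kappa S$ and $\varepsilon\le\varepsilon_0$, the following holds with probability at least $1-\varepsilon$: $I=\operatorname{supp}\hat p$, the algorithm uses at most $C\,d\,S^2N(\log S)^2|\log\varepsilon|$ samples and at most $C\,d^2S^2N(\log S)^3|\log\varepsilon|$ arithmetic operations. 3. For all $\kappa>0$, $\varepsilon_0<1$ and $C_0\ge 1$ there is a constant $C$, depending only on $\kappa,\varepsilon_0,C_0$, such that, whenever $S\ge 2$, $N\le\kappa S$, $d\le\kappa S$, $\varepsilon\le\varepsilon_0$ and $s\le C_0S$, the algorithm always (for all outcomes of the random draws) uses at most $$C\,d\,S^3N(\log S)^3|\log\varepsilon|\,\max\{1,|\log|\log\varepsilon||\}$$ samples and at most $$C\,d^2S^3N(\log S)^4|\log\varepsilon|^2\max\{1,|\log|\log\varepsilon||\}^2$$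 arithmetic operations. Arithmetic operations are additions, multiplications, divisions (also with remainder), comparisons and evaluations of elementary functions of integers, real and complex numbers; the discrete Fourier transforms are done with a fast Fourier transform (radix 2, with the chirp transform for general lengths), the largest values are found with merge sort, primes are found with a sieve, and testing whether a vector belongs to a projection of $\Gamma$ costs one operation per component. -/

import Mathlib

open Finset
open scoped ENNReal

noncomputable section

/-! ### Trigonometric polynomials on the torus -/

/-- A frequency with `t` components. -/
abbrev Freq (t : ℕ) : Type := Fin t → ℤ

/-- The trigonometric polynomial `p(x) = ∑ₖ p̂ₖ exp(2πi k·x)` on `𝕋ᵈ = (ℝ/ℤ)ᵈ` with the finitely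
supported family `c = (p̂ₖ)` of Fourier coefficients; `supp p̂` is `c.support`. -/
def trigPoly {d : ℕ} (c : Freq d →₀ ℂ) (x : UnitAddTorus (Fin d)) : ℂ :=
  ∑ k ∈ c.support, c k * UnitAddTorus.mFourier k x

/-- The full grid `{-N, …, N}ᵈ`. -/
def fullGrid (d N : ℕ) : Finset (Freq d) :=
  Fintype.piFinset fun _ => Finset.Icc (-(N : ℤ)) (N : ℤ)

/-- The projection of a frequency to its first `t` components. -/
def proj {d t : ℕ} (ht : t ≤ d) (k : Freq d) : Freq t := fun i => k (Fin.castLE ht i)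

/-! ### Deterministic computations with a count of arithmetic operations -/

/-- A value together with the number of arithmetic operations spent on it.  Operations are
additions, multiplications, divisions (also with remainder), comparisons and elementary functions
of integers, real and complex numbers. -/
structure Counted (α : Type) : Type where
  val : α
  ops : ℕ

namespace Counted

instance : Monad Counted where
  pure a := ⟨a, 0⟩
  bind m f := ⟨(f m.val).val, m.ops + (f m.val).ops⟩

/-- One arithmetic operation with result `a`. -/
def op {α : Type} (a : α) : Counted α := ⟨a, 1⟩

/-- The loop "for all `i ∈ S` compute `f i`"; the results form an array indexed by `S`. -/
def forAll {ι α : Type} [DecidableEq ι] [Zero α] (S : Finset ι) (f : ι → Counted α) :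
    Counted (ι → α) :=
  ⟨fun i => if i ∈ S then (f i).val else 0, ∑ i ∈ S, (f i).ops⟩

/-- Radix-2 fast Fourier transform of length `2 ^ m` with the sign `σ = ±1` in the exponent:
the `k`-th result is `∑ j < 2 ^ m, x j * exp (2πi σ j k / 2 ^ m)`. -/
def fftTwo (σ : ℝ) : (m : ℕ) → (ℕ → ℂ) → Counted (ℕ → ℂ)
  | 0, x => pure x
  | m + 1, x => do
    let E ← fftTwo σ m fun j => x (2 * j)
    let O ← fftTwo σ m fun j => x (2 * j + 1)
    forAll (range (2 ^ (m + 1))) fun k => do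
      let w ← (⟨Complex.exp (2 * Real.pi * Complex.I * σ * k / 2 ^ (m + 1)), 5⟩ : Counted ℂ)
      let y ← op (w * O (k % 2 ^ m))
      op (E (k % 2 ^ m) + y)

/-- Fast Fourier transform of arbitrary length `M`: the `k`-th result is
`∑ j < M, a j * exp (-2πi j k / M)`.  With the chirp `w j = exp (πi j² / M)` it is the
cyclic convolution of `a j * conj (w j)` and `w`, multiplied by `conj (w k)`, which is computed
with radix-2 transforms of a length `n = 2 ^ m ≥ 2 * M`. -/
def fft (M : ℕ) (a : ℕ → ℂ) : Counted (ℕ → ℂ) := do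
  let m := Nat.clog 2 (2 * M)
  let n := 2 ^ m
  let w ← forAll (range M) fun j =>
    (⟨Complex.exp (Real.pi * Complex.I * (j : ℂ) ^ 2 / M), 5⟩ : Counted ℂ)
  let u ← forAll (range n) fun j =>
    if j < M then (⟨a j * (starRingEnd ℂ) (w j), 3⟩ : Counted ℂ) else ⟨0, 1⟩
  let v ← forAll (range n) fun j => (⟨w (min j (n - j)), 2⟩ : Counted ℂ)
  let U ← fftTwo (-1) m u
  let V ← fftTwo (-1) m v
  let P ← forAll (range n) fun k => op (U k * V k)
  let Q ← fftTwo 1 m P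
  forAll (range M) fun k => do
    let q ← op (Q k / n)
    (⟨q * (starRingEnd ℂ) (w k), 2⟩ : Counted ℂ)

/-- Merging two lists that are sorted by decreasing `v`. -/
def merge {β : Type} (v : β → ℝ) : List β → List β → Counted (List β)
  | [], l => pure l
  | l, [] => pure l
  | a :: l, b :: l' => do
    let first ← op (decide (v b ≤ v a))
    if first then
      let r ← merge v l (b :: l')
      pure (a :: r)
    else
      let r ← merge v (a :: l) l'
      pure (b :: r)
termination_by l l' => l.length + l'.length

/-- Merge sort by decreasing `v` for lists of length at most `2 ^ m`. -/
def mergeSort {β : Type} (v : β → ℝ) : (m : ℕ) → List β → Counted (List β)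
  | 0, l => pure l
  | m + 1, l => do
    let a ← mergeSort v m (l.take (l.length / 2))
    let b ← mergeSort v m (l.drop (l.length / 2))
    merge v a b

/-- The set of the (up to) `s` indices `k ∈ A` with the largest values `|g k| ≥ δ`. -/
def select {β : Type} [DecidableEq β] (A : Finset β) (g : β → ℂ) (δ : ℝ) (s : ℕ) :
    Counted (Finset β) := do
  let v ← forAll A fun k => (⟨‖g k‖, 4⟩ : Counted ℝ)
  let B ← (⟨{k ∈ A | δ ≤ v k}, #A⟩ : Counted (Finset β))
  let l ← mergeSort v (Nat.clog 2 #B) B.toList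
  pure (l.take s).toFinset

end Counted

open Counted

/-! ### Randomized computations with access to a black box -/

/-- A randomized program with black-box access to a function on `𝕋ᵈ`. -/
inductive Prog (d : ℕ) (α : Type) : Type
  /-- stop and return `a` -/
  | ret (a : α) : Prog d α
  /-- spend `n` arithmetic operations -/
  | spend (n : ℕ) (next : Prog d α) : Prog d α
  /-- sample the black box at the node `x` -/
  | sample (x : UnitAddTorus (Fin d)) (next : ℂ → Prog d α) : Prog d α
  /-- draw a point of `𝕋ᵈ` uniformly at random -/
  | randPoint (next : UnitAddTorus (Fin d) → Prog d α) : Prog d α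
  /-- draw a vector from `{0, …, M - 1}ᵗ` uniformly at random -/
  | randVec (t M : ℕ) (next : (Fin t → Fin M) → Prog d α) : Prog d α

namespace Prog

variable {d : ℕ}

/-- Sequential composition. -/
def bind {α β : Type} : Prog d α → (α → Prog d β) → Prog d β
  | ret a, f => f a
  | spend n q, f => spend n (q.bind f)
  | sample x q, f => sample x fun y => (q y).bind f
  | randPoint q, f => randPoint fun x => (q x).bind f
  | randVec t M q, f => randVec t M fun z => (q z).bind f

instance : Monad (Prog d) where
  pure := ret
  bind := bind

/-- A deterministic computation as a program. -/
def lift {α : Type} (m : Counted α) : Prog d α := spend m.ops (ret m.val)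

open Classical in
/-- `prob p q E` is the probability that the program `q`, run with the black box `p` and with
independent draws, returns a value `a` after `m` samples and `n` arithmetic operations such that
`E a m n`. -/
def prob {α : Type} (p : UnitAddTorus (Fin d) → ℂ) :
    Prog d α → (α → ℕ → ℕ → Prop) → ℝ≥0∞
  | ret a, E => if E a 0 0 then 1 else 0
  | spend k q, E => prob p q fun a m n => E a m (k + n)
  | sample x q, E => prob p (q (p x)) fun a m n => E a (1 + m) n
  | randPoint q, E =>
    ∫⁻ x, prob p (q x) E ∂(MeasureTheory.Measure.pi fun _ : Fin d => AddCircle.haarAddCircle)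
  | randVec t M q, E => (∑ z : Fin t → Fin M, prob p (q z) E) / (M ^ t : ℝ≥0∞)

/-- `always p q E` means that `E a m n` holds for every run of the program `q` with the black box
`p`, whatever the results of the random draws are. -/
def always {α : Type} (p : UnitAddTorus (Fin d) → ℂ) :
    Prog d α → (α → ℕ → ℕ → Prop) → Prop
  | ret a, E => E a 0 0
  | spend k q, E => always p q fun a m n => E a m (k + n)
  | sample x q, E => always p (q (p x)) fun a m n => E a (1 + m) n
  | randPoint q, E => ∀ x, always p (q x) E
  | randVec _ _ q, E => ∀ z, always p (q z) E

/-- Draw a random point of `𝕋ᵈ` (`d` operations). -/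
def drawPoint : Prog d (UnitAddTorus (Fin d)) := spend d (randPoint ret)

/-- Draw a random vector from `{0, …, M - 1}ᵗ` (`t` operations). -/
def drawVec (t M : ℕ) : Prog d (Freq t) := spend t (randVec t M fun z => ret fun i => (z i : ℤ))

/-- Sample the black box at the nodes `x 0, …, x (n - 1)`, each of which costs `w` operations. -/
def sampleAll (w : ℕ) (x : ℕ → UnitAddTorus (Fin d)) : (n : ℕ) → Prog d (ℕ → ℂ)
  | 0 => pure 0
  | n + 1 => do
    let y ← sampleAll w x n
    let v ← spend w (sample (x n) ret)
    pure (Function.update y n v)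

/-- Run a program `r` times with fresh random draws and return the union of the results (one
operation for every element of a result). -/
def unionLoop {β : Type} [DecidableEq β] (q : Prog d (Finset β)) : (r : ℕ) → Prog d (Finset β)
  | 0 => pure ∅
  | r + 1 => do
    let I ← unionLoop q r
    let T ← q
    spend #T (pure (I ∪ T))

end Prog

/-! ### Construction of multiple rank-1 lattices -/

/-- A rank-1 lattice `Λ(z, M)`, given by its generating vector and its size. -/
structure Rank1Lattice (t : ℕ) : Type where
  z : Freq t
  M : ℕ

variable {d t : ℕ}

/-- `k · z mod M` as an element of `{0, …, M - 1}`. -/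
def residue (k : Freq t) (Λ : Rank1Lattice t) : ℕ := ((∑ i, k i * Λ.z i) % (Λ.M : ℤ)).toNat

/-- The set of all `k ∈ I` such that no `h ∈ I \ {k}` fulfills `k · z ≡ h · z (mod M)`.  It is found
by computing all residues (`2 t + 1` operations each), counting how often each of them occurs and
comparing the counts with `1`. -/
def isolated (I : Finset (Freq t)) (Λ : Rank1Lattice t) : Counted (Finset (Freq t)) :=
  ⟨{k ∈ I | ∀ h ∈ I, h ≠ k → ¬ (∑ i, k i * Λ.z i) ≡ (∑ i, h i * Λ.z i) [ZMOD (Λ.M : ℤ)]},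
    #I * (2 * t + 3)⟩

/-- The maximal number `⌈c² / (c - 1)² (ln |I| - ln γ) / 2⌉` of lattices. -/
def maxLattices (c γ : ℝ) (I : Finset (Freq t)) : ℕ :=
  ⌈c ^ 2 / (c - 1) ^ 2 * (Real.log #I - Real.log γ) / 2⌉₊

/-- `q` is a prime larger than `λ = c (|I| - 1)` for which the elements of `I` are pairwise distinct
modulo `q`. -/
def IsLatticeSize (c : ℝ) (I : Finset (Freq t)) (q : ℕ) : Prop :=
  q.Prime ∧ c * ((#I : ℝ) - 1) < q ∧ #(I.image fun k i => k i % (q : ℤ)) = #I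

/-- The `j`-th smallest lattice size, `j = 0, 1, …`. -/
def latticeSize (c : ℝ) (I : Finset (Freq t)) (j : ℕ) : ℕ := Nat.nth (IsLatticeSize c I) j

/-- The number of operations of a sieve on `{2, …, B}` that crosses out all products `a * b ≤ B` with
`2 ≤ a`, `b ≤ B / a`. -/
def sieveOps (B : ℕ) : ℕ := ∑ a ∈ Finset.Icc 2 B, (B / a + 1)

/-- The number of operations for finding the `L` smallest lattice sizes, the largest of which is `q`.
First the primes up to `2, 4, 8, …` are sieved until `q` is reached.  Then each prime `λ < q' ≤ q`
is tested: the `t`-dimensional vectors of `I` are reduced modulo `q'` and put one after the other in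
an ordered search tree, with `t` comparisons of numbers at each of at most `log₂ |I| + 1` levels. -/
def latticeSizesOps (c : ℝ) (I : Finset (Freq t)) (L : ℕ) : ℕ :=
  let q := latticeSize c I (L - 1)
  ∑ i ∈ range (Nat.clog 2 q + 1), sieveOps (2 ^ i) +
    #{q' ∈ range (q + 1) | Nat.Prime q' ∧ c * ((#I : ℝ) - 1) < (q' : ℝ)} *
      (#I * (t + t * (Nat.log 2 #I + 1)))

/-- The loop of the lattice construction: `n` is the number of lattices that may still be added, `ℓ`
the index of the next one, and `R` the set of frequencies that are reconstructible already. The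
result consists of the added lattices and the final set `R`. -/
def latticeLoop (I : Finset (Freq t)) (size : ℕ → ℕ) :
    (n ℓ : ℕ) → Finset (Freq t) → Prog d (List (Rank1Lattice t) × Finset (Freq t))
  | 0, _, R => pure ([], R)
  | n + 1, ℓ, R => do
    let z ← Prog.drawVec t (size ℓ)
    let Λ : Rank1Lattice t := ⟨z, size ℓ⟩
    let Iℓ ← Prog.lift (isolated I Λ)
    let R' ← Prog.lift (⟨R ∪ Iℓ, #I + 1⟩ : Counted (Finset (Freq t)))
    if #R' = #I then pure ([Λ], R')
    else
      let rest ← latticeLoop I size n (ℓ + 1) R'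
      pure (Λ :: rest.1, rest.2)

/-- One run of the randomized construction of a multiple rank-1 lattice for `I` with oversampling
factor `c` and failure probability `γ`. -/
def constructLattice (c γ : ℝ) (I : Finset (Freq t)) :
    Prog d (List (Rank1Lattice t) × Finset (Freq t)) := do
  let L ← Prog.lift (⟨maxLattices c γ I, 8⟩ : Counted ℕ)
  let size ← Prog.lift (⟨latticeSize c I, latticeSizesOps c I L⟩ : Counted (ℕ → ℕ))
  latticeLoop I size L 0 ∅

/-- The construction with `c = 2`, `γ = 1/2`, repeated up to `n` times until all frequencies of `I`
are reconstructible. -/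
def searchLattice (I : Finset (Freq t)) : (n : ℕ) → Prog d (List (Rank1Lattice t))
  | 0 => do
    let Λ ← constructLattice 2 (1 / 2) I
    pure Λ.1
  | n + 1 => do
    let Λ ← constructLattice 2 (1 / 2) I
    if #Λ.2 = #I then pure Λ.1 else searchLattice I n

/-! ### Fourier coefficients from samples along multiple rank-1 lattices -/

/-- The node `((j / M) z, x_{t+1}, …, x_d) mod 1` of `𝕋ᵈ`. -/
def latticeNode (Λ : Rank1Lattice t) (x : UnitAddTorus (Fin d)) (j : ℕ) : UnitAddTorus (Fin d) :=
  fun i => if h : (i : ℕ) < t then (((j : ℝ) / Λ.M * Λ.z ⟨i, h⟩ : ℝ) : UnitAddCircle) else x i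

/-- Sample the black box along all lattices, with the components `x_{t+1}, …, x_d` fixed. -/
def sampleLattices (x : UnitAddTorus (Fin d)) :
    List (Rank1Lattice t) → Prog d (List (Rank1Lattice t × (ℕ → ℂ)))
  | [] => pure []
  | Λ :: rest => do
    let y ← Prog.sampleAll (3 * t) (latticeNode Λ x) Λ.M
    let ys ← sampleLattices x rest
    pure ((Λ, y) :: ys)

/-- The loop of the inverse multiple rank-1 lattice transform, with the current counters and sums.
A coefficient whose counter is zero in the end keeps the value zero. -/
def inverseLoop (I : Finset (Freq t)) :
    List (Rank1Lattice t × (ℕ → ℂ)) → (Freq t → ℕ) → (Freq t → ℂ) → Counted (Freq t → ℂ)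
  | [], counter, g =>
    forAll I fun k => if counter k = 0 then op 0 else (⟨g k / counter k, 2⟩ : Counted ℂ)
  | (Λ, y) :: rest, counter, g => do
    let Iℓ ← isolated I Λ
    let Y ← fft Λ.M y
    let counter' ← forAll I fun k => if k ∈ Iℓ then op (counter k + 1) else pure (counter k)
    let g' ← forAll I fun k =>
      if k ∈ Iℓ then do
        let r ← (⟨residue k Λ, 2 * t + 1⟩ : Counted ℕ)
        let a ← op (Y r / Λ.M)
        op (g k + a)
      else pure (g k)
    inverseLoop I rest counter' g'

/-- The Fourier coefficients with frequencies in `I`, computed from samples along a multiple rank-1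
lattice. -/
def inverseTransform (I : Finset (Freq t)) (data : List (Rank1Lattice t × (ℕ → ℂ))) :
    Counted (Freq t → ℂ) := inverseLoop I data 0 0

/-! ### The dimension-incremental algorithm -/

/-- The `τ`-th components of the search space. -/
def component (Γ : Finset (Freq d)) (τ : Fin d) : Finset ℤ := Γ.image fun k => k τ

/-- `max - min + 1` of the `τ`-th components of the search space. -/
def extent (Γ : Finset (Freq d)) (τ : Fin d) : ℕ :=
  (sSup (component Γ τ : Set ℤ) - sInf (component Γ τ : Set ℤ) + 1).toNat

/-- One detection iteration for the `τ`-th component: the components of the sampling nodes other than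
the `τ`-th one are random (the `τ`-th component of the random point is overwritten). -/
def detectOnce (Γ : Finset (Freq d)) (δ : ℝ) (s : ℕ) (τ : Fin d) : Prog d (Finset ℤ) := do
  let K ← Prog.lift (⟨extent Γ τ, 2 * #(component Γ τ) + 2⟩ : Counted ℕ)
  let x ← Prog.drawPoint
  let y ← Prog.sampleAll 1
    (fun l => Function.update x τ (((l : ℝ) / K : ℝ) : UnitAddCircle)) K
  let Y ← Prog.lift (fft K y)
  let g ← Prog.lift (forAll (component Γ τ) fun k =>
    (⟨Y (k % (K : ℤ)).toNat / K, 2⟩ : Counted ℂ))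
  Prog.lift (select (component Γ τ) g δ s)

/-- The frequency candidates `(I × A) ∩ P_{(1,…,t+1)}(Γ)`; testing whether a vector belongs to a
projection of the search space costs one operation for each of its components. -/
def candidates (Γ : Finset (Freq d)) (ht : t + 1 ≤ d) (I : Finset (Freq t)) (A : Finset ℤ) :
    Counted (Finset (Freq (t + 1))) :=
  ⟨((I ×ˢ A).image fun q => (Fin.snoc (α := fun _ => ℤ) q.1 q.2 : Freq (t + 1))) ∩
      Γ.image (proj ht),
    #I * #A * (t + 1)⟩

/-- The index set `I^{(1,…,t)}` of the dimension-incremental algorithm with search space `Γ`,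
threshold `δ`, sparsity parameters `s` and `sLocal`, `r` detection iterations and at most `b` lattice
searches per component. -/
def increment (Γ : Finset (Freq d)) (δ : ℝ) (s sLocal r b : ℕ) :
    (t : ℕ) → t ≤ d → Prog d (Finset (Freq t))
  | 0, _ => pure ∅
  | 1, h => do
    let A ← Prog.unionLoop (detectOnce Γ δ sLocal ⟨0, h⟩) r
    pure (A.image fun a _ => a)
  | t + 2, h => do
    let I ← increment Γ δ s sLocal r b (t + 1) (Nat.le_of_succ_le h)
    let A ← Prog.unionLoop (detectOnce Γ δ sLocal ⟨t + 1, h⟩) r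
    let J ← Prog.lift (candidates Γ h I A)
    let Λ ← searchLattice J (b - 1)
    Prog.unionLoop
      (do
        let x ← Prog.drawPoint
        let y ← sampleLattices x Λ
        let g ← Prog.lift (inverseTransform J y)
        Prog.lift (select J g δ (if t + 2 < d then sLocal else s)))
      (if t + 2 < d then r else 1)

/-- The dimension-incremental sparse fast Fourier transform with multiple rank-1 lattices; the result
is the index set of the detected frequencies. -/
def sparseFFT (Γ : Finset (Freq d)) (δ : ℝ) (s sLocal r b : ℕ) : Prog d (Finset (Freq d)) :=
  increment Γ δ s sLocal r b d le_rfl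

/-! ### The choice of the parameters -/

/-- The number `⌈2 S (log 3 + log d + log S - log ε)⌉` of detection iterations. -/
def numDetections (d S : ℕ) (ε : ℝ) : ℕ :=
  ⌈2 * S * (Real.log 3 + Real.log d + Real.log S - Real.log ε)⌉₊

/-- The number `⌈(log 3 + log d - log ε) / log 2⌉` of multiple rank-1 lattice searches. -/
def numSearches (d : ℕ) (ε : ℝ) : ℕ :=
  ⌈(Real.log 3 + Real.log d - Real.log ε) / Real.log 2⌉₊

/-- The algorithm with `sLocal = s` and with the numbers of detection iterations and of lattice
searches chosen for the sparsity `S` and the failure probability `ε`. -/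
def tunedFFT (Γ : Finset (Freq d)) (δ : ℝ) (s S : ℕ) (ε : ℝ) : Prog d (Finset (Freq d)) :=
  sparseFFT Γ δ s s (numDetections d S ε) (numSearches d ε)

/-- The admissible inputs. -/
structure Admissible (N : ℕ) (c : Freq d →₀ ℂ) (Γ : Finset (Freq d)) (δ : ℝ) (s : ℕ) (ε : ℝ) :
    Prop where
  one_le_dim : 1 ≤ d
  one_le_N : 1 ≤ N
  ne_zero : c ≠ 0
  support_subset : c.support ⊆ Γ
  subset_grid : Γ ⊆ fullGrid d N
  delta_pos : 0 < δ
  delta_le : ∀ h ∈ c.support, δ ≤ ‖c h‖ / 3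
  card_le : #c.support ≤ s
  eps_pos : 0 < ε
  eps_lt_one : ε < 1

end

/-!
**Randomness.** `Prog.prob` integrates with `∫⁻` and hence is a *lower* probability.  Everything is
derived from the corresponding lower expectation `Prog.expect`, which is monotone, homogeneous and
compatible with sequential composition (`Prog.expect_bind`), so that success probabilities multiply
(`Prog.SucceedsWithin.bind`).  Additivity is only needed where a measurable function is involved.

**Detection.** Every computed value is exact.  For a single component the transform length exceeds all
differences of the components of `Γ`; for a lattice, a frequency that is isolated within the
candidates `J` collides with no other projection of a frequency of `p`, provided that `J` contains
all of them.  So the value at `k` is the sum of `p̂ₕ exp(2πi h·x)` over the `h` whose projection is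
`k`, taken in the random components of `x` only: it vanishes if `k` is no such projection, and
otherwise Parseval's identity and the Cauchy–Schwarz inequality show that its modulus is below `δ`
with probability at most `1 - 1 / (2 S)` (`measure_norm_lt_le`).  After `r` iterations the expected
number of missed projections is at most `S (1 - 1 / (2 S)) ^ r ≤ ε / (3 d)` (`Prog.prob_unionLoop`).

**Lattices.** Two frequencies that differ modulo the prime `M` collide for a fraction of at most
`1 / M` of the generating vectors.  As `M > 2 (|J| - 1)`, each lattice halves the expected number of
frequencies without reconstructing lattice, a construction succeeds with probability at least `1 / 2`
and the search fails with probability at most `2 ^ (-b) ≤ ε / (3 d)` (`prob_searchLattice`).  Each of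
the at most `3 d` random steps failing with probability at most `ε / (3 d)`, Bernoulli's inequality
yields the first claim.

**Costs.** Chebyshev's bounds provide enough primes up to a multiple of `|J| + N`, which bounds the
lattice sizes (`exists_latticeSize_le`).  If at most `n` frequencies are detected in every stage,
then `|J| ≤ n (2 N + 1)`, and one stage takes `O(r L Q)` samples for at most `L = O(log S)` lattices of
sizes at most `Q = O(n N)` (`exists_cost_le`).  When all detections succeed, one can take `n = S`.  In
general, nonzero values arise only at isolated frequencies that collide with the projection of a
frequency of `p`, and each of the `S` frequencies of `p` does so with at most one isolated frequency
per lattice (`card_detectable_le`); so at most `S L` frequencies are detected, whatever `s` and `r`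
are.  As `L` depends only logarithmically on `n`, the choice `n = K S ^ 2` is consistent for a suitable
`K` (`exists_latticeBound_mul_le`), and gives the costs in the worst case.
-/

/-! ### Lower expectations of randomized programs -/

section Programs

open MeasureTheory

namespace Prog

variable {d : ℕ} {α β : Type} {p : UnitAddTorus (Fin d) → ℂ}

/-- The uniform distribution on `𝕋ᵈ`. -/
noncomputable abbrev torusMeasure (d : ℕ) : Measure (UnitAddTorus (Fin d)) :=
  Measure.pi fun _ : Fin d => AddCircle.haarAddCircle

/-- The lower expectation of `φ (result) (samples) (operations)`.  As for `Prog.prob`, the draws of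
points are integrated with `∫⁻`, which is a lower integral for functions that are not measurable. -/
noncomputable def expect (p : UnitAddTorus (Fin d) → ℂ) :
    Prog d α → (α → ℕ → ℕ → ℝ≥0∞) → ℝ≥0∞
  | ret a, φ => φ a 0 0
  | spend k q, φ => expect p q fun a m n => φ a m (k + n)
  | sample x q, φ => expect p (q (p x)) fun a m n => φ a (1 + m) n
  | randPoint q, φ => ∫⁻ x, expect p (q x) φ ∂torusMeasure d
  | randVec t M q, φ => (∑ z : Fin t → Fin M, expect p (q z) φ) / (M ^ t : ℝ≥0∞)

open Classical in
theorem prob_eq_expect (q : Prog d α) (E : α → ℕ → ℕ → Prop) :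
    prob p q E = expect p q fun a m n => if E a m n then 1 else 0 := by
  induction q generalizing E with
  | ret a => simp [prob, expect]
  | spend k q ih => simp only [prob, expect, ih]
  | sample x q ih => simp only [prob, expect, ih]
  | randPoint q ih => simp only [prob, expect, ih]
  | randVec t M q ih => simp only [prob, expect, ih]

theorem expect_bind (q : Prog d α) (f : α → Prog d β) (φ : β → ℕ → ℕ → ℝ≥0∞) :
    expect p (q.bind f) φ =
      expect p q fun a m n => expect p (f a) fun b m' n' => φ b (m + m') (n + n') := by
  induction q generalizing φ with
  | ret a => simp [bind, expect]
  | spend k q ih => simp only [bind, expect, ih, add_assoc]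
  | sample x q ih => simp only [bind, expect, ih, add_assoc]
  | randPoint q ih => simp only [bind, expect, ih]
  | randVec t M q ih => simp only [bind, expect, ih]

theorem always_bind (q : Prog d α) (f : α → Prog d β) (E : β → ℕ → ℕ → Prop) :
    always p (q.bind f) E ↔
      always p q fun a m n => always p (f a) fun b m' n' => E b (m + m') (n + n') := by
  induction q generalizing E with
  | ret a => simp [bind, always]
  | spend k q ih => simp only [bind, always, ih, add_assoc]
  | sample x q ih => simp only [bind, always, ih, add_assoc]
  | randPoint q ih => simp only [bind, always, ih]
  | randVec t M q ih => simp only [bind, always, ih]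

theorem always_mono {q : Prog d α} {E F : α → ℕ → ℕ → Prop} (hE : always p q E)
    (h : ∀ a m n, E a m n → F a m n) : always p q F := by
  induction q generalizing E F with
  | ret a => exact h _ _ _ hE
  | spend k q ih => exact ih hE fun a m n => h _ _ _
  | sample x q ih => exact ih _ hE fun a m n => h _ _ _
  | randPoint q ih => exact fun x => ih _ (hE x) h
  | randVec t M q ih => exact fun z => ih _ (hE z) h

theorem expect_mono_of_always {q : Prog d α} {E : α → ℕ → ℕ → Prop} {φ ψ : α → ℕ → ℕ → ℝ≥0∞}
    (hE : always p q E) (h : ∀ a m n, E a m n → φ a m n ≤ ψ a m n) :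
    expect p q φ ≤ expect p q ψ := by
  induction q generalizing E φ ψ with
  | ret a => exact h _ _ _ hE
  | spend k q ih => exact ih hE fun a m n => h _ _ _
  | sample x q ih => exact ih _ hE fun a m n => h _ _ _
  | randPoint q ih => exact lintegral_mono fun x => ih _ (hE x) h
  | randVec t M q ih =>
    exact ENNReal.div_le_div_right (Finset.sum_le_sum fun z _ => ih _ (hE z) h) _

theorem always_true (q : Prog d α) : always p q fun _ _ _ => True := by
  induction q with
  | ret a => trivial
  | spend k q ih => exact ih
  | sample x q ih => exact ih _
  | randPoint q ih => exact fun x => ih x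
  | randVec t M q ih => exact fun z => ih z

theorem expect_mono {q : Prog d α} {φ ψ : α → ℕ → ℕ → ℝ≥0∞}
    (h : ∀ a m n, φ a m n ≤ ψ a m n) : expect p q φ ≤ expect p q ψ :=
  expect_mono_of_always (always_true q) fun a m n _ => h a m n

theorem expect_mul_const (q : Prog d α) (φ : α → ℕ → ℕ → ℝ≥0∞) {c : ℝ≥0∞} (hc : c ≠ ∞) :
    (expect p q fun a m n => φ a m n * c) = expect p q φ * c := by
  induction q generalizing φ with
  | ret a => rfl
  | spend k q ih => simp only [expect, ih]
  | sample x q ih => simp only [expect, ih]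
  | randPoint q ih => simp only [expect, ih, lintegral_mul_const' _ _ hc]
  | randVec t M q ih =>
    simp only [expect, ih, ← Finset.sum_mul, div_eq_mul_inv]
    ring

theorem prob_mono_of_always {q : Prog d α} {E F G : α → ℕ → ℕ → Prop} (hE : always p q E)
    (h : ∀ a m n, E a m n → F a m n → G a m n) : prob p q F ≤ prob p q G := by
  classical
  simp only [prob_eq_expect]
  refine expect_mono_of_always hE fun a m n ha => ?_
  by_cases hF : F a m n
  · simp [hF, h a m n ha hF]
  · simp [hF]

theorem prob_mono {q : Prog d α} {F G : α → ℕ → ℕ → Prop}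
    (h : ∀ a m n, F a m n → G a m n) : prob p q F ≤ prob p q G :=
  prob_mono_of_always (always_true q) fun a m n _ => h a m n

/-- A success probability `c` of the continuation, given `E`, multiplies the probability of `E`.  No
measurability is needed, as a constant factor can always be moved out of a lower expectation. -/
theorem prob_mul_le_prob_bind {q : Prog d α} {f : α → Prog d β} {E : α → ℕ → ℕ → Prop}
    {F : β → ℕ → ℕ → Prop} {c : ℝ≥0∞} (hc : c ≠ ∞)
    (h : ∀ a m n, E a m n → c ≤ prob p (f a) fun b m' n' => F b (m + m') (n + n')) :
    prob p q E * c ≤ prob p (q.bind f) F := by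
  classical
  rw [prob_eq_expect, prob_eq_expect, ← expect_mul_const _ _ hc, expect_bind]
  refine expect_mono fun a m n => ?_
  by_cases hE : E a m n
  · simpa [hE, prob_eq_expect] using h a m n hE
  · simp [hE]

/-! ### Rules for results and costs -/

/-- With (lower) probability at least `c`, the result of `q` fulfills `P` and at most `m` samples
and `n` operations are used. -/
def SucceedsWithin (p : UnitAddTorus (Fin d) → ℂ) (q : Prog d α) (c : ℝ≥0∞) (P : α → Prop)
    (m n : ℕ) : Prop :=
  c ≤ prob p q fun a m' n' => P a ∧ m' ≤ m ∧ n' ≤ n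

/-- For all outcomes of the draws, the result of `q` fulfills `P` and at most `m` samples and `n`
operations are used. -/
def AlwaysWithin (p : UnitAddTorus (Fin d) → ℂ) (q : Prog d α) (P : α → Prop) (m n : ℕ) : Prop :=
  always p q fun a m' n' => P a ∧ m' ≤ m ∧ n' ≤ n

theorem AlwaysWithin.mono {q : Prog d α} {P P' : α → Prop} {m m' n n' : ℕ}
    (h : AlwaysWithin p q P m n) (hP : ∀ a, P a → P' a) (hm : m ≤ m') (hn : n ≤ n') :
    AlwaysWithin p q P' m' n' :=
  always_mono h fun a _ _ ⟨h1, h2, h3⟩ => ⟨hP a h1, h2.trans hm, h3.trans hn⟩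

theorem SucceedsWithin.mono {q : Prog d α} {c c' : ℝ≥0∞} {P P' : α → Prop} {m m' n n' : ℕ}
    (h : SucceedsWithin p q c P m n) (hc : c' ≤ c) (hP : ∀ a, P a → P' a) (hm : m ≤ m')
    (hn : n ≤ n') : SucceedsWithin p q c' P' m' n' :=
  (hc.trans h).trans <| prob_mono fun a _ _ ⟨h1, h2, h3⟩ => ⟨hP a h1, h2.trans hm, h3.trans hn⟩

theorem AlwaysWithin.bind {q : Prog d α} {f : α → Prog d β} {P : α → Prop} {P' : β → Prop}
    {m m' n n' : ℕ} (h : AlwaysWithin p q P m n)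
    (hf : ∀ a, P a → AlwaysWithin p (f a) P' m' n') :
    AlwaysWithin p (q >>= f) P' (m + m') (n + n') := by
  refine (always_bind q f _).2 (always_mono h fun a _ _ ⟨h1, h2, h3⟩ => ?_)
  exact always_mono (hf a h1) fun b _ _ ⟨h4, h5, h6⟩ =>
    ⟨h4, Nat.add_le_add h2 h5, Nat.add_le_add h3 h6⟩

theorem SucceedsWithin.bind {q : Prog d α} {f : α → Prog d β} {c c' : ℝ≥0∞} {P : α → Prop}
    {P' : β → Prop} {m m' n n' : ℕ} (h : SucceedsWithin p q c P m n) (hc' : c' ≠ ∞)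
    (hf : ∀ a, P a → SucceedsWithin p (f a) c' P' m' n') :
    SucceedsWithin p (q >>= f) (c * c') P' (m + m') (n + n') := by
  refine (mul_le_mul_left h c').trans (prob_mul_le_prob_bind hc' fun a _ _ ⟨h1, h2, h3⟩ => ?_)
  exact (hf a h1).trans <| prob_mono fun b _ _ ⟨h4, h5, h6⟩ =>
    ⟨h4, Nat.add_le_add h2 h5, Nat.add_le_add h3 h6⟩

theorem AlwaysWithin.succeedsWithin {q : Prog d α} {c : ℝ≥0∞} {P P' : α → Prop} {m n : ℕ}
    (h : AlwaysWithin p q P m n) (hc : c ≤ prob p q fun a _ _ => P' a) :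
    SucceedsWithin p q c (fun a => P a ∧ P' a) m n :=
  hc.trans <| prob_mono_of_always h fun _ _ _ h1 h2 => ⟨⟨h1.1, h2⟩, h1.2⟩

theorem AlwaysWithin.lift {m : Counted α} {P : α → Prop} {n : ℕ} (hP : P m.val)
    (hn : m.ops ≤ n) : AlwaysWithin p (Prog.lift m) P 0 n :=
  ⟨hP, le_rfl, by simpa using hn⟩

theorem AlwaysWithin.pure {a : α} {P : α → Prop} (hP : P a) :
    AlwaysWithin p (Pure.pure a : Prog d α) P 0 0 :=
  ⟨hP, le_rfl, le_rfl⟩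

theorem SucceedsWithin.lift {m : Counted α} {P : α → Prop} {n : ℕ} (hP : P m.val)
    (hn : m.ops ≤ n) : SucceedsWithin p (Prog.lift m) 1 P 0 n := by
  simp [SucceedsWithin, Prog.lift, prob, hP, hn]

/-! ### Programs with at most one random point -/

/-- `q` makes no draws, its result is `v`, and it uses `m` samples and `n` operations. -/
structure Evaluates (p : UnitAddTorus (Fin d) → ℂ) (q : Prog d α) (v : α) (m n : ℕ) : Prop where
  expect_eq : ∀ φ, expect p q φ = φ v m n
  always_iff : ∀ E, always p q E ↔ E v m n

/-- `q` draws one point `x`, its result is `T x`, and it uses `m` samples and `n x` operations. -/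
structure EvaluatesOnDraw (p : UnitAddTorus (Fin d) → ℂ) (q : Prog d α)
    (T : UnitAddTorus (Fin d) → α) (m : ℕ) (n : UnitAddTorus (Fin d) → ℕ) : Prop where
  expect_eq : ∀ φ, expect p q φ = ∫⁻ x, φ (T x) m (n x) ∂torusMeasure d
  always_iff : ∀ E, always p q E ↔ ∀ x, E (T x) m (n x)

theorem Evaluates.pure (a : α) : Evaluates p (Pure.pure a : Prog d α) a 0 0 :=
  ⟨fun _ => rfl, fun _ => Iff.rfl⟩

theorem Evaluates.lift (m : Counted α) : Evaluates p (Prog.lift m) m.val 0 m.ops :=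
  ⟨fun _ => by simp [Prog.lift, expect], fun _ => by simp [Prog.lift, always]⟩

theorem Evaluates.bind {q : Prog d α} {f : α → Prog d β} {v : α} {w : β} {m n m' n' : ℕ}
    (h : Evaluates p q v m n) (hf : Evaluates p (f v) w m' n') :
    Evaluates p (q >>= f) w (m + m') (n + n') :=
  ⟨fun φ => (expect_bind q f φ).trans (by rw [h.expect_eq, hf.expect_eq]),
    fun E => (always_bind q f E).trans (by rw [h.always_iff, hf.always_iff])⟩

theorem EvaluatesOnDraw.drawPoint :
    EvaluatesOnDraw p (drawPoint : Prog d _) (fun x => x) 0 fun _ => d :=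
  ⟨fun _ => by simp [Prog.drawPoint, expect], fun _ => by simp [Prog.drawPoint, always]⟩

theorem EvaluatesOnDraw.bind {q : Prog d α} {f : α → Prog d β} {T : UnitAddTorus (Fin d) → α}
    {T' : UnitAddTorus (Fin d) → β} {m m' : ℕ} {n n' : UnitAddTorus (Fin d) → ℕ}
    (h : EvaluatesOnDraw p q T m n) (hf : ∀ x, Evaluates p (f (T x)) (T' x) m' (n' x)) :
    EvaluatesOnDraw p (q >>= f) T' (m + m') fun x => n x + n' x :=
  ⟨fun φ => (expect_bind q f φ).trans (by simp only [h.expect_eq, (hf _).expect_eq]),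
    fun E => (always_bind q f E).trans (by simp only [h.always_iff, (hf _).always_iff])⟩

theorem Evaluates.bind_onDraw {q : Prog d α} {f : α → Prog d β} {v : α}
    {T' : UnitAddTorus (Fin d) → β} {m n m' : ℕ} {n' : UnitAddTorus (Fin d) → ℕ}
    (h : Evaluates p q v m n) (hf : EvaluatesOnDraw p (f v) T' m' n') :
    EvaluatesOnDraw p (q >>= f) T' (m + m') fun x => n + n' x :=
  ⟨fun φ => (expect_bind q f φ).trans (by simp only [h.expect_eq, hf.expect_eq]),
    fun E => (always_bind q f E).trans (by simp only [h.always_iff, hf.always_iff])⟩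

theorem evaluates_sampleAll (w : ℕ) (x : ℕ → UnitAddTorus (Fin d)) (n : ℕ) :
    Evaluates p (sampleAll w x n) (fun i => if i < n then p (x i) else 0) n (n * w) := by
  induction n with
  | zero => exact (Nat.zero_mul w).symm ▸ Evaluates.pure (p := p) (0 : ℕ → ℂ)
  | succ n ih =>
    have h2 : Evaluates p (spend w (sample (x n) ret) : Prog d ℂ) (p (x n)) 1 w :=
      ⟨fun _ => by simp [expect], fun _ => by simp [always]⟩
    have h3 : (fun i => if i < n + 1 then p (x i) else 0) =
        Function.update (fun i => if i < n then p (x i) else 0) n (p (x n)) := by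
      funext i
      rcases lt_trichotomy i n with h | rfl | h
      · simp [h, h.ne, Nat.lt_succ_of_lt h]
      · simp
      · simp [h.ne', h.not_gt, (Nat.succ_le_of_lt h).not_gt]
    rw [Nat.succ_mul, h3]
    exact ih.bind (f := fun y => (spend w (sample (x n) ret) : Prog d ℂ) >>= fun v =>
      Pure.pure (Function.update y n v)) (h2.bind (Evaluates.pure _))

/-! ### Unions of independent repetitions -/

variable [DecidableEq β]

theorem AlwaysWithin.unionLoop {q : Prog d (Finset β)} {A : Finset β} {m n : ℕ}
    (h : AlwaysWithin p q (· ⊆ A) m n) (r : ℕ) :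
    AlwaysWithin p (unionLoop q r) (· ⊆ A) (r * m) (r * (n + #A)) := by
  induction r with
  | zero => exact ⟨Finset.empty_subset A, Nat.zero_le _, Nat.zero_le _⟩
  | succ r ih =>
    have h2 : AlwaysWithin p (Prog.unionLoop q (r + 1)) (· ⊆ A) (r * m + (m + 0))
        (r * (n + #A) + (n + #A)) := by
      refine ih.bind fun I hI => h.bind fun T hT => ?_
      exact ⟨Finset.union_subset hI hT, le_rfl, by simpa using card_le_card hT⟩
    exact h2.mono (fun _ h => h) (by rw [Nat.succ_mul]; simp) (by rw [Nat.succ_mul])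

/-- If every `k ∈ A` is missed by one repetition with probability at most `ρ`, then the expected
number of elements of `A` that are missed by `r` repetitions is at most `#A * ρ ^ r`.  In the
induction the weight `a` of a missing element absorbs the factors `ρ` of later repetitions. -/
theorem expect_unionLoop {q : Prog d (Finset β)} {T : UnitAddTorus (Fin d) → Finset β} {m : ℕ}
    {n : UnitAddTorus (Fin d) → ℕ} (hq : EvaluatesOnDraw p q T m n) {A : Finset β} {ρ : ℝ≥0∞}
    (hρ : ∀ k ∈ A, ∃ U, MeasurableSet U ∧ (∀ x, k ∉ T x → x ∈ U) ∧ torusMeasure d U ≤ ρ)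
    (r : ℕ) (a : ℝ≥0∞) :
    1 - #A * (ρ ^ r * a) ≤ expect p (unionLoop q r) fun I _ _ => 1 - #(A \ I) * a := by
  induction r generalizing a with
  | zero =>
    refine le_of_eq ?_
    change _ = 1 - (#(A \ ∅) : ℝ≥0∞) * a
    simp
  | succ r ih =>
    have h1 := ih (ρ * a)
    have h2 : ∀ φ, expect p (unionLoop q (r + 1)) φ = expect p (unionLoop q r) fun I m' n' =>
        ∫⁻ x, φ (I ∪ T x) (m' + m) (n' + (n x + #(T x))) ∂torusMeasure d := by
      intro φ
      change expect p ((unionLoop q r).bind fun I => q.bind fun T =>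
        spend #T (Prog.ret (I ∪ T))) φ = _
      simp only [expect_bind, expect, hq.expect_eq, add_zero]
    rw [h2]
    refine le_trans (le_of_eq (by ring_nf)) (h1.trans (expect_mono fun I _ _ => ?_))
    -- The lower expectation is additive for the measurable `g`, which bounds the number of missed
    -- elements; that number itself need not be measurable.
    choose! U hU1 hU2 hU3 using hρ
    set g : UnitAddTorus (Fin d) → ℝ≥0∞ :=
      fun x => ∑ k ∈ A \ I, (U k).indicator (fun _ => a) x with hg
    have hgm : Measurable g := Finset.measurable_sum _ fun k hk =>
      measurable_const.indicator (hU1 k (mem_sdiff.1 hk).1)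
    have hgi : ∫⁻ x, g x ∂torusMeasure d ≤ #(A \ I) * (ρ * a) := by
      rw [hg, lintegral_finsetSum _ fun k hk =>
        measurable_const.indicator (hU1 k (mem_sdiff.1 hk).1), ← nsmul_eq_mul]
      refine Finset.sum_le_card_nsmul _ _ _ fun k hk => ?_
      rw [lintegral_indicator (hU1 k (mem_sdiff.1 hk).1), setLIntegral_const, mul_comm]
      exact mul_le_mul_left (hU3 k (mem_sdiff.1 hk).1) _
    have hle : ∀ x, 1 - g x ≤ 1 - (#(A \ (I ∪ T x)) : ℝ≥0∞) * a := by
      intro x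
      refine tsub_le_tsub_left ?_ 1
      rw [← nsmul_eq_mul, ← Finset.sum_const]
      refine (Finset.sum_le_sum (g := fun k => (U k).indicator (fun _ => a) x) fun k hk => ?_).trans
        (Finset.sum_le_sum_of_subset (sdiff_subset_sdiff le_rfl subset_union_left))
      simp only [mem_sdiff, mem_union, not_or] at hk
      simp [hU2 k hk.1 x hk.2.2]
    refine le_trans ?_ (lintegral_mono hle)
    rw [tsub_le_iff_right]
    calc (1 : ℝ≥0∞) = ∫⁻ _, 1 ∂torusMeasure d := by simp
      _ ≤ ∫⁻ x, ((1 - g x) + g x) ∂torusMeasure d := lintegral_mono fun x => le_tsub_add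
      _ = ∫⁻ x, (1 - g x) ∂torusMeasure d + ∫⁻ x, g x ∂torusMeasure d :=
        lintegral_add_right _ hgm
      _ ≤ _ := by gcongr

theorem prob_unionLoop {q : Prog d (Finset β)} {T : UnitAddTorus (Fin d) → Finset β} {m : ℕ}
    {n : UnitAddTorus (Fin d) → ℕ} (hq : EvaluatesOnDraw p q T m n) {A : Finset β}
    (hA : ∀ x, T x ⊆ A) {ρ : ℝ≥0∞}
    (hρ : ∀ k ∈ A, ∃ U, MeasurableSet U ∧ (∀ x, k ∉ T x → x ∈ U) ∧ torusMeasure d U ≤ ρ)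
    (r : ℕ) : 1 - #A * ρ ^ r ≤ prob p (unionLoop q r) fun I _ _ => I = A := by
  classical
  have h1 : always p q fun I _ _ => I ⊆ A := (hq.always_iff _).2 hA
  have h2 : always p (unionLoop q r) fun I _ _ => I ⊆ A := by
    induction r with
    | zero => exact Finset.empty_subset A
    | succ r ih =>
      refine (always_bind _ _ _).2 (always_mono ih fun I _ _ hI => ?_)
      refine (always_bind _ _ _).2 (always_mono h1 fun T _ _ hT => ?_)
      exact union_subset hI hT
  rw [prob_eq_expect]
  have h3 := expect_unionLoop hq hρ r 1
  simp only [mul_one] at h3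
  refine h3.trans (expect_mono_of_always h2 fun I _ _ hI => ?_)
  by_cases hIA : I = A
  · simp [hIA]
  · have h4 : (1 : ℝ≥0∞) ≤ #(A \ I) := by
      have : 0 < #(A \ I) := card_pos.2 (sdiff_nonempty.2 fun h => hIA (hI.antisymm h))
      exact_mod_cast this
    simp [tsub_eq_zero_of_le h4]

end Prog

end Programs

/-! ### Correctness and cost of the fast Fourier transform -/

namespace Counted

@[simp] theorem val_bind {α β : Type} (m : Counted α) (f : α → Counted β) :
    (m >>= f).val = (f m.val).val := rfl

@[simp] theorem ops_bind {α β : Type} (m : Counted α) (f : α → Counted β) :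
    (m >>= f).ops = m.ops + (f m.val).ops := rfl

@[simp] theorem val_pure {α : Type} (a : α) : (pure a : Counted α).val = a := rfl

@[simp] theorem ops_pure {α : Type} (a : α) : (pure a : Counted α).ops = 0 := rfl

@[simp] theorem val_op {α : Type} (a : α) : (op a).val = a := rfl

@[simp] theorem ops_op {α : Type} (a : α) : (op a).ops = 1 := rfl

theorem val_forAll {ι α : Type} [DecidableEq ι] [Zero α] (S : Finset ι) (f : ι → Counted α)
    (i : ι) : (forAll S f).val i = if i ∈ S then (f i).val else 0 := rfl

theorem ops_forAll {ι α : Type} [DecidableEq ι] [Zero α] (S : Finset ι) (f : ι → Counted α) :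
    (forAll S f).ops = ∑ i ∈ S, (f i).ops := rfl

theorem ops_forAll_le {ι α : Type} [DecidableEq ι] [Zero α] (S : Finset ι) (f : ι → Counted α)
    (n : ℕ) (h : ∀ i ∈ S, (f i).ops ≤ n) : (forAll S f).ops ≤ #S * n :=
  (Finset.sum_le_card_nsmul _ _ _ h).trans (by simp)

open Complex in
/-- The half-length transforms in `fftTwo` are periodic. -/
theorem exp_mod (σ : ℝ) (hσ : σ = 1 ∨ σ = -1) (m j k : ℕ) :
    exp (2 * Real.pi * I * σ * j * (k % 2 ^ m : ℕ) / 2 ^ m) =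
      exp (2 * Real.pi * I * σ * j * k / 2 ^ m) := by
  have hk : (k : ℂ) = (k % 2 ^ m : ℕ) + 2 ^ m * (k / 2 ^ m : ℕ) := by
    exact_mod_cast (Nat.mod_add_div k (2 ^ m)).symm
  have h2 : (2 : ℂ) ^ m ≠ 0 := pow_ne_zero m two_ne_zero
  conv_rhs => rw [hk]
  rw [show 2 * (Real.pi : ℂ) * I * σ * j * ((k % 2 ^ m : ℕ) + 2 ^ m * (k / 2 ^ m : ℕ)) / 2 ^ m =
    2 * Real.pi * I * σ * j * (k % 2 ^ m : ℕ) / 2 ^ m +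
      (σ * (j * (k / 2 ^ m : ℕ))) * (2 * Real.pi * I) by field_simp, exp_add]
  generalize k / 2 ^ m = e
  have h1 : exp ((σ * (j * e)) * (2 * Real.pi * I)) = 1 := by
    refine exp_eq_one_iff.2 ?_
    rcases hσ with rfl | rfl
    · exact ⟨j * e, by push_cast; ring⟩
    · exact ⟨-(j * e), by push_cast; ring⟩
  rw [h1, mul_one]

open Complex in
/-- The radix-2 transform, by splitting into even and odd positions. -/
theorem val_fftTwo (σ : ℝ) (hσ : σ = 1 ∨ σ = -1) (m : ℕ) (x : ℕ → ℂ) (k : ℕ) (hk : k < 2 ^ m) :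
    (fftTwo σ m x).val k =
      ∑ j ∈ range (2 ^ m), x j * exp (2 * Real.pi * I * σ * j * k / 2 ^ m) := by
  induction m generalizing x k with
  | zero =>
    have : k = 0 := by simpa using hk
    subst this
    simp [fftTwo]
  | succ m ih =>
    have hm : k % 2 ^ m < 2 ^ m := Nat.mod_lt _ (by positivity)
    have h2 : (2 : ℂ) ^ m ≠ 0 := pow_ne_zero m two_ne_zero
    have hsum : ∀ f : ℕ → ℂ, ∑ j ∈ range (2 ^ (m + 1)), f j =
        ∑ j ∈ range (2 ^ m), f (2 * j) + ∑ j ∈ range (2 ^ m), f (2 * j + 1) := by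
      intro f
      rw [pow_succ, mul_comm, ← Finset.sum_add_distrib]
      induction 2 ^ m with
      | zero => simp
      | succ n ihn => rw [Nat.mul_succ, Finset.sum_range_succ, Finset.sum_range_succ, ihn,
          Finset.sum_range_succ]; ring
    rw [hsum]
    simp only [fftTwo, val_bind, val_forAll, mem_range, hk, if_true, val_op]
    rw [ih _ _ hm, ih _ _ hm, Finset.mul_sum]
    congr 1
    · refine Finset.sum_congr rfl fun j _ => ?_
      rw [exp_mod σ hσ]
      congr 2
      push_cast
      rw [pow_succ]
      field_simp
    · refine Finset.sum_congr rfl fun j _ => ?_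
      rw [exp_mod σ hσ, mul_left_comm, ← exp_add]
      congr 2
      push_cast
      rw [pow_succ]
      field_simp
      ring

theorem ops_fftTwo (σ : ℝ) (m : ℕ) (x : ℕ → ℂ) : (fftTwo σ m x).ops = 7 * m * 2 ^ m := by
  induction m generalizing x with
  | zero => simp [fftTwo]
  | succ m ih =>
    simp only [fftTwo, ops_bind, ops_forAll, ih, ops_op, Finset.sum_const, card_range]
    simp only [smul_eq_mul]
    ring

open Complex in
/-- Orthogonality of the characters of `ℤ/n`. -/
theorem sum_exp_eq_zero {n : ℕ} {a : ℤ} (ha : ¬ (n : ℤ) ∣ a) :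
    ∑ j ∈ range n, exp (2 * Real.pi * I * j * a / n) = 0 := by
  rcases Nat.eq_zero_or_pos n with rfl | hn
  · simp
  have hn' : (n : ℂ) ≠ 0 := by exact_mod_cast hn.ne'
  set w := exp (2 * Real.pi * I * a / n) with hw
  have h1 : ∀ j : ℕ, exp (2 * Real.pi * I * j * a / n) = w ^ j := by
    intro j
    rw [hw, ← exp_nat_mul]
    congr 1
    ring
  have hw1 : w ≠ 1 := by
    intro h
    obtain ⟨m, hm⟩ := exp_eq_one_iff.1 h
    have hpi : (Real.pi : ℂ) ≠ 0 := by exact_mod_cast Real.pi_ne_zero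
    refine ha ⟨m, ?_⟩
    field_simp at hm
    exact_mod_cast hm
  have hwn : w ^ n = 1 := by
    rw [hw, ← exp_nat_mul]
    refine exp_eq_one_iff.2 ⟨a, ?_⟩
    field_simp
  rw [Finset.sum_congr rfl fun j _ => h1 j, geom_sum_eq hw1, hwn]
  simp

open Complex in
theorem sum_exp_eq_ite {n : ℕ} (hn : 0 < n) (a : ℤ) :
    ∑ j ∈ range n, exp (2 * Real.pi * I * j * a / n) = if (n : ℤ) ∣ a then (n : ℂ) else 0 := by
  split_ifs with h
  · obtain ⟨m, rfl⟩ := h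
    have hn' : (n : ℂ) ≠ 0 := by exact_mod_cast hn.ne'
    have h1 : ∀ j ∈ range n, exp (2 * Real.pi * I * j * ((n * m : ℤ) : ℂ) / n) = 1 :=
      fun j _ => exp_eq_one_iff.2 ⟨j * m, by push_cast; field_simp⟩
    rw [Finset.sum_congr rfl h1]
    simp
  · exact sum_exp_eq_zero h

open Complex in
/-- The convolution theorem for the discrete Fourier transform. -/
theorem sum_dft_mul_dft {n : ℕ} (hn : 0 < n) (u v : ℕ → ℂ) (k : ℕ) (hk : k < n) :
    ∑ l ∈ range n, ((∑ i ∈ range n, u i * exp (2 * Real.pi * I * (-1 : ℝ) * i * l / n)) *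
      (∑ i ∈ range n, v i * exp (2 * Real.pi * I * (-1 : ℝ) * i * l / n))) *
        exp (2 * Real.pi * I * (1 : ℝ) * l * k / n) =
      n * ∑ i ∈ range n, u i * v (if i ≤ k then k - i else n + k - i) := by
  have hn' : (n : ℂ) ≠ 0 := by exact_mod_cast hn.ne'
  calc _ = ∑ i ∈ range n, ∑ j ∈ range n, u i * v j *
        ∑ l ∈ range n, exp (2 * Real.pi * I * l * ((k - i - j : ℤ) : ℂ) / n) := by
        rw [Finset.sum_congr rfl fun l _ => by rw [Finset.sum_mul_sum, Finset.sum_mul]]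
        rw [Finset.sum_comm]
        refine Finset.sum_congr rfl fun i _ => ?_
        rw [Finset.sum_congr rfl fun l _ => by rw [Finset.sum_mul]]
        rw [Finset.sum_comm]
        refine Finset.sum_congr rfl fun j _ => ?_
        rw [Finset.mul_sum]
        refine Finset.sum_congr rfl fun l _ => ?_
        rw [show 2 * (Real.pi : ℂ) * I * l * ((k - i - j : ℤ) : ℂ) / n =
          2 * Real.pi * I * (-1 : ℝ) * i * l / n + 2 * Real.pi * I * (-1 : ℝ) * j * l / n +
            2 * Real.pi * I * (1 : ℝ) * l * k / n by push_cast; ring, exp_add, exp_add]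
        ring
    _ = ∑ i ∈ range n, u i * v (if i ≤ k then k - i else n + k - i) * n := by
        refine Finset.sum_congr rfl fun i hi => ?_
        rw [mem_range] at hi
        set j₀ := if i ≤ k then k - i else n + k - i with hj₀
        have hj₀n : j₀ < n := by rw [hj₀]; split_ifs <;> omega
        rw [Finset.sum_eq_single_of_mem j₀ (mem_range.2 hj₀n), sum_exp_eq_ite hn, if_pos]
        · rw [hj₀]
          split_ifs with h
          · exact ⟨0, by omega⟩
          · exact ⟨-1, by omega⟩
        · intro j hj hne
          rw [mem_range] at hj
          rw [sum_exp_eq_ite hn, if_neg, mul_zero]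
          rintro ⟨e, he⟩
          apply hne
          rw [hj₀]
          have h1 : e < 1 := by nlinarith
          have h2 : -2 < e := by nlinarith
          obtain rfl | rfl : e = 0 ∨ e = -1 := by omega
          · split_ifs <;> omega
          · split_ifs <;> omega
    _ = _ := by rw [Finset.mul_sum]; exact Finset.sum_congr rfl fun i _ => by ring

open Complex in
theorem exp_conj_I (x : ℝ) : (starRingEnd ℂ) (exp (x * I)) = exp (-(x * I)) := by
  rw [← exp_conj]
  simp

open Complex in
/-- The chirp transform is exact: with `2 j k = j² + k² - (k - j)²` the transform becomes a
convolution, computed by cyclic convolution of a length `2 ^ m ≥ 2 M` that prevents overlaps. -/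
theorem val_fft (M : ℕ) (a : ℕ → ℂ) (k : ℕ) (hk : k < M) :
    (fft M a).val k = ∑ j ∈ range M, a j * exp (-(2 * Real.pi * I * j * k / M)) := by
  have hM : 0 < M := by omega
  set m := Nat.clog 2 (2 * M) with hm
  have hn : 2 * M ≤ 2 ^ m := Nat.le_pow_clog (by norm_num) _
  have hkn : k < 2 ^ m := by omega
  simp only [fft, val_bind, val_forAll, ← hm, mem_range, hk, if_true, val_op]
  rw [val_fftTwo 1 (Or.inl rfl) m _ k hkn]
  have hU : ∀ (u : ℕ → ℂ), ∀ l ∈ range (2 ^ m), (fftTwo (-1) m u).val l =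
      ∑ j ∈ range (2 ^ m), u j * exp (2 * Real.pi * I * (-1 : ℝ) * j * l / (2 ^ m : ℕ)) := by
    intro u l hl
    rw [val_fftTwo (-1) (Or.inr rfl) m u l (mem_range.1 hl)]
    push_cast
    rfl
  have h2 : ((2 ^ m : ℕ) : ℂ) ≠ 0 := by
    push_cast; exact pow_ne_zero m two_ne_zero
  have hMc : (M : ℂ) ≠ 0 := by exact_mod_cast hM.ne'
  generalize hu : (forAll (range (2 ^ m)) fun j => if j < M then
    (⟨a j * (starRingEnd ℂ) (if j < M then exp (Real.pi * I * (j : ℂ) ^ 2 / M) else 0), 3⟩ :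
      Counted ℂ) else ⟨0, 1⟩).val = u
  generalize hv : (forAll (range (2 ^ m)) fun j => (⟨if min j (2 ^ m - j) < M then
    exp (Real.pi * I * (min j (2 ^ m - j) : ℕ) ^ 2 / M) else 0, 2⟩ : Counted ℂ)).val = v
  have hsum : ∑ j ∈ range (2 ^ m), (if j < 2 ^ m then
      (fftTwo (-1) m u).val j * (fftTwo (-1) m v).val j else 0) *
      exp (2 * Real.pi * I * (1 : ℝ) * j * k / 2 ^ m) =
      (2 ^ m : ℕ) * ∑ i ∈ range (2 ^ m), u i * v (if i ≤ k then k - i else 2 ^ m + k - i) := by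
    rw [← sum_dft_mul_dft (by positivity) u v k hkn]
    refine Finset.sum_congr rfl fun l hl => ?_
    rw [if_pos (mem_range.1 hl), hU u l hl, hU v l hl]
    push_cast
    rfl
  have hconv : ∑ i ∈ range (2 ^ m), u i * v (if i ≤ k then k - i else 2 ^ m + k - i) =
      ∑ j ∈ range M, a j * exp (-(Real.pi * I * j ^ 2 / M)) *
        exp (Real.pi * I * (k - j) ^ 2 / M) := by
    rw [← Finset.sum_subset (range_subset_range.2 (by omega : M ≤ 2 ^ m))]
    · refine Finset.sum_congr rfl fun j hj => ?_
      rw [mem_range] at hj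
      have e1 : u j = a j * exp (-(Real.pi * I * j ^ 2 / M)) := by
        rw [← hu, val_forAll, if_pos (mem_range.2 (by omega))]
        simp only [hj, if_true]
        rw [show (Real.pi * I * (j : ℂ) ^ 2 / M) = ((Real.pi * (j : ℝ) ^ 2 / M : ℝ) : ℂ) * I by
          push_cast; ring, exp_conj_I]
      have e2 : ∀ i, i < 2 ^ m → ∀ e : ℕ, e < M → (min i (2 ^ m - i) = e) →
          v i = exp (Real.pi * I * (e : ℂ) ^ 2 / M) := by
        intro i hi e he hie
        rw [← hv, val_forAll, if_pos (mem_range.2 hi)]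
        simp only [hie, he, if_true]
      rw [e1]
      congr 1
      split_ifs with h
      · rw [e2 (k - j) (by omega) (k - j) (by omega) (by omega), Nat.cast_sub h]
      · rw [e2 (2 ^ m + k - j) (by omega) (j - k) (by omega) (by omega),
          Nat.cast_sub (by omega)]
        congr 2
        ring
    · intro i hi hi'
      rw [mem_range] at hi hi'
      have : u i = 0 := by
        rw [← hu, val_forAll, if_pos (mem_range.2 hi)]
        simp [hi']
      rw [this, zero_mul]
  rw [show (Real.pi * I * (k : ℂ) ^ 2 / M) = ((Real.pi * (k : ℝ) ^ 2 / M : ℝ) : ℂ) * I by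
          push_cast; ring, exp_conj_I]
  simp only [val_forAll, val_op, mem_range]
  rw [hsum, hconv, mul_div_cancel_left₀ _ h2, Finset.sum_mul]
  refine Finset.sum_congr rfl fun j _ => ?_
  rw [mul_assoc, mul_assoc, ← exp_add, ← exp_add]
  congr 2
  push_cast
  field_simp
  ring

theorem ops_fft_le (M W : ℕ) (a : ℕ → ℂ) (hM : 1 ≤ M) (hW : Nat.clog 2 (2 * M) ≤ W) (hW1 : 1 ≤ W) :
    (fft M a).ops ≤ 120 * M * W := by
  set m := Nat.clog 2 (2 * M) with hm
  have hn : 2 ^ m ≤ 4 * M := by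
    have h := Nat.pow_pred_clog_lt_self (b := 2) (by norm_num) (x := 2 * M) (by omega)
    rw [← hm] at h
    have hm0 : m ≠ 0 := by
      intro h0
      have := Nat.le_pow_clog (b := 2) (by norm_num) (2 * M)
      rw [← hm, h0] at this
      omega
    obtain ⟨e, he⟩ := Nat.exists_eq_succ_of_ne_zero hm0
    rw [he] at h ⊢
    rw [Nat.pred_succ] at h
    rw [pow_succ]
    omega
  simp only [fft, ops_bind, ← hm, ops_fftTwo, val_forAll]
  have h2 : 7 * m * 2 ^ m ≤ 28 * M * W := by nlinarith [Nat.mul_le_mul hn hW]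
  refine (Nat.add_le_add (ops_forAll_le _ _ 5 fun i _ => le_rfl)
    (Nat.add_le_add (ops_forAll_le _ _ 3 fun i _ => ?_)
    (Nat.add_le_add (ops_forAll_le _ _ 2 fun i _ => le_rfl)
    (Nat.add_le_add h2 (Nat.add_le_add h2 (Nat.add_le_add (ops_forAll_le _ _ 1 fun i _ => le_rfl)
    (Nat.add_le_add h2 (ops_forAll_le _ _ 3 fun i _ => le_rfl)))))))).trans ?_
  · split_ifs <;> simp
  · simp only [card_range]
    nlinarith [Nat.mul_le_mul_left M hW1]

/-! ### Sorting and selecting -/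

theorem perm_merge {β : Type} (v : β → ℝ) (l l' : List β) :
    (merge v l l').val.Perm (l ++ l') ∧ (merge v l l').ops ≤ l.length + l'.length := by
  induction l, l' using merge.induct with
  | case1 l => simp [merge]
  | case2 l h => cases l <;> simp [merge]
  | case3 a l b l' ih1 ih2 =>
    rw [merge]
    simp only [val_bind, ops_bind, val_op, ops_op]
    by_cases h : v b ≤ v a
    · simp only [h, decide_true, if_true, val_bind, ops_bind, val_pure, ops_pure]
      refine ⟨(ih1.1.cons a).trans (by simp), ?_⟩
      have := ih1.2
      simp only [List.length_cons] at this ⊢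
      omega
    · simp only [h, decide_false, Bool.false_eq_true, if_false, val_bind, ops_bind, val_pure,
        ops_pure]
      refine ⟨(ih2.1.cons b).trans (List.perm_middle.symm), ?_⟩
      have := ih2.2
      simp only [List.length_cons] at this ⊢
      omega

theorem perm_mergeSort {β : Type} (v : β → ℝ) (m : ℕ) (l : List β) :
    (mergeSort v m l).val.Perm l ∧ (mergeSort v m l).ops ≤ m * l.length := by
  induction m generalizing l with
  | zero => simp [mergeSort]
  | succ m ih =>
    obtain ⟨h1, h2⟩ := ih (l.take (l.length / 2))
    obtain ⟨h3, h4⟩ := ih (l.drop (l.length / 2))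
    obtain ⟨h5, h6⟩ := perm_merge v (mergeSort v m (l.take (l.length / 2))).val
      (mergeSort v m (l.drop (l.length / 2))).val
    simp only [mergeSort, val_bind, ops_bind]
    refine ⟨h5.trans ((h1.append h3).trans (by rw [List.take_append_drop])), ?_⟩
    rw [h1.length_eq, h3.length_eq] at h6
    have h7 : (l.take (l.length / 2)).length + (l.drop (l.length / 2)).length = l.length := by
      rw [← List.length_append, List.take_append_drop]
    rw [Nat.succ_mul]
    nlinarith

section Select

variable {β : Type} [DecidableEq β] (A : Finset β) (g : β → ℂ) (δ : ℝ) (s : ℕ)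

theorem val_select_subset : (select A g δ s).val ⊆ {k ∈ A | δ ≤ ‖g k‖} := by
  intro k hk
  simp only [select, val_bind, val_pure, List.mem_toFinset] at hk
  have h1 := List.mem_of_mem_take hk
  rw [(perm_mergeSort _ _ _).1.mem_iff, mem_toList, mem_filter, val_forAll] at h1
  rw [mem_filter]
  refine ⟨h1.1, ?_⟩
  simpa [h1.1] using h1.2

/-- With at most `s` sufficiently large values, none of them is dropped, and ties do not matter. -/
theorem val_select (h : #{k ∈ A | δ ≤ ‖g k‖} ≤ s) :
    (select A g δ s).val = {k ∈ A | δ ≤ ‖g k‖} := by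
  have hB : ({k ∈ A | δ ≤ (forAll A fun k => (⟨‖g k‖, 4⟩ : Counted ℝ)).val k} : Finset β) =
      {k ∈ A | δ ≤ ‖g k‖} :=
    Finset.filter_congr fun k hk => by rw [val_forAll, if_pos hk]
  simp only [select, val_bind, val_pure, hB]
  rw [List.take_of_length_le]
  · ext k
    rw [List.mem_toFinset, (perm_mergeSort _ _ _).1.mem_iff, mem_toList]
  · rw [(perm_mergeSort _ _ _).1.length_eq, length_toList]
    exact h

theorem ops_select_le {W : ℕ} (hW : Nat.clog 2 #A ≤ W) :
    (select A g δ s).ops ≤ #A * (5 + W) := by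
  simp only [select, ops_bind, ops_pure]
  have h1 := (perm_mergeSort (forAll A fun k => (⟨‖g k‖, 4⟩ : Counted ℝ)).val
    (Nat.clog 2 #{k ∈ A | δ ≤ (forAll A fun k => (⟨‖g k‖, 4⟩ : Counted ℝ)).val k})
    ({k ∈ A | δ ≤ (forAll A fun k => (⟨‖g k‖, 4⟩ : Counted ℝ)).val k} : Finset β).toList).2
  rw [length_toList] at h1
  have h2 : #{k ∈ A | δ ≤ (forAll A fun k => (⟨‖g k‖, 4⟩ : Counted ℝ)).val k} ≤ #A :=
    card_filter_le _ _
  have h3 := (Nat.clog_mono_right 2 h2).trans hW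
  have h4 : (forAll A fun k => (⟨‖g k‖, 4⟩ : Counted ℝ)).ops ≤ #A * 4 :=
    ops_forAll_le _ _ _ fun _ _ => le_rfl
  have h5 := Nat.mul_le_mul h3 h2
  nlinarith

end Select

end Counted

/-! ### The sizes of the lattices -/

section LatticeSizes

open Filter in
/-- By Chebyshev's bounds, an interval `(x, C x]` contains far more than `2 log x` primes. -/
theorem exists_forall_le_card_primes : ∃ C : ℕ, 1 ≤ C ∧ ∀ x : ℕ, 2 ≤ x →
    ⌈2 * Real.log x⌉₊ ≤ #{q ∈ Ioc x (C * x) | q.Prime} := by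
  -- The error terms in the lower bound for `θ(y)` and the number of primes asked for, compared with
  -- the linear term.
  have h1 : ∀ᶠ y : ℝ in atTop, Real.log (y + 1) + 2 * √y * Real.log y +
      (2 * Real.log y + 1) * Real.log y ≤ (1 / 6) * y := by
    have h2 := (isLittleO_log_rpow_atTop (r := 1 / 4) (by norm_num)).bound
      (show (0 : ℝ) < 1 / 100 by norm_num)
    filter_upwards [h2, eventually_ge_atTop (10 : ℝ)] with y hy hy10
    have hy0 : 0 ≤ y := by linarith
    set u : ℝ := y ^ (1 / 4 : ℝ) with hu
    have hu0 : 0 ≤ u := Real.rpow_nonneg hy0 _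
    have hu2 : √y = u ^ 2 := by
      rw [Real.sqrt_eq_rpow, hu, ← Real.rpow_natCast, ← Real.rpow_mul hy0]
      norm_num
    have hu4 : y = u ^ 4 := by
      rw [hu, ← Real.rpow_natCast, ← Real.rpow_mul hy0]
      norm_num
    have hu1 : 1 ≤ u := Real.one_le_rpow (by linarith) (by norm_num)
    have hl0 : 0 ≤ Real.log y := Real.log_nonneg (by linarith)
    have hl : Real.log y ≤ 1 / 100 * u := by
      rwa [Real.norm_of_nonneg hl0, Real.norm_of_nonneg hu0] at hy
    have hl1 : Real.log (y + 1) ≤ Real.log y + 1 := by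
      have h3 : Real.log (y + 1) = Real.log y + Real.log (1 + 1 / y) := by
        rw [← Real.log_mul (by positivity) (by positivity)]
        congr 1
        field_simp
      have h4 := Real.log_le_sub_one_of_pos (show 0 < 1 + 1 / y by positivity)
      have h5 : 1 / y ≤ 1 := by rw [div_le_one (by linarith)]; linarith
      linarith
    rw [hu2]
    have h5 : u ≤ y := by
      rw [hu4]
      exact le_self_pow₀ hu1 (by norm_num)
    have h6 : u ^ 2 * u ≤ y := by
      rw [hu4, ← pow_succ]
      exact pow_le_pow_right₀ hu1 (by norm_num)
    have h7 : u * u ≤ y := by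
      rw [hu4, ← sq]
      exact pow_le_pow_right₀ hu1 (by norm_num)
    have h8 : u ^ 2 * Real.log y ≤ 1 / 100 * y := by nlinarith [sq_nonneg u]
    have h9 : Real.log y * Real.log y ≤ 1 / 100 * y := by nlinarith
    linarith
  obtain ⟨Y, hY⟩ := (h1.and (eventually_ge_atTop (0 : ℝ))).exists_forall_of_atTop
  refine ⟨max 3 ⌈Y⌉₊, by simp, fun x hx => ?_⟩
  set C := max 3 ⌈Y⌉₊ with hC
  have hC3 : 3 ≤ C := le_max_left _ _
  have hx' : (2 : ℝ) ≤ x := by exact_mod_cast hx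
  have hC3' : (3 : ℝ) ≤ C := by exact_mod_cast hC3
  have hCx : Y ≤ ((C * x : ℕ) : ℝ) := by
    have : (⌈Y⌉₊ : ℝ) ≤ C := by exact_mod_cast le_max_right _ _
    push_cast
    nlinarith [Nat.le_ceil Y]
  obtain ⟨h2, -⟩ := hY _ hCx
  have h3 := Chebyshev.theta_ge (C * x)
  have h4 := Chebyshev.theta_le_log4_mul_x (x := (x : ℝ)) (by positivity)
  have hlog2 : (0.69 : ℝ) < Real.log 2 := by linarith [Real.log_two_gt_d9]
  have hlog2' : Real.log 2 < (0.7 : ℝ) := by linarith [Real.log_two_lt_d9]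
  have hlog4 : Real.log 4 = 2 * Real.log 2 := by
    rw [show (4 : ℝ) = 2 ^ 2 by norm_num, Real.log_pow]; norm_num
  -- Every prime in `(x, C x]` contributes at most `log (C x)` to `θ(C x) - θ(x)`.
  have h5 : Chebyshev.theta (C * x : ℕ) - Chebyshev.theta x ≤
      #{q ∈ Ioc x (C * x) | q.Prime} * Real.log (C * x : ℕ) := by
    have hxC : x ≤ C * x := by nlinarith
    rw [Chebyshev.theta, Chebyshev.theta, Nat.floor_natCast, Nat.floor_natCast]
    have : ({q ∈ Ioc 0 (C * x) | q.Prime} : Finset ℕ) =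
        {q ∈ Ioc 0 x | q.Prime} ∪ {q ∈ Ioc x (C * x) | q.Prime} := by
      rw [← filter_union, Ioc_union_Ioc_eq_Ioc (by omega) hxC]
    rw [this, Finset.sum_union, add_sub_cancel_left, ← nsmul_eq_mul]
    · refine Finset.sum_le_card_nsmul _ _ _ fun q hq => ?_
      rw [mem_filter, mem_Ioc] at hq
      exact Real.log_le_log (by exact_mod_cast hq.2.pos) (by exact_mod_cast hq.1.2)
    · refine Finset.disjoint_left.2 fun q hq hq' => ?_
      rw [mem_filter, mem_Ioc] at hq hq'
      omega
  set y : ℝ := ((C * x : ℕ) : ℝ) with hy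
  have hyx : 3 * (x : ℝ) ≤ y := by rw [hy]; push_cast; nlinarith
  have hlogy : 0 < Real.log y := Real.log_pos (by linarith)
  have hlogx : Real.log x ≤ Real.log y := Real.log_le_log (by linarith) (by linarith)
  have h6 : (2 * Real.log y + 1) * Real.log y ≤
      #{q ∈ Ioc x (C * x) | q.Prime} * Real.log y := by
    refine le_trans ?_ h5
    rw [hlog4] at h4
    have h7 : 0.52 * y ≥ 0 := by linarith
    have h8 : 0.69 * y ≤ y * Real.log 2 := by nlinarith
    have h9 : 2 * Real.log 2 * x ≤ 1.4 / 3 * y := by nlinarith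
    linarith
  have h7 := le_of_mul_le_mul_right h6 hlogy
  have h8 : (⌈2 * Real.log x⌉₊ : ℝ) < 2 * Real.log x + 1 :=
    Nat.ceil_lt_add_one (by have := Real.log_nonneg (show (1 : ℝ) ≤ x by linarith); linarith)
  have h9 : (⌈2 * Real.log x⌉₊ : ℝ) ≤ #{q ∈ Ioc x (C * x) | q.Prime} := by linarith
  exact_mod_cast h9

variable {t N : ℕ} {J : Finset (Freq t)}

/-- Primes above `2 N` separate the points of the grid `{-N, …, N}ᵗ`. -/
theorem isLatticeSize_of_lt (hJ : J ⊆ fullGrid t N) {q : ℕ} (hq : q.Prime) (hN : 2 * N < q)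
    (hJq : 2 * ((#J : ℝ) - 1) < q) : IsLatticeSize 2 J q := by
  refine ⟨hq, hJq, card_image_iff.2 fun k hk h hh hkh => ?_⟩
  funext i
  have h1 := congrFun hkh i
  have h2 := hJ hk
  have h3 := hJ hh
  simp only [fullGrid, Fintype.mem_piFinset, mem_Icc] at h2 h3
  have h4 := h2 i
  have h5 := h3 i
  have h6 : (q : ℤ) ∣ k i - h i := Int.ModEq.dvd (Int.ModEq.symm h1)
  have h7 : k i - h i = 0 := Int.eq_zero_of_abs_lt_dvd h6 (by rw [abs_lt]; omega)
  omega

theorem infinite_isLatticeSize (hJ : J ⊆ fullGrid t N) : {q | IsLatticeSize 2 J q}.Infinite := by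
  refine Set.infinite_of_not_bddAbove fun ⟨b, hb⟩ => ?_
  obtain ⟨q, hq, hqp⟩ := Nat.exists_infinite_primes (b + 2 * N + 2 * #J + 1)
  have h1 := hb (isLatticeSize_of_lt hJ hqp (by omega) (by
    have : ((b + 2 * N + 2 * #J + 1 : ℕ) : ℝ) ≤ q := by exact_mod_cast hq
    push_cast at this
    have hb0 : (0 : ℝ) ≤ b := b.cast_nonneg
    have hN0 : (0 : ℝ) ≤ N := N.cast_nonneg
    linarith))
  omega

theorem isLatticeSize_latticeSize (hJ : J ⊆ fullGrid t N) (j : ℕ) :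
    IsLatticeSize 2 J (latticeSize 2 J j) :=
  Nat.nth_mem_of_infinite (infinite_isLatticeSize hJ) j

theorem maxLattices_eq (J : Finset (Freq t)) :
    maxLattices 2 (1 / 2) J = ⌈2 * (Real.log #J + Real.log 2)⌉₊ := by
  rw [maxLattices]
  congr 1
  rw [one_div, Real.log_inv]
  ring

theorem one_le_maxLattices (J : Finset (Freq t)) : 1 ≤ maxLattices 2 (1 / 2) J := by
  rw [maxLattices_eq, Nat.one_le_ceil_iff]
  have h1 : 0 ≤ Real.log #J := Real.log_natCast_nonneg _
  have h2 : 0 < Real.log 2 := Real.log_pos (by norm_num)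
  linarith

/-- The interval of `exists_forall_le_card_primes` starting at `x = 2 max(|J|, N)` contains enough primes,
and all of them are admissible. -/
theorem exists_latticeSize_le : ∃ C : ℕ, 1 ≤ C ∧ ∀ (t N : ℕ) (J : Finset (Freq t)),
    J ⊆ fullGrid t N → 1 ≤ N → ∀ j < maxLattices 2 (1 / 2) J,
      latticeSize 2 J j ≤ C * (#J + N) := by
  classical
  obtain ⟨C, hC, h⟩ := exists_forall_le_card_primes
  refine ⟨2 * C, by omega, fun t N J hJ hN j hj => ?_⟩
  set x := 2 * max #J N with hx
  have hN' : N ≤ max #J N := le_max_right _ _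
  have hJ' : #J ≤ max #J N := le_max_left _ _
  have hx2 : 2 ≤ x := by omega
  have hxle : x ≤ 2 * (#J + N) := by
    have : max #J N ≤ #J + N := max_le (by omega) (by omega)
    omega
  refine le_trans ?_ (by nlinarith : C * x ≤ 2 * C * (#J + N))
  refine Nat.lt_succ_iff.1 (Nat.nth_lt_of_lt_count (hj.trans_le ?_))
  rw [maxLattices_eq, Nat.count_eq_card_filter_range]
  refine le_trans (Nat.ceil_le_ceil ?_) ((h x hx2).trans (card_le_card fun q hq => ?_))
  · gcongr
    rcases Nat.eq_zero_or_pos #J with h0 | h0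
    · rw [h0]
      simp only [CharP.cast_eq_zero, Real.log_zero, zero_add]
      exact Real.log_le_log (by norm_num) (by exact_mod_cast hx2)
    · have h0' : (0 : ℝ) < #J := by exact_mod_cast h0
      rw [← Real.log_mul h0'.ne' (by norm_num)]
      refine Real.log_le_log (by positivity) ?_
      have : #J * 2 ≤ x := by omega
      exact_mod_cast this
  · rw [mem_filter, mem_Ioc] at hq
    rw [mem_filter, mem_range]
    refine ⟨by omega, isLatticeSize_of_lt hJ hq.2 (by omega) ?_⟩
    have : 2 * #J < q := by omega
    have : (2 : ℝ) * #J < q := by exact_mod_cast this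
    linarith

/-- Only few primes are tested in vain: for `#J > N`, all tested primes are lattice sizes. -/
theorem card_tested_mul_card_le (hJ : J ⊆ fullGrid t N) (hN : 1 ≤ N) {L : ℕ} (hL : 1 ≤ L) :
    #{q' ∈ range (latticeSize 2 J (L - 1) + 1) | Nat.Prime q' ∧ 2 * ((#J : ℝ) - 1) < (q' : ℝ)} * #J ≤
      L * #J + 3 * N * N := by
  classical
  set F := {q' ∈ range (latticeSize 2 J (L - 1) + 1) |
    Nat.Prime q' ∧ 2 * ((#J : ℝ) - 1) < (q' : ℝ)} with hF
  have h1 : #{q' ∈ range (latticeSize 2 J (L - 1) + 1) | IsLatticeSize 2 J q'} = L := by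
    rw [← Nat.count_eq_card_filter_range, latticeSize,
      Nat.count_nth_succ_of_infinite (infinite_isLatticeSize hJ)]
    omega
  have h2 : F ⊆ {q' ∈ range (latticeSize 2 J (L - 1) + 1) | IsLatticeSize 2 J q'} ∪
      {q' ∈ range (2 * N + 1) | 2 * ((#J : ℝ) - 1) < ((q' : ℕ) : ℝ)} := by
    intro q hq
    rw [hF, mem_filter] at hq
    rw [mem_union, mem_filter, mem_filter, mem_range (n := 2 * N + 1)]
    by_cases hqN : q < 2 * N + 1
    · exact Or.inr ⟨hqN, hq.2.2⟩
    · exact Or.inl ⟨hq.1, isLatticeSize_of_lt hJ hq.2.1 (by omega) hq.2.2⟩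
  have h3 := (card_le_card h2).trans (card_union_le _ _)
  rw [h1] at h3
  have h4 : #{q' ∈ range (2 * N + 1) | 2 * ((#J : ℝ) - 1) < ((q' : ℕ) : ℝ)} * #J ≤ 3 * N * N := by
    by_cases hJN : #J ≤ N
    · have h5 : #{q' ∈ range (2 * N + 1) | 2 * ((#J : ℝ) - 1) < ((q' : ℕ) : ℝ)} ≤ 3 * N :=
        (card_filter_le _ _).trans (by rw [card_range]; omega)
      exact Nat.mul_le_mul h5 hJN
    · rw [filter_false_of_mem, card_empty, Nat.zero_mul]
      · exact Nat.zero_le _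
      · intro q hq
        rw [mem_range] at hq
        have h5 : q + 2 ≤ 2 * #J := by omega
        have h6 : (q : ℝ) + 2 ≤ 2 * #J := by exact_mod_cast h5
        linarith
  nlinarith [Nat.mul_le_mul_right #J h3]

/-- The cost of sieving is a harmonic sum. -/
theorem sieveOps_two_pow_le (i : ℕ) : sieveOps (2 ^ i) ≤ 2 ^ i * (2 + i) := by
  have h1 : ((sieveOps (2 ^ i) : ℕ) : ℝ) ≤ 2 ^ i * (2 + i) := by
    rw [sieveOps]
    push_cast
    rw [Finset.sum_add_distrib]
    have h2 : ∑ a ∈ Icc 2 (2 ^ i), (((2 ^ i / (a : ℕ) : ℕ)) : ℝ) ≤ 2 ^ i * (1 + i) := by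
      calc ∑ a ∈ Icc 2 (2 ^ i), (((2 ^ i / (a : ℕ) : ℕ)) : ℝ)
          ≤ ∑ a ∈ Icc 1 (2 ^ i), (((2 ^ i / (a : ℕ) : ℕ)) : ℝ) :=
            Finset.sum_le_sum_of_subset_of_nonneg (Icc_subset_Icc_left (by norm_num))
              fun _ _ _ => Nat.cast_nonneg _
        _ ≤ ∑ a ∈ Icc 1 (2 ^ i), (2 ^ i : ℝ) * ((a : ℕ) : ℝ)⁻¹ := by
            refine Finset.sum_le_sum fun a _ => ?_
            refine Nat.cast_div_le.trans (le_of_eq ?_)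
            push_cast
            rw [div_eq_mul_inv]
        _ = 2 ^ i * (harmonic (2 ^ i) : ℝ) := by
            rw [← Finset.mul_sum, harmonic_eq_sum_Icc]
            push_cast
            rfl
        _ ≤ 2 ^ i * (1 + i) := by
            gcongr
            refine (harmonic_le_one_add_log _).trans ?_
            push_cast
            rw [Real.log_pow]
            have := Real.log_two_lt_d9
            nlinarith [Nat.cast_nonneg (α := ℝ) i]
    have h3 : ∑ a ∈ Icc 2 ((2 : ℕ) ^ i), (1 : ℝ) ≤ 2 ^ i := by
      rw [Finset.sum_const, Nat.card_Icc, nsmul_eq_mul, mul_one]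
      have : 2 ^ i + 1 - 2 ≤ 2 ^ i :=
      (Nat.sub_le_sub_left (by norm_num : 1 ≤ 2) _).trans (by simp)
      exact_mod_cast this
    linarith
  exact_mod_cast h1

/-- The sieves of doubling sizes form a geometric sum; the remaining cost is that of testing the primes. -/
theorem latticeSizesOps_le (hJ : J ⊆ fullGrid t N) (hN : 1 ≤ N) {L Q W : ℕ} (hL : 1 ≤ L)
    (hW : 1 ≤ W) (hQ : latticeSize 2 J (L - 1) ≤ Q) (hQW : Nat.clog 2 Q ≤ W)
    (hJW : Nat.log 2 #J ≤ W) :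
    latticeSizesOps 2 J L ≤ 12 * Q * W + (L * #J + 3 * N * N) * (3 * t * W) := by
  rw [latticeSizesOps]
  have h1 := card_tested_mul_card_le hJ hN hL
  set q := latticeSize 2 J (L - 1) with hq
  have hq1 : 1 < q := (isLatticeSize_latticeSize hJ (L - 1)).1.one_lt
  have hqW : Nat.clog 2 q ≤ W := (Nat.clog_mono_right 2 hQ).trans hQW
  refine Nat.add_le_add ?_ ?_
  · have h2 : ∀ i ∈ range (Nat.clog 2 q + 1), sieveOps (2 ^ i) ≤ 2 ^ i * (3 * W) := by
      intro i hi
      rw [mem_range] at hi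
      exact (sieveOps_two_pow_le i).trans (Nat.mul_le_mul_left _ (by omega))
    have h3 : 2 ^ (Nat.clog 2 q + 1) ≤ 4 * q := by
      have h4 := Nat.pow_pred_clog_lt_self (b := 2) (by norm_num) hq1
      obtain ⟨e, he⟩ := Nat.exists_eq_succ_of_ne_zero
        (Nat.clog_pos (b := 2) (by norm_num) hq1).ne'
      rw [he] at h4 ⊢
      rw [Nat.pred_succ] at h4
      rw [pow_succ, pow_succ]
      omega
    calc ∑ i ∈ range (Nat.clog 2 q + 1), sieveOps (2 ^ i)
        ≤ ∑ i ∈ range (Nat.clog 2 q + 1), 2 ^ i * (3 * W) := Finset.sum_le_sum h2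
      _ = (2 ^ (Nat.clog 2 q + 1) - 1) * (3 * W) := by
          rw [← Finset.sum_mul, Nat.geomSum_eq (by norm_num)]; simp
      _ ≤ (4 * Q) * (3 * W) := Nat.mul_le_mul_right _ (by omega)
      _ = _ := by ring
  · rw [← mul_assoc]
    refine Nat.mul_le_mul h1 ?_
    nlinarith [Nat.mul_le_mul_left t hJW, Nat.mul_le_mul_left t hW]

end LatticeSizes

/-! ### Success probability and cost of the lattice construction -/

section Construction

open Prog

variable {d t : ℕ} {J : Finset (Freq t)}

/-- `Λs` consists of at most `L` lattices of positive sizes at most `Q`. -/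
def IsLatticeFamily (L Q : ℕ) (Λs : List (Rank1Lattice t)) : Prop :=
  Λs.length ≤ L ∧ ∀ Λ ∈ Λs, 0 < Λ.M ∧ Λ.M ≤ Q

/-- Every frequency of `J` is reconstructible with one of the lattices. -/
def Covers (J : Finset (Freq t)) (Λs : List (Rank1Lattice t)) : Prop :=
  ∀ k ∈ J, ∃ Λ ∈ Λs, k ∈ (isolated J Λ).val

theorem mem_isolated {k : Freq t} {Λ : Rank1Lattice t} : k ∈ (isolated J Λ).val ↔ k ∈ J ∧
    ∀ h ∈ J, h ≠ k → ¬ (∑ i, k i * Λ.z i) ≡ (∑ i, h i * Λ.z i) [ZMOD (Λ.M : ℤ)] := mem_filter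

theorem isolated_subset (Λ : Rank1Lattice t) : (isolated J Λ).val ⊆ J := filter_subset _ _

/-- The lattice with generating vector `z ∈ {0, …, M - 1}ᵗ`. -/
def latticeOf {M : ℕ} (z : Fin t → Fin M) : Rank1Lattice t := ⟨fun i => (z i : ℤ), M⟩

/-- Two frequencies that differ modulo the prime `M` collide for at most one out of `M` generating
vectors. -/
theorem card_collision_mul_le {M : ℕ} (hM : M.Prime) {k h : Freq t} {i₀ : Fin t}
    (hi₀ : ¬ k i₀ ≡ h i₀ [ZMOD M]) :
    #{z : Fin t → Fin M | (∑ i, k i * (z i : ℤ)) ≡ (∑ i, h i * (z i : ℤ)) [ZMOD M]} * M ≤ M ^ t := by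
  classical
  set F : Finset (Fin t → Fin M) :=
    {z | (∑ i, k i * (z i : ℤ)) ≡ (∑ i, h i * (z i : ℤ)) [ZMOD M]} with hF
  -- Overwriting component `i₀` of the vectors in `F` with an arbitrary value is injective.
  have h1 : #(F ×ˢ (univ : Finset (Fin M))) ≤ #(univ : Finset (Fin t → Fin M)) := by
    refine card_le_card_of_injOn (fun q => Function.update q.1 i₀ q.2) (fun _ _ => mem_univ _) ?_
    rintro ⟨z, v⟩ hz ⟨z', v'⟩ hz' heq
    simp only [coe_product, Set.mem_prod, mem_coe, hF, mem_filter, mem_univ, true_and,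
      and_true] at hz hz'
    have hoff : ∀ i, i ≠ i₀ → z i = z' i := fun i hi => by
      have := congrFun heq i
      simpa [hi] using this
    have hv : v = v' := by
      have := congrFun heq i₀
      simpa using this
    have hsum : ∀ w : Fin t → Fin M, (∑ i, k i * (w i : ℤ)) - ∑ i, h i * (w i : ℤ) =
        ∑ i ∈ univ.erase i₀, (k i - h i) * (w i : ℤ) + (k i₀ - h i₀) * (w i₀ : ℤ) := by
      intro w
      rw [← Finset.sum_sub_distrib, Finset.sum_erase_add _ _ (mem_univ i₀)]
      exact Finset.sum_congr rfl fun i _ => by ring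
    have h2 : (M : ℤ) ∣ (k i₀ - h i₀) * ((z i₀ : ℤ) - z' i₀) := by
      have h3 := dvd_sub (Int.ModEq.dvd hz.symm) (Int.ModEq.dvd hz'.symm)
      rw [hsum, hsum, Finset.sum_congr rfl fun i hi => by rw [hoff i (mem_erase.1 hi).1]] at h3
      rwa [add_sub_add_left_eq_sub, ← mul_sub] at h3
    have h3 : (M : ℤ) ∣ (z i₀ : ℤ) - z' i₀ :=
      ((Nat.prime_iff_prime_int.1 hM).dvd_or_dvd h2).resolve_left fun h4 =>
        hi₀ (Int.modEq_iff_dvd.2 ((dvd_sub_comm).1 h4))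
    have h4 : (z i₀ : ℤ) - z' i₀ = 0 := by
      refine Int.eq_zero_of_abs_lt_dvd h3 (abs_lt.2 ?_)
      have := (z i₀).2
      have := (z' i₀).2
      omega
    have h5 : z = z' := by
      funext i
      by_cases hi : i = i₀
      · subst hi; ext; omega
      · exact hoff i hi
    rw [h5, hv]
  rw [card_product] at h1
  simpa using h1

/-- Since `2 (|J| - 1) ≤ M`, a union bound over the other frequencies shows that every frequency is
isolated for at least half of the generating vectors. -/
theorem two_mul_card_not_isolated_le {M : ℕ} (hM : IsLatticeSize 2 J M) {k : Freq t} (hk : k ∈ J) :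
    2 * #{z : Fin t → Fin M | k ∉ (isolated J (latticeOf z)).val} ≤ M ^ t := by
  classical
  have hinj := card_image_iff.1 hM.2.2
  have h1 : ({z : Fin t → Fin M | k ∉ (isolated J (latticeOf z)).val} : Finset _) ⊆
      (J.erase k).biUnion fun h => {z : Fin t → Fin M |
        (∑ i, k i * (z i : ℤ)) ≡ (∑ i, h i * (z i : ℤ)) [ZMOD M]} := by
    refine Finset.subset_iff.2 fun z hz => ?_
    rw [mem_filter, mem_isolated] at hz
    have hz := hz.2
    push Not at hz
    obtain ⟨h, hh, hne, heq⟩ := hz hk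
    simp only [mem_biUnion, mem_erase, mem_filter, mem_univ, true_and]
    exact ⟨h, ⟨hne, hh⟩, heq⟩
  have h2 : #{z : Fin t → Fin M | k ∉ (isolated J (latticeOf z)).val} * M ≤ (#J - 1) * M ^ t := by
    refine (Nat.mul_le_mul_right M ((card_le_card h1).trans card_biUnion_le)).trans ?_
    rw [Finset.sum_mul, ← card_erase_of_mem hk, ← smul_eq_mul]
    refine Finset.sum_le_card_nsmul _ _ _ fun h hh => ?_
    have hne : ∃ i, ¬ k i ≡ h i [ZMOD M] := by
      by_contra hcon
      push Not at hcon
      exact (mem_erase.1 hh).1 (hinj (mem_erase.1 hh).2 hk (funext fun i => (hcon i).symm))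
    obtain ⟨i₀, hi₀⟩ := hne
    exact card_collision_mul_le hM.1 hi₀
  have h3 : 2 * (#J - 1) ≤ M := by
    have h4 := hM.2.1
    have h5 : 1 ≤ #J := card_pos.2 ⟨k, hk⟩
    have h6 : (2 : ℝ) * ((#J - 1 : ℕ) : ℝ) < M := by rw [Nat.cast_sub h5]; simpa using h4
    have h7 : 2 * (#J - 1) < M := by exact_mod_cast h6
    exact h7.le
  have h4 : (2 * #{z : Fin t → Fin M | k ∉ (isolated J (latticeOf z)).val}) * M ≤ M ^ t * M := by
    nlinarith [Nat.mul_le_mul_right (M ^ t) h3]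
  exact Nat.le_of_mul_le_mul_right h4 hM.1.pos

theorem two_mul_sum_card_sdiff_le {M : ℕ} (hM : IsLatticeSize 2 J M) (R : Finset (Freq t)) :
    2 * ∑ z : Fin t → Fin M, #(J \ (R ∪ (isolated J (latticeOf z)).val)) ≤ #(J \ R) * M ^ t := by
  classical
  have h1 : ∀ z : Fin t → Fin M, #(J \ (R ∪ (isolated J (latticeOf z)).val)) =
      ∑ k ∈ J \ R, if k ∉ (isolated J (latticeOf z)).val then 1 else 0 := by
    intro z
    rw [← card_filter]
    congr 1
    ext k
    simp only [mem_sdiff, mem_union, mem_filter]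
    tauto
  rw [Finset.sum_congr rfl fun z _ => h1 z, Finset.sum_comm, Finset.mul_sum, ← smul_eq_mul]
  refine Finset.sum_le_card_nsmul _ _ _ fun k hk => ?_
  rw [← card_filter]
  exact two_mul_card_not_isolated_le hM (mem_sdiff.1 hk).1

variable {p : UnitAddTorus (Fin d) → ℂ}

theorem expect_drawVec_bind {M : ℕ} {α : Type} (f : Freq t → Prog d α)
    (φ : α → ℝ≥0∞) :
    (expect p ((drawVec t M : Prog d (Freq t)) >>= f) fun a _ _ => φ a) =
      (∑ z : Fin t → Fin M, expect p (f (latticeOf z).z) fun a _ _ => φ a) / (M ^ t : ℝ≥0∞) := by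
  change expect p ((drawVec t M : Prog d (Freq t)).bind f) _ = _
  rw [expect_bind]
  rfl

theorem expect_lift_bind {α β : Type} (m : Counted α) (f : α → Prog d β) (φ : β → ℝ≥0∞) :
    (expect p (Prog.lift m >>= f) fun a _ _ => φ a) = expect p (f m.val) fun a _ _ => φ a := by
  change expect p ((Prog.lift m).bind f) _ = _
  rw [expect_bind]
  rfl

/-- The expected number of frequencies that are still missing is halved by every lattice.  A failure
counts as `1 - a`, the success probability of the constructions that then follow. -/
theorem expect_latticeLoop {size : ℕ → ℕ} (hsize : ∀ j, IsLatticeSize 2 J (size j)) (a : ℝ≥0∞)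
    (n ℓ : ℕ) {R : Finset (Freq t)} (hR : R ⊆ J) :
    1 - #(J \ R) * ((1 / 2) ^ n * a) ≤ expect p (latticeLoop J size n ℓ R)
      fun b _ _ => if #b.2 = #J then 1 else 1 - a := by
  classical
  induction n generalizing ℓ R with
  | zero =>
    change _ ≤ if #R = #J then (1 : ℝ≥0∞) else 1 - a
    split_ifs with h
    · exact tsub_le_self
    · refine tsub_le_tsub_left ?_ 1
      have h1 : 0 < #(J \ R) := card_pos.2 (sdiff_nonempty.2 fun h' => h (by rw [hR.antisymm h']))
      have h2 : (1 : ℝ≥0∞) ≤ #(J \ R) := by exact_mod_cast h1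
      calc a = 1 * a := (one_mul a).symm
        _ ≤ _ := by simpa using mul_le_mul_left h2 a
  | succ n ih =>
    have hM := hsize ℓ
    set M := size ℓ with hMdef
    have hMt : ((M : ℝ≥0∞) ^ t) ≠ 0 := pow_ne_zero _ (by exact_mod_cast hM.1.ne_zero)
    have hMt' : ((M : ℝ≥0∞) ^ t) ≠ ∞ := ENNReal.pow_ne_top (ENNReal.natCast_ne_top M)
    have hstep : ∀ z : Fin t → Fin M,
        1 - (#(J \ (R ∪ (isolated J (latticeOf z)).val)) : ℝ≥0∞) * ((1 / 2) ^ n * a) ≤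
        expect p (do
          let Iℓ ← (Prog.lift (isolated J (latticeOf z)) : Prog d _)
          let R' ← Prog.lift (⟨R ∪ Iℓ, #J + 1⟩ : Counted (Finset (Freq t)))
          if #R' = #J then pure ([latticeOf z], R')
          else
            let rest ← latticeLoop J size n (ℓ + 1) R'
            pure (latticeOf z :: rest.1, rest.2))
          fun b _ _ => if #b.2 = #J then (1 : ℝ≥0∞) else 1 - a := by
      intro z
      rw [expect_lift_bind, expect_lift_bind]
      simp only
      split_ifs with h
      · change _ ≤ if #(R ∪ (isolated J (latticeOf z)).val) = #J then (1 : ℝ≥0∞) else 1 - a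
        rw [if_pos h]
        exact tsub_le_self
      · refine (ih (ℓ + 1) (union_subset hR (isolated_subset _))).trans (le_of_eq ?_)
        exact (expect_bind (latticeLoop J size n (ℓ + 1) _)
          (fun rest => Prog.ret (latticeOf z :: rest.1, rest.2))
          (fun b _ _ => if #b.2 = #J then (1 : ℝ≥0∞) else 1 - a)).symm
    have h1 : (∑ z : Fin t → Fin M,
        (1 - (#(J \ (R ∪ (isolated J (latticeOf z)).val)) : ℝ≥0∞) * ((1 / 2) ^ n * a))) /
          (M ^ t : ℝ≥0∞) ≤ expect p (latticeLoop J size (n + 1) ℓ R)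
      fun b _ _ => if #b.2 = #J then (1 : ℝ≥0∞) else 1 - a := by
      rw [latticeLoop, expect_drawVec_bind]
      exact ENNReal.div_le_div_right (Finset.sum_le_sum fun z _ => hstep z) _
    refine le_trans ?_ h1
    rw [ENNReal.le_div_iff_mul_le (Or.inl hMt) (Or.inl hMt')]
    have h2 : ((M : ℝ≥0∞) ^ t) ≤ (∑ z : Fin t → Fin M,
        (1 - (#(J \ (R ∪ (isolated J (latticeOf z)).val)) : ℝ≥0∞) * ((1 / 2) ^ n * a))) +
        #(J \ R) * ((1 / 2) ^ (n + 1) * a) * M ^ t := by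
      calc ((M : ℝ≥0∞) ^ t) = ∑ z : Fin t → Fin M, 1 := by simp
        _ ≤ ∑ z : Fin t → Fin M,
            ((1 - (#(J \ (R ∪ (isolated J (latticeOf z)).val)) : ℝ≥0∞) * ((1 / 2) ^ n * a)) +
              (#(J \ (R ∪ (isolated J (latticeOf z)).val)) : ℝ≥0∞) * ((1 / 2) ^ n * a)) :=
            Finset.sum_le_sum fun z _ => le_tsub_add
        _ ≤ _ := by
            rw [Finset.sum_add_distrib]
            refine add_le_add le_rfl ?_
            rw [← Finset.sum_mul]
            have h3 := two_mul_sum_card_sdiff_le hM R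
            have h4 : (2 : ℝ≥0∞) * ∑ z : Fin t → Fin M,
                (#(J \ (R ∪ (isolated J (latticeOf z)).val)) : ℝ≥0∞) ≤ #(J \ R) * M ^ t := by
              exact_mod_cast h3
            have h5 : ∀ x : ℝ≥0∞, x = (1 / 2) * (2 * x) := fun x => by
              rw [← mul_assoc, one_div, ENNReal.inv_mul_cancel (by norm_num) (by norm_num), one_mul]
            rw [h5 (∑ z : Fin t → Fin M, _)]
            calc _ ≤ (1 / 2) * (#(J \ R) * M ^ t : ℝ≥0∞) * ((1 / 2) ^ n * a) := by gcongr
              _ = _ := by ring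
    rw [ENNReal.sub_mul (fun _ _ => hMt'), one_mul, tsub_le_iff_right]
    exact h2

/-- The collected set contains only frequencies from `R` and frequencies isolated for a lattice of the
list. -/
theorem always_latticeLoop {size : ℕ → ℕ} {Q : ℕ} (n ℓ : ℕ)
    (hQ : ∀ j < ℓ + n, 0 < size j ∧ size j ≤ Q) {R : Finset (Freq t)} :
    AlwaysWithin p (latticeLoop J size n ℓ R)
      (fun b => IsLatticeFamily n Q b.1 ∧ (R ⊆ J → b.2 ⊆ J) ∧
        ∀ k ∈ b.2, k ∈ R ∨ ∃ Λ ∈ b.1, k ∈ (isolated J Λ).val)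
      0 (n * (t + #J * (2 * t + 3) + (#J + 1))) := by
  induction n generalizing ℓ R with
  | zero =>
    exact ⟨⟨⟨le_rfl, by simp⟩, fun h => h, fun k hk => Or.inl hk⟩, le_rfl, Nat.zero_le _⟩
  | succ n ih =>
    have hd : AlwaysWithin p (drawVec t (size ℓ) : Prog d (Freq t)) (fun _ => True) 0 t :=
      fun _ => ⟨trivial, le_rfl, le_rfl⟩
    have h1 := hd.bind (P' := fun b : List (Rank1Lattice t) × Finset (Freq t) =>
      IsLatticeFamily (n + 1) Q b.1 ∧ (R ⊆ J → b.2 ⊆ J) ∧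
        ∀ k ∈ b.2, k ∈ R ∨ ∃ Λ ∈ b.1, k ∈ (isolated J Λ).val) (m' := 0)
        (n' := #J * (2 * t + 3) + ((#J + 1) + n * (t + #J * (2 * t + 3) + (#J + 1)))) (f := fun z => do
          let Iℓ ← (Prog.lift (isolated J ⟨z, size ℓ⟩) : Prog d _)
          let R' ← Prog.lift (⟨R ∪ Iℓ, #J + 1⟩ : Counted (Finset (Freq t)))
          if #R' = #J then pure ([⟨z, size ℓ⟩], R')
          else
            let rest ← latticeLoop J size n (ℓ + 1) R'
            pure (⟨z, size ℓ⟩ :: rest.1, rest.2)) fun z _ => by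
      refine (AlwaysWithin.lift (P := fun I => I = (isolated J ⟨z, size ℓ⟩).val) rfl le_rfl).bind
        (m := 0) (m' := 0) fun I hI => ?_
      refine (AlwaysWithin.lift (P := fun I' => I' = R ∪ I) rfl le_rfl).bind
        (m := 0) (m' := 0) fun R' hR' => ?_
      split_ifs with h
      · refine ⟨⟨⟨by simp, by simpa using hQ ℓ (by omega)⟩, fun hRJ => ?_, fun k hk => ?_⟩, le_rfl,
          Nat.zero_le _⟩
        · rw [hR', hI]
          exact union_subset hRJ (isolated_subset _)
        · rw [hR', mem_union] at hk
          exact hk.imp_right fun hk => ⟨_, List.mem_singleton.2 rfl, hI ▸ hk⟩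
      · refine (((ih (ℓ + 1) (fun j hj => hQ j (by omega)) (R := R')).bind
          (f := fun rest => pure (⟨z, size ℓ⟩ :: rest.1, rest.2)) (m' := 0) (n' := 0)
          fun b hb => ?_).mono (fun _ h => h) le_rfl le_rfl)
        refine ⟨⟨⟨by simpa using hb.1.1, ?_⟩, fun hRJ => ?_, fun k hk => ?_⟩, le_rfl, le_rfl⟩
        · intro Λ hΛ
          rcases List.mem_cons.1 hΛ with rfl | hΛ
          · exact hQ ℓ (by omega)
          · exact hb.1.2 Λ hΛ
        · refine hb.2.1 ?_
          rw [hR', hI]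
          exact union_subset hRJ (isolated_subset _)
        · rcases hb.2.2 k hk with hk | ⟨Λ, hΛ, hk⟩
          · rw [hR', mem_union] at hk
            exact hk.imp_right fun hk => ⟨_, List.mem_cons_self, hI ▸ hk⟩
          · exact Or.inr ⟨Λ, List.mem_cons_of_mem _ hΛ, hk⟩
    exact h1.mono (fun _ h => h) le_rfl (by rw [Nat.succ_mul n]; omega)

theorem always_constructLattice {N : ℕ} (hJ : J ⊆ fullGrid t N) {Q L n : ℕ}
    (hQ : ∀ j < maxLattices 2 (1 / 2) J, latticeSize 2 J j ≤ Q)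
    (hL : maxLattices 2 (1 / 2) J ≤ L)
    (hn : latticeSizesOps 2 J (maxLattices 2 (1 / 2) J) ≤ n) :
    AlwaysWithin p (constructLattice 2 (1 / 2) J : Prog d _)
      (fun b => IsLatticeFamily L Q b.1 ∧ (#b.2 = #J → Covers J b.1))
      0 (8 + (n + L * (t + #J * (2 * t + 3) + (#J + 1)))) := by
  refine (AlwaysWithin.lift (P := fun x => x = maxLattices 2 (1 / 2) J) rfl le_rfl).bind
    (m := 0) (m' := 0) fun x hx => ?_
  subst hx
  refine (AlwaysWithin.lift (P := fun x => x = latticeSize 2 J) rfl hn).bind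
    (m := 0) (m' := 0) fun x hx => ?_
  subst hx
  refine (always_latticeLoop _ 0 fun j hj =>
    ⟨(isLatticeSize_latticeSize hJ j).1.pos, hQ j (by omega)⟩).mono ?_ le_rfl
    (Nat.mul_le_mul_right _ hL)
  rintro b ⟨h1, h2, h3⟩
  refine ⟨⟨h1.1.trans hL, h1.2⟩, fun hb k hk => ?_⟩
  rw [← eq_of_subset_of_card_le (h2 (empty_subset J)) hb.ge] at hk
  simpa using h3 k hk

/-- So many lattices are allowed that the expected number of missing frequencies drops to `1 / 2`. -/
theorem two_mul_card_le_two_pow (J : Finset (Freq t)) :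
    2 * #J ≤ 2 ^ maxLattices 2 (1 / 2) J := by
  rcases Nat.eq_zero_or_pos #J with h0 | h0
  · rw [h0]; exact Nat.zero_le _
  have hJ : (0 : ℝ) < #J := by exact_mod_cast h0
  have h1 : 2 * (Real.log #J + Real.log 2) ≤ maxLattices 2 (1 / 2) J := by
    rw [maxLattices_eq]; exact Nat.le_ceil _
  have h2 : Real.log (2 * #J) ≤ Real.log (2 ^ maxLattices 2 (1 / 2) J) := by
    rw [Real.log_pow, Real.log_mul (by norm_num) hJ.ne']
    have h3 : 0 ≤ Real.log #J := Real.log_natCast_nonneg _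
    have h4 := Real.log_two_gt_d9
    nlinarith
  have h3 := (Real.log_le_log_iff (by positivity) (by positivity)).1 h2
  exact_mod_cast h3

theorem expect_constructLattice {N : ℕ} (hJ : J ⊆ fullGrid t N) (a : ℝ≥0∞) :
    1 - (1 / 2) * a ≤ expect p (constructLattice 2 (1 / 2) J : Prog d _)
      fun b _ _ => if #b.2 = #J then 1 else 1 - a := by
  rw [constructLattice, expect_lift_bind, expect_lift_bind]
  refine le_trans (tsub_le_tsub_left ?_ 1) (expect_latticeLoop (isLatticeSize_latticeSize hJ) a
    (maxLattices 2 (1 / 2) J) 0 (empty_subset J))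
  rw [← mul_assoc, sdiff_empty]
  refine mul_le_mul_left ?_ a
  have h1 : (2 : ℝ≥0∞) * #J ≤ 2 ^ maxLattices 2 (1 / 2) J := by
    exact_mod_cast two_mul_card_le_two_pow J
  rw [one_div, ← ENNReal.inv_pow, ← div_eq_mul_inv]
  refine ENNReal.div_le_of_le_mul ?_
  calc (#J : ℝ≥0∞) = 2⁻¹ * (2 * #J) := by
        rw [← mul_assoc, ENNReal.inv_mul_cancel (by norm_num) (by norm_num), one_mul]
    _ ≤ _ := by gcongr

theorem always_searchLattice {N : ℕ} (hJ : J ⊆ fullGrid t N) {Q L n : ℕ}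
    (hQ : ∀ j < maxLattices 2 (1 / 2) J, latticeSize 2 J j ≤ Q)
    (hL : maxLattices 2 (1 / 2) J ≤ L)
    (hn : latticeSizesOps 2 J (maxLattices 2 (1 / 2) J) ≤ n) (b : ℕ) :
    AlwaysWithin p (searchLattice J b : Prog d _) (IsLatticeFamily L Q)
      0 ((b + 1) * (8 + (n + L * (t + #J * (2 * t + 3) + (#J + 1))))) := by
  have h := always_constructLattice (p := p) hJ hQ hL hn
  induction b with
  | zero =>
    have h1 := h.bind (m' := 0) (n' := 0) (f := fun Λ => pure Λ.1) (P' := IsLatticeFamily L Q)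
      fun b hb => AlwaysWithin.pure hb.1
    exact h1.mono (fun _ h => h) le_rfl (by simp)
  | succ b ih =>
    have h1 := h.bind (m' := 0) (f := fun Λ => if #Λ.2 = #J then pure Λ.1 else searchLattice J b)
      (P' := IsLatticeFamily L Q)
      (n' := (b + 1) * (8 + (n + L * (t + #J * (2 * t + 3) + (#J + 1))))) fun b hb => by
      split_ifs
      · exact (AlwaysWithin.pure hb.1).mono (fun _ h => h) le_rfl (Nat.zero_le _)
      · exact ih
    exact h1.mono (fun _ h => h) le_rfl (by rw [Nat.succ_mul (b + 1)]; omega)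

/-- The search makes `b + 1` constructions, each failing with probability at most `1 / 2`. -/
theorem prob_searchLattice {N : ℕ} (hJ : J ⊆ fullGrid t N) (b : ℕ) :
    1 - (1 / 2 : ℝ≥0∞) ^ (b + 1) ≤
      prob p (searchLattice J b : Prog d _) fun Λs _ _ => Covers J Λs := by
  classical
  have hal := always_constructLattice (d := d) (p := p) hJ
    (Q := ∑ j ∈ range (maxLattices 2 (1 / 2) J), latticeSize 2 J j)
    (fun j hj => single_le_sum (fun _ _ => Nat.zero_le _) (mem_range.2 hj)) le_rfl le_rfl
  induction b with
  | zero =>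
    rw [prob_eq_expect]
    have h1 := expect_constructLattice (p := p) hJ 1
    rw [zero_add, pow_one]
    rw [mul_one] at h1
    refine h1.trans ?_
    change _ ≤ expect p ((constructLattice 2 (1 / 2) J : Prog d _).bind fun Λ => pure Λ.1) _
    rw [expect_bind]
    refine expect_mono_of_always hal fun a m n ⟨ha, _⟩ => ?_
    change _ ≤ if Covers J a.1 then (1 : ℝ≥0∞) else 0
    by_cases h : #a.2 = #J
    · simp [h, ha.2 h]
    · simp [h]
  | succ b ih =>
    rw [prob_eq_expect] at ih ⊢
    have h1 := expect_constructLattice (p := p) hJ ((1 / 2 : ℝ≥0∞) ^ (b + 1))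
    rw [← pow_succ'] at h1
    refine h1.trans ?_
    change _ ≤ expect p ((constructLattice 2 (1 / 2) J : Prog d _).bind fun Λ =>
      if #Λ.2 = #J then pure Λ.1 else searchLattice J b) _
    rw [expect_bind]
    refine expect_mono_of_always hal fun a m n ⟨ha, _⟩ => ?_
    by_cases h : #a.2 = #J
    · rw [if_pos h, if_pos h]
      change _ ≤ if Covers J a.1 then (1 : ℝ≥0∞) else 0
      rw [if_pos (ha.2 h)]
    · rw [if_neg h, if_neg h]
      exact ih

end Construction

/-! ### Fourier coefficients from samples -/

section Coefficients

open Prog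

variable {d t : ℕ}

/-- The frequency `h` with the components in `A` replaced by zero. -/
def restFreq (A : Finset (Fin d)) (h : Freq d) : Freq d := fun i => if i ∈ A then 0 else h i

/-- The part `∑ p̂ₕ exp(2πi h·x)` of the polynomial over all `h` that fulfill `P`, with the components
of `x` in `A` replaced by zero. -/
noncomputable def partialSum (c : Freq d →₀ ℂ) (A : Finset (Fin d)) (P : Freq d → Prop)
    [DecidablePred P] (x : UnitAddTorus (Fin d)) : ℂ :=
  ∑ h ∈ c.support with P h, c h * UnitAddTorus.mFourier (restFreq A h) x

open Complex in
/-- The character `exp(2πi h·y)` splits into the part for the components in `A`, which are given by real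
representatives `θ`, and the part for the other components, where `y` agrees with `x`. -/
theorem mFourier_eq_exp_mul {A : Finset (Fin d)} {x y : UnitAddTorus (Fin d)} {θ : Fin d → ℝ}
    (hx : ∀ i ∉ A, y i = x i) (hθ : ∀ i ∈ A, y i = (θ i : UnitAddCircle)) (h : Freq d) :
    UnitAddTorus.mFourier h y = exp (2 * Real.pi * I * ∑ i ∈ A, h i * θ i) *
      UnitAddTorus.mFourier (restFreq A h) x := by
  change ∏ i, fourier (h i) (y i) = _ * ∏ i, fourier (restFreq A h i) (x i)
  rw [← Finset.prod_mul_prod_compl A,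
    ← Finset.prod_mul_prod_compl A (fun i => fourier (restFreq A h i) (x i)), ← mul_assoc]
  congr 1
  · have h1 : ∏ i ∈ A, fourier (restFreq A h i) (x i) = 1 :=
      Finset.prod_eq_one fun i hi => by simp [restFreq, hi]
    rw [h1, mul_one, ofReal_sum, Finset.mul_sum, exp_sum]
    refine Finset.prod_congr rfl fun i hi => ?_
    rw [hθ i hi, fourier_coe_apply]
    congr 1
    push_cast
    ring
  · refine Finset.prod_congr rfl fun i hi => ?_
    rw [mem_compl] at hi
    simp [restFreq, hi, hx i hi]

open Complex in
/-- The discrete Fourier transform of length `M` of a sum of exponentials adds up the coefficients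
whose frequencies agree modulo `M`. -/
theorem fft_sum_exp {ι : Type} {M : ℕ} (F : Finset ι) (a : ι → ℂ) (b : ι → ℤ)
    {y : ℕ → ℂ} (hy : ∀ j < M, y j = ∑ h ∈ F, a h * exp (2 * Real.pi * I * (j * b h / M)))
    {r : ℕ} (hr : r < M) :
    (Counted.fft M y).val r / M = ∑ h ∈ F with (M : ℤ) ∣ b h - r, a h := by
  have hM : 0 < M := by omega
  have hM' : (M : ℂ) ≠ 0 := by exact_mod_cast hM.ne'
  rw [Counted.val_fft M y r hr]
  have h1 : ∑ j ∈ range M, y j * exp (-(2 * Real.pi * I * j * r / M)) =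
      ∑ h ∈ F, a h * ∑ j ∈ range M, exp (2 * Real.pi * I * j * ((b h - r : ℤ) : ℂ) / M) := by
    simp only [Finset.mul_sum]
    rw [Finset.sum_comm]
    refine Finset.sum_congr rfl fun j hj => ?_
    rw [hy j (mem_range.1 hj), Finset.sum_mul]
    refine Finset.sum_congr rfl fun h _ => ?_
    rw [mul_assoc, ← exp_add]
    congr 2
    push_cast
    ring
  rw [h1, Finset.sum_filter, Finset.sum_div]
  refine Finset.sum_congr rfl fun h _ => ?_
  rw [Counted.sum_exp_eq_ite hM]
  split_ifs with hd
  · field_simp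
  · simp

variable {c : Freq d →₀ ℂ} {Γ : Finset (Freq d)} {N : ℕ} {τ : Fin d}

theorem trigPoly_eq_sum_exp {A : Finset (Fin d)} {x y : UnitAddTorus (Fin d)} {θ : Fin d → ℝ}
    (hx : ∀ i ∉ A, y i = x i) (hθ : ∀ i ∈ A, y i = (θ i : UnitAddCircle)) :
    trigPoly c y = ∑ h ∈ c.support, (c h * UnitAddTorus.mFourier (restFreq A h) x) *
      Complex.exp (2 * Real.pi * Complex.I * ∑ i ∈ A, h i * θ i) := by
  refine Finset.sum_congr rfl fun h _ => ?_
  rw [mFourier_eq_exp_mul hx hθ]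
  ring

theorem abs_sub_lt_extent {k h : ℤ} (hk : k ∈ component Γ τ) (hh : h ∈ component Γ τ) :
    |h - k| < (extent Γ τ : ℤ) := by
  have hb := (component Γ τ).bddAbove
  have hb' := (component Γ τ).bddBelow
  have h1 := le_csSup hb (mem_coe.2 hk)
  have h2 := le_csSup hb (mem_coe.2 hh)
  have h3 := csInf_le hb' (mem_coe.2 hk)
  have h4 := csInf_le hb' (mem_coe.2 hh)
  rw [extent, abs_lt]
  omega

theorem extent_pos (hΓ : Γ.Nonempty) : 0 < extent Γ τ := by
  obtain ⟨k, hk⟩ := hΓ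
  have h1 := abs_sub_lt_extent (mem_image_of_mem (fun k => k τ) hk : _ ∈ component Γ τ)
    (mem_image_of_mem (fun k => k τ) hk : _ ∈ component Γ τ)
  simpa using h1

theorem component_subset_Icc (hN : Γ ⊆ fullGrid d N) : component Γ τ ⊆ Icc (-(N : ℤ)) N := by
  refine image_subset_iff.2 fun k hk => ?_
  have := hN hk
  rw [fullGrid, Fintype.mem_piFinset] at this
  exact this τ

theorem card_component_le (hN : Γ ⊆ fullGrid d N) : #(component Γ τ) ≤ 2 * N + 1 := by
  refine (card_le_card (component_subset_Icc hN)).trans ?_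
  rw [Int.card_Icc]
  omega

theorem extent_le (hΓ : Γ.Nonempty) (hN : Γ ⊆ fullGrid d N) : extent Γ τ ≤ 2 * N + 1 := by
  have hne : (component Γ τ : Set ℤ).Nonempty := coe_nonempty.2 (hΓ.image _)
  have h1 := mem_Icc.1 (component_subset_Icc hN
    (mem_coe.1 (hne.csSup_mem (component Γ τ).finite_toSet)))
  have h2 := mem_Icc.1 (component_subset_Icc hN
    (mem_coe.1 (hne.csInf_mem (component Γ τ).finite_toSet)))
  rw [extent]
  omega

/-- One detection iteration for a single component computes exact partial sums, since the transform
length `extent Γ τ` exceeds all differences of components. -/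
theorem evaluates_detectOnce (hc : c.support ⊆ Γ) (hΓ : Γ.Nonempty) (hN : Γ ⊆ fullGrid d N)
    (δ : ℝ) (s : ℕ) (τ : Fin d) {W : ℕ} (hW : Nat.clog 2 (2 * (2 * N + 1)) ≤ W) (hW1 : 1 ≤ W) :
    ∃ (g : UnitAddTorus (Fin d) → ℤ → ℂ) (n : UnitAddTorus (Fin d) → ℕ),
      (∀ x, ∀ k ∈ component Γ τ, g x k = partialSum c {τ} (fun h => h τ = k) x) ∧
      (∀ x, n x ≤ d + (2 * N + 1) * 142 * W) ∧
      EvaluatesOnDraw (trigPoly c) (detectOnce Γ δ s τ)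
        (fun x => (Counted.select (component Γ τ) (g x) δ s).val) (extent Γ τ) n := by
  set K := extent Γ τ with hK
  have hK0 : 0 < K := extent_pos hΓ
  have hKN : K ≤ 2 * N + 1 := extent_le hΓ hN
  set y : UnitAddTorus (Fin d) → ℕ → ℂ := fun x l => if l < K then
    trigPoly c (Function.update x τ (((l : ℝ) / K : ℝ) : UnitAddCircle)) else 0 with hy
  set G : UnitAddTorus (Fin d) → Counted (ℤ → ℂ) := fun x =>
    Counted.forAll (component Γ τ) fun k =>
      (⟨(Counted.fft K (y x)).val (k % (K : ℤ)).toNat / K, 2⟩ : Counted ℂ) with hG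
  refine ⟨fun x => (G x).val, fun x => (2 * #(component Γ τ) + 2) + (d + (K * 1 +
    ((Counted.fft K (y x)).ops + ((G x).ops +
      (Counted.select (component Γ τ) (G x).val δ s).ops)))), ?_, ?_, ?_⟩
  · intro x k hk
    have hr0 : 0 ≤ k % (K : ℤ) := Int.emod_nonneg _ (by omega)
    have hrK : k % (K : ℤ) < K := Int.emod_lt_of_pos _ (by omega)
    change (G x).val k = _
    rw [hG, Counted.val_forAll, if_pos hk]
    simp only
    rw [fft_sum_exp c.support (fun h => c h * UnitAddTorus.mFourier (restFreq {τ} h) x)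
      (fun h => h τ) (y := y x) _ (by omega)]
    · rw [partialSum]
      refine Finset.sum_congr (Finset.filter_congr fun h hh => ?_) fun _ _ => rfl
      rw [Int.toNat_of_nonneg hr0]
      constructor
      · intro hd
        have h1 : (K : ℤ) ∣ h τ - k := by
          have h2 := dvd_sub hd (Int.dvd_self_sub_emod (x := k) (m := (K : ℤ)))
          rwa [show h τ - k % (K : ℤ) - (k - k % (K : ℤ)) = h τ - k by ring] at h2
        have h2 := Int.eq_zero_of_abs_lt_dvd h1
          (abs_sub_lt_extent hk (mem_image_of_mem (fun k => k τ) (hc hh)))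
        omega
      · rintro rfl
        exact Int.dvd_self_sub_emod
    · intro j hj
      simp only [hy, hj, if_true]
      rw [trigPoly_eq_sum_exp (A := {τ}) (x := x) (θ := fun _ => (j : ℝ) / K)]
      · refine Finset.sum_congr rfl fun h _ => ?_
        congr 3
        simp
        ring
      · intro i hi
        rw [Function.update_of_ne (by simpa using hi)]
      · intro i hi
        rw [mem_singleton] at hi
        subst hi
        simp
  · intro x
    have hcK := card_component_le (τ := τ) hN
    have h1 : (Counted.fft K (y x)).ops ≤ 120 * K * W :=
      Counted.ops_fft_le K W _ hK0 ((Nat.clog_mono_right 2 (by omega)).trans hW) hW1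
    have h2 : (G x).ops ≤ #(component Γ τ) * 2 := Counted.ops_forAll_le _ _ _ fun _ _ => le_rfl
    have h3 := Counted.ops_select_le (component Γ τ) (G x).val δ s (W := W)
      ((Nat.clog_mono_right 2 (by omega)).trans hW)
    have h4 : #(component Γ τ) * W ≤ (2 * N + 1) * W := Nat.mul_le_mul_right _ hcK
    have h5 : K * W ≤ (2 * N + 1) * W := Nat.mul_le_mul_right _ hKN
    have h6 : 2 * N + 1 ≤ (2 * N + 1) * W := Nat.le_mul_of_pos_right _ hW1
    have h7 : 120 * K * W = 120 * (K * W) := by ring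
    have h8 : (2 * N + 1) * 142 * W = 142 * ((2 * N + 1) * W) := by ring
    rw [mul_add] at h3
    rw [h7] at h1
    rw [h8]
    change (2 * #(component Γ τ) + 2) + (d + (K * 1 +
      ((Counted.fft K (y x)).ops + ((G x).ops +
      (Counted.select (component Γ τ) (G x).val δ s).ops)))) ≤ _
    omega
  · have h1 := (Evaluates.lift (p := trigPoly c)
      (⟨K, 2 * #(component Γ τ) + 2⟩ : Counted ℕ)).bind_onDraw
      (f := fun K : ℕ => do
        let x ← (drawPoint : Prog d _)
        let y ← Prog.sampleAll 1
          (fun l => Function.update x τ (((l : ℝ) / K : ℝ) : UnitAddCircle)) K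
        let Y ← Prog.lift (Counted.fft K y)
        let g ← Prog.lift (Counted.forAll (component Γ τ) fun k =>
          (⟨Y (k % (K : ℤ)).toNat / K, 2⟩ : Counted ℂ))
        Prog.lift (Counted.select (component Γ τ) g δ s))
      (EvaluatesOnDraw.drawPoint.bind fun x =>
        (evaluates_sampleAll 1
          (fun l => Function.update x τ (((l : ℝ) / K : ℝ) : UnitAddCircle)) K).bind <|
        (Evaluates.lift _).bind <| (Evaluates.lift _).bind <| (Evaluates.lift _))
    simp only [zero_add, add_zero] at h1
    exact h1

/-- The set of the first `t` of `d` components. -/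
def firstComponents (ht : t ≤ d) : Finset (Fin d) := univ.map (Fin.castLEEmb ht)

theorem mem_firstComponents {ht : t ≤ d} {i : Fin d} : i ∈ firstComponents ht ↔ (i : ℕ) < t := by
  rw [firstComponents, mem_map]
  constructor
  · rintro ⟨j, -, rfl⟩
    exact j.2
  · exact fun h => ⟨⟨i, h⟩, mem_univ _, rfl⟩

/-- The values of the polynomial along the lattice `Λ`. -/
noncomputable def latticeValues (p : UnitAddTorus (Fin d) → ℂ) (x : UnitAddTorus (Fin d))
    (Λ : Rank1Lattice t) : ℕ → ℂ :=
  fun j => if j < Λ.M then p (latticeNode Λ x j) else 0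

theorem evaluates_sampleLattices (p : UnitAddTorus (Fin d) → ℂ) (x : UnitAddTorus (Fin d))
    (Λs : List (Rank1Lattice t)) :
    Evaluates p (sampleLattices x Λs) (Λs.map fun Λ => (Λ, latticeValues p x Λ))
      (Λs.map fun Λ => Λ.M).sum (Λs.map fun Λ => Λ.M * (3 * t)).sum := by
  induction Λs with
  | nil => exact Evaluates.pure _
  | cons Λ Λs ih =>
    have h1 := (evaluates_sampleAll (p := p) (3 * t) (latticeNode Λ x) Λ.M).bind
      (f := fun y => do
        let ys ← sampleLattices x Λs
        pure ((Λ, y) :: ys)) (ih.bind (Evaluates.pure _))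
    simp only [add_zero] at h1
    exact h1

/-- On a lattice, the transform adds up the frequencies whose projections agree with `k` modulo the
lattice. -/
theorem fft_latticeValues (ht : t ≤ d) {Λ : Rank1Lattice t} (hΛ : 0 < Λ.M) (k : Freq t)
    (x : UnitAddTorus (Fin d)) :
    (Counted.fft Λ.M (latticeValues (trigPoly c) x Λ)).val (residue k Λ) / Λ.M =
      partialSum c (firstComponents ht)
        (fun h => (∑ i, proj ht h i * Λ.z i) ≡ (∑ i, k i * Λ.z i) [ZMOD Λ.M]) x := by
  set b := ∑ i, k i * Λ.z i with hb
  have hr0 : 0 ≤ b % (Λ.M : ℤ) := Int.emod_nonneg _ (by omega)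
  have hrM : b % (Λ.M : ℤ) < Λ.M := Int.emod_lt_of_pos _ (by omega)
  have hM : (Λ.M : ℂ) ≠ 0 := by exact_mod_cast hΛ.ne'
  rw [fft_sum_exp c.support
    (fun h => c h * UnitAddTorus.mFourier (restFreq (firstComponents ht) h) x)
    (fun h => ∑ i, proj ht h i * Λ.z i) (y := latticeValues (trigPoly c) x Λ) _
    (by rw [residue, ← hb]; omega)]
  · rw [partialSum]
    refine Finset.sum_congr (Finset.filter_congr fun h hh => ?_) fun _ _ => rfl
    rw [residue, Int.toNat_of_nonneg hr0, ← Int.modEq_iff_dvd]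
    constructor
    · exact fun h1 => h1.symm.trans (Int.mod_modEq _ _)
    · exact fun h1 => (Int.mod_modEq _ _).trans h1.symm
  · intro j hj
    rw [latticeValues, if_pos hj, trigPoly_eq_sum_exp (A := firstComponents ht) (x := x)
      (θ := fun i => if h : (i : ℕ) < t then (j : ℝ) / Λ.M * Λ.z ⟨i, h⟩ else 0)]
    · refine Finset.sum_congr rfl fun h _ => ?_
      congr 3
      rw [firstComponents, Finset.sum_map]
      push_cast
      rw [Finset.mul_sum, Finset.sum_div]
      refine Finset.sum_congr rfl fun i _ => ?_
      simp [proj]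
      ring
    · intro i hi
      rw [mem_firstComponents] at hi
      simp [latticeNode, hi]
    · intro i hi
      rw [mem_firstComponents] at hi
      simp [latticeNode, hi]

/-- The inverse transform computes, for every frequency, the mean over all lattices for which it is
isolated; the division by zero yields the value zero. -/
theorem val_inverseLoop (J : Finset (Freq t)) (data : List (Rank1Lattice t × (ℕ → ℂ)))
    (counter : Freq t → ℕ) (g : Freq t → ℂ) {k : Freq t} (hk : k ∈ J) :
    (inverseLoop J data counter g).val k =
      (g k + (data.map fun D => if k ∈ (isolated J D.1).val then
        (Counted.fft D.1.M D.2).val (residue k D.1) / D.1.M else 0).sum) /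
      (counter k + (data.map fun D => if k ∈ (isolated J D.1).val then (1 : ℂ) else 0).sum) := by
  induction data generalizing counter g with
  | nil =>
    simp only [inverseLoop, Counted.val_forAll, hk, if_true, List.map_nil, List.sum_nil, add_zero]
    split_ifs with h
    · simp [h]
    · rfl
  | cons D data ih =>
    obtain ⟨Λ, y⟩ := D
    simp only [inverseLoop, Counted.val_bind]
    rw [ih]
    simp only [Counted.val_forAll, hk, if_true, List.map_cons, List.sum_cons]
    split_ifs with h
    · simp only [Counted.val_bind, Counted.val_op]
      push_cast
      rw [add_assoc, add_assoc]
    · simp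

theorem ops_inverseLoop_le (J : Finset (Freq t)) {F : ℕ} (data : List (Rank1Lattice t × (ℕ → ℂ)))
    (hF : ∀ D ∈ data, (Counted.fft D.1.M D.2).ops ≤ F)
    (counter : Freq t → ℕ) (g : Freq t → ℂ) :
    (inverseLoop J data counter g).ops ≤
      data.length * (#J * (2 * t + 3) + (F + (#J * 1 + #J * (2 * t + 3)))) + #J * 2 := by
  induction data generalizing counter g with
  | nil =>
    simp only [inverseLoop]
    refine (Counted.ops_forAll_le _ _ 2 fun k _ => ?_).trans (by simp)
    split_ifs <;> simp
  | cons D data ih =>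
    obtain ⟨Λ, y⟩ := D
    simp only [inverseLoop, Counted.ops_bind, List.length_cons]
    have h1 : ∀ (I' : Finset (Freq t)) (ct : Freq t → ℕ), (Counted.forAll J fun k =>
        if k ∈ I' then Counted.op (ct k + 1) else pure (ct k)).ops ≤ #J * 1 := fun I' ct =>
      Counted.ops_forAll_le _ _ 1 fun k _ => by split_ifs <;> simp
    have h2 : ∀ (I' : Finset (Freq t)) (Y : ℕ → ℂ), (Counted.forAll J fun k =>
        if k ∈ I' then do
          let r ← (⟨residue k Λ, 2 * t + 1⟩ : Counted ℕ)
          let a ← Counted.op (Y r / Λ.M)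
          Counted.op (g k + a)
        else pure (g k)).ops ≤ #J * (2 * t + 3) := fun I' Y =>
      Counted.ops_forAll_le _ _ _ fun k _ => by
        split_ifs
        · simp only [Counted.ops_bind, Counted.ops_op]; omega
        · simp
    have h3 := hF (Λ, y) List.mem_cons_self
    have h4 : (isolated J Λ).ops = #J * (2 * t + 3) := rfl
    rw [h4, Nat.succ_mul data.length]
    have h5 := h1 (isolated J Λ).val counter
    have h6 := h2 (isolated J Λ).val (Counted.fft Λ.M y).val
    have h7 := ih (fun D hD => hF D (List.mem_cons_of_mem _ hD))
      (Counted.forAll J fun k => if k ∈ (isolated J Λ).val then Counted.op (counter k + 1)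
        else pure (counter k)).val
      (Counted.forAll J fun k =>
        if k ∈ (isolated J Λ).val then do
          let r ← (⟨residue k Λ, 2 * t + 1⟩ : Counted ℕ)
          let a ← Counted.op ((Counted.fft Λ.M y).val r / Λ.M)
          Counted.op (g k + a)
        else pure (g k)).val
    calc _ ≤ #J * (2 * t + 3) + (F + (#J * 1 + (#J * (2 * t + 3) + (data.length *
        (#J * (2 * t + 3) + (F + (#J * 1 + #J * (2 * t + 3)))) + #J * 2)))) :=
          Nat.add_le_add le_rfl (Nat.add_le_add h3 (Nat.add_le_add h5 (Nat.add_le_add h6 h7)))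
      _ = _ := by ring

/-- The frequencies of `J` at which the polynomial `∑ p̂ₕ exp(2πi h·x)` can produce a nonzero
coefficient: those that are isolated for some lattice and collide there with the projection of a
frequency of the polynomial. -/
noncomputable def detectable (c : Freq d →₀ ℂ) (ht : t ≤ d) (J : Finset (Freq t))
    (Λs : List (Rank1Lattice t)) : Finset (Freq t) := by
  classical
  exact {k ∈ J | ∃ Λ ∈ Λs, k ∈ (isolated J Λ).val ∧
    ∃ h ∈ c.support, (∑ i, proj ht h i * Λ.z i) ≡ (∑ i, k i * Λ.z i) [ZMOD Λ.M]}

theorem detectable_subset (c : Freq d →₀ ℂ) (ht : t ≤ d) (J : Finset (Freq t))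
    (Λs : List (Rank1Lattice t)) : detectable c ht J Λs ⊆ J := by
  classical
  exact filter_subset _ _

/-- Every frequency of the polynomial collides with at most one isolated frequency per lattice. -/
theorem card_detectable_le (c : Freq d →₀ ℂ) (ht : t ≤ d) (J : Finset (Freq t))
    (Λs : List (Rank1Lattice t)) : #(detectable c ht J Λs) ≤ Λs.length * #c.support := by
  classical
  induction Λs with
  | nil => simp [detectable]
  | cons Λ Λs ih =>
    have h1 : detectable c ht J (Λ :: Λs) ⊆ (c.support.biUnion fun h =>
        {k ∈ (isolated J Λ).val |
          (∑ i, proj ht h i * Λ.z i) ≡ (∑ i, k i * Λ.z i) [ZMOD Λ.M]}) ∪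
        detectable c ht J Λs := by
      intro k hk
      simp only [detectable, mem_filter, List.mem_cons, exists_eq_or_imp] at hk
      rw [mem_union]
      rcases hk with ⟨hkJ, ⟨h2, h, hh, h3⟩ | h2⟩
      · exact Or.inl (mem_biUnion.2 ⟨h, hh, mem_filter.2 ⟨h2, h3⟩⟩)
      · exact Or.inr (mem_filter.2 ⟨hkJ, h2⟩)
    refine (card_le_card h1).trans ((card_union_le _ _).trans ?_)
    rw [List.length_cons, Nat.succ_mul, add_comm]
    refine Nat.add_le_add ih (card_biUnion_le.trans ?_)
    rw [← mul_one #c.support, ← smul_eq_mul]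
    refine Finset.sum_le_card_nsmul _ _ _ fun h _ => card_le_one.2 fun k hk k' hk' => ?_
    rw [mem_filter, mem_isolated] at hk hk'
    by_contra hne
    exact hk.1.2 k' hk'.1.1 (Ne.symm hne) (hk.2.symm.trans hk'.2)

theorem sum_ite_eq_mul {ι : Type} (l : List ι) (P : ι → Prop) [DecidablePred P] (a : ι → ℂ) (b : ℂ)
    (h : ∀ i ∈ l, P i → a i = b) :
    (l.map fun i => if P i then a i else 0).sum =
      b * (l.map fun i => if P i then (1 : ℂ) else 0).sum := by
  induction l with
  | nil => simp
  | cons i l ih =>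
    simp only [List.map_cons, List.sum_cons, mul_add]
    rw [ih fun j hj => h j (List.mem_cons_of_mem _ hj)]
    congr 1
    split_ifs with hi
    · rw [h i List.mem_cons_self hi, mul_one]
    · simp

theorem sum_ite_one_ne_zero {ι : Type} (l : List ι) (P : ι → Prop) [DecidablePred P]
    (h : ∃ i ∈ l, P i) : (l.map fun i => if P i then (1 : ℂ) else 0).sum ≠ 0 := by
  have h1 : (l.map fun i => if P i then (1 : ℂ) else 0).sum =
      (((l.map fun i => if P i then 1 else 0).sum : ℕ) : ℂ) := by
    induction l with
    | nil => simp
    | cons i l ih =>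
      by_cases hl : ∃ i ∈ l, P i
      · simp only [List.map_cons, List.sum_cons, ih hl]
        push_cast
        rfl
      · have h2 : ∀ j ∈ l, ¬ P j := fun j hj hP => hl ⟨j, hj, hP⟩
        have h3 : (l.map fun i => if P i then (1 : ℂ) else 0) = l.map fun _ => 0 :=
          List.map_congr_left fun j hj => if_neg (h2 j hj)
        have h4 : (l.map fun i => if P i then (1 : ℕ) else 0) = l.map fun _ => 0 :=
          List.map_congr_left fun j hj => if_neg (h2 j hj)
        simp only [List.map_cons, List.sum_cons, h3, h4]
        simp
  obtain ⟨i, hi, hP⟩ := h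
  rw [h1, Nat.cast_ne_zero]
  have h2 : (if P i then 1 else 0) ≤ (l.map fun i => if P i then 1 else 0).sum :=
    List.single_le_sum (fun _ _ => Nat.zero_le _) _ (List.mem_map_of_mem hi)
  rw [if_pos hP] at h2
  omega

/-- One iteration with random values of the last components computes exact partial sums if the lattices
reconstruct all candidates and no projected frequency of the polynomial is missing.  In any case the
nonzero values belong to detectable frequencies. -/
theorem evaluates_coefficients (c : Freq d →₀ ℂ) (ht : t ≤ d) (δ : ℝ) (s : ℕ) (J : Finset (Freq t))
    {L Q W : ℕ} {Λs : List (Rank1Lattice t)} (hΛs : IsLatticeFamily L Q Λs) (hJQ : #J ≤ Q)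
    (hW : Nat.clog 2 (2 * Q) ≤ W) (hW1 : 1 ≤ W) (hL : 1 ≤ L) (ht1 : 1 ≤ t) :
    ∃ (g : UnitAddTorus (Fin d) → Freq t → ℂ) (n : UnitAddTorus (Fin d) → ℕ),
      (Covers J Λs → c.support.image (proj ht) ⊆ J → ∀ x, ∀ k ∈ J,
        g x k = partialSum c (firstComponents ht) (fun h => proj ht h = k) x) ∧
      (∀ x, ∀ k ∈ J, g x k ≠ 0 → k ∈ detectable c ht J Λs) ∧
      (∀ x, n x ≤ d + 142 * (L * Q * t * W)) ∧
      EvaluatesOnDraw (trigPoly c) (do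
          let x ← drawPoint
          let y ← sampleLattices x Λs
          let g ← Prog.lift (inverseTransform J y)
          Prog.lift (Counted.select J g δ s))
        (fun x => (Counted.select J (g x) δ s).val) (Λs.map fun Λ => Λ.M).sum n := by
  set G : UnitAddTorus (Fin d) → Counted (Freq t → ℂ) := fun x =>
    inverseTransform J (Λs.map fun Λ => (Λ, latticeValues (trigPoly c) x Λ)) with hG
  have hval : ∀ x, ∀ k ∈ J, (G x).val k =
      (Λs.map fun Λ => if k ∈ (isolated J Λ).val then partialSum c (firstComponents ht)
        (fun h => (∑ i, proj ht h i * Λ.z i) ≡ (∑ i, k i * Λ.z i) [ZMOD Λ.M]) x else 0).sum /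
      (Λs.map fun Λ => if k ∈ (isolated J Λ).val then (1 : ℂ) else 0).sum := by
    intro x k hk
    rw [hG]
    simp only [inverseTransform]
    rw [val_inverseLoop _ _ _ _ hk, List.map_map, List.map_map]
    simp only [Pi.zero_apply, Nat.cast_zero, zero_add]
    congr 2
    refine List.map_congr_left fun Λ hΛ => ?_
    simp only [Function.comp]
    rw [fft_latticeValues ht (hΛs.2 Λ hΛ).1]
  refine ⟨fun x => (G x).val, fun x => d + ((Λs.map fun Λ => Λ.M * (3 * t)).sum +
    ((G x).ops + (Counted.select J (G x).val δ s).ops)), ?_, ?_, ?_, ?_⟩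
  · intro hcov hsub x k hk
    change (G x).val k = _
    rw [hval x k hk, sum_ite_eq_mul Λs (fun Λ => k ∈ (isolated J Λ).val) _
      (partialSum c (firstComponents ht) (fun h => proj ht h = k) x),
      mul_div_cancel_right₀ _ (sum_ite_one_ne_zero _ _ (hcov k hk))]
    intro Λ hΛ hkΛ
    rw [mem_isolated] at hkΛ
    rw [partialSum, partialSum]
    refine Finset.sum_congr (Finset.filter_congr fun h hh => ?_) fun _ _ => rfl
    constructor
    · intro hmod
      by_contra hne
      exact hkΛ.2 _ (hsub (mem_image_of_mem _ hh)) hne hmod.symm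
    · rintro rfl
      exact Int.ModEq.refl _
  · intro x k hk hne
    by_contra hnd
    refine hne ?_
    change (G x).val k = 0
    rw [hval x k hk, sum_ite_eq_mul Λs (fun Λ => k ∈ (isolated J Λ).val) _ 0, zero_mul, zero_div]
    intro Λ hΛ hkΛ
    rw [partialSum]
    refine Finset.sum_eq_zero fun h hh => (hnd ?_).elim
    rw [mem_filter] at hh
    classical
    exact mem_filter.2 ⟨hk, Λ, hΛ, hkΛ, h, hh.1, hh.2⟩
  · intro x
    have h1 : (Λs.map fun Λ => Λ.M * (3 * t)).sum ≤ L * (Q * (3 * t)) := by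
      refine (List.sum_le_card_nsmul _ (Q * (3 * t)) fun m hm => ?_).trans ?_
      · obtain ⟨Λ, hΛ, rfl⟩ := List.mem_map.1 hm
        exact Nat.mul_le_mul_right _ (hΛs.2 Λ hΛ).2
      · rw [List.length_map, smul_eq_mul]
        exact Nat.mul_le_mul_right _ hΛs.1
    have h2 : (G x).ops ≤ L * (#J * (2 * t + 3) + (120 * Q * W + (#J * 1 + #J * (2 * t + 3)))) +
        #J * 2 := by
      refine (ops_inverseLoop_le J (F := 120 * Q * W) _ (fun D hD => ?_) _ _).trans ?_
      · obtain ⟨Λ, hΛ, rfl⟩ := List.mem_map.1 hD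
        refine (Counted.ops_fft_le Λ.M W _ (hΛs.2 Λ hΛ).1
          ((Nat.clog_mono_right 2 (Nat.mul_le_mul_left 2 (hΛs.2 Λ hΛ).2)).trans hW) hW1).trans ?_
        exact Nat.mul_le_mul_right _ (Nat.mul_le_mul_left _ (hΛs.2 Λ hΛ).2)
      · rw [List.length_map]
        exact Nat.add_le_add_right (Nat.mul_le_mul_right _ hΛs.1) _
    have h3 := Counted.ops_select_le J (G x).val δ s (W := W)
      ((Nat.clog_mono_right 2 (by omega)).trans hW)
    have h4 : L * (#J * (2 * t + 3) + (120 * Q * W + (#J * 1 + #J * (2 * t + 3)))) + #J * 2 ≤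
        L * (Q * (2 * t + 3) + (120 * Q * W + (Q * 1 + Q * (2 * t + 3)))) + Q * 2 := by gcongr
    have h5 : #J * (5 + W) ≤ Q * (5 + W) := Nat.mul_le_mul_right _ hJQ
    have m1 : L * Q * t ≤ L * Q * t * W := Nat.le_mul_of_pos_right _ hW1
    have m2 : L * Q * W ≤ L * Q * W * t := Nat.le_mul_of_pos_right _ ht1
    have m3 : L * Q ≤ L * Q * t := Nat.le_mul_of_pos_right _ ht1
    have m4 : Q * W ≤ L * (Q * W) := Nat.le_mul_of_pos_left _ hL
    have m5 : Q ≤ L * Q := Nat.le_mul_of_pos_left _ hL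
    change d + ((Λs.map fun Λ => Λ.M * (3 * t)).sum +
      ((G x).ops + (Counted.select J (G x).val δ s).ops)) ≤ _
    linarith
  · have h1 := (EvaluatesOnDraw.drawPoint (p := trigPoly c)).bind (f := fun x => do
          let y ← sampleLattices x Λs
          let g ← Prog.lift (inverseTransform J y)
          Prog.lift (Counted.select J g δ s)) fun x =>
      (evaluates_sampleLattices (trigPoly c) x Λs).bind <|
        (Evaluates.lift _).bind <| (Evaluates.lift _)
    simpa only [zero_add, add_zero] using h1

end Coefficients

/-! ### Detection probabilities -/

section Detection

open Prog MeasureTheory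

variable {d : ℕ}

theorem integral_mFourier (n : Freq d) :
    ∫ x, UnitAddTorus.mFourier n x ∂torusMeasure d = if n = 0 then 1 else 0 := by
  change ∫ x : UnitAddTorus (Fin d), ∏ i, fourier (n i) (x i) ∂torusMeasure d = _
  rw [integral_fintype_prod_eq_prod (μ := fun _ => AddCircle.haarAddCircle)
    (fun i (y : UnitAddCircle) => fourier (n i) y)]
  split_ifs with h
  · refine Finset.prod_eq_one fun i _ => ?_
    simp [h]
  · obtain ⟨i, hi⟩ := Function.ne_iff.1 h
    refine Finset.prod_eq_zero (mem_univ i) ?_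
    exact integral_eq_zero_of_add_right_eq_neg (μ := AddCircle.haarAddCircle)
      (fourier_add_half_inv_index (by simpa using hi) (by norm_num))

variable {ι : Type} (G : Finset ι) (a : ι → ℂ) (e : ι → Freq d)

theorem continuous_sum_mFourier :
    Continuous fun x : UnitAddTorus (Fin d) => ∑ h ∈ G, a h * UnitAddTorus.mFourier (e h) x :=
  continuous_finsetSum _ fun h _ => continuous_const.mul (UnitAddTorus.mFourier (e h)).continuous

theorem integrable_of_continuous {E : Type} [NormedAddCommGroup E] {f : UnitAddTorus (Fin d) → E}
    (hf : Continuous f) [SecondCountableTopologyEither (UnitAddTorus (Fin d)) E] :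
    Integrable f (torusMeasure d) :=
  hf.integrable_of_hasCompactSupport (HasCompactSupport.of_compactSpace f)

/-- Parseval's identity for a finite sum. -/
theorem integral_norm_sq_sum_mFourier (he : Set.InjOn e G) :
    ∫ x, ‖∑ h ∈ G, a h * UnitAddTorus.mFourier (e h) x‖ ^ 2 ∂torusMeasure d =
      ∑ h ∈ G, ‖a h‖ ^ 2 := by
  have h1 : ∀ x, ((‖∑ h ∈ G, a h * UnitAddTorus.mFourier (e h) x‖ ^ 2 : ℝ) : ℂ) =
      ∑ h ∈ G, ∑ h' ∈ G, (a h * (starRingEnd ℂ) (a h')) *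
        UnitAddTorus.mFourier (e h + -e h') x := by
    intro x
    push_cast
    rw [← Complex.mul_conj', map_sum, Finset.sum_mul_sum]
    refine Finset.sum_congr rfl fun h _ => Finset.sum_congr rfl fun h' _ => ?_
    rw [UnitAddTorus.mFourier_add, UnitAddTorus.mFourier_neg, map_mul]
    ring
  have h2 : ((∫ x, ‖∑ h ∈ G, a h * UnitAddTorus.mFourier (e h) x‖ ^ 2 ∂torusMeasure d : ℝ) : ℂ) =
      ((∑ h ∈ G, ‖a h‖ ^ 2 : ℝ) : ℂ) := by
    rw [← integral_complex_ofReal]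
    simp only [h1]
    have h3 : ∀ h h', Integrable (fun x => (a h * (starRingEnd ℂ) (a h')) *
        UnitAddTorus.mFourier (e h + -e h') x) (torusMeasure d) := fun h h' =>
      integrable_of_continuous (continuous_const.mul (ContinuousMap.continuous _))
    rw [integral_finsetSum _ fun h _ => integrable_finsetSum _ fun h' _ => h3 h h']
    push_cast
    refine Finset.sum_congr rfl fun h hh => ?_
    rw [integral_finsetSum _ fun h' _ => h3 h h', Finset.sum_eq_single_of_mem h hh]
    · rw [integral_const_mul, integral_mFourier, if_pos (by simp), mul_one, Complex.mul_conj']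
    · intro h' hh' hne
      rw [integral_const_mul, integral_mFourier, if_neg, mul_zero]
      intro h0
      exact hne (he hh' hh (add_neg_eq_zero.1 h0).symm)
  exact_mod_cast h2

/-- A sum of at most `S` exponentials with coefficients of size at least `3 δ` is smaller than `δ`
with probability at most `1 - 1 / (2 S)`: by Parseval's identity its mean square is at least
`1 / #G` times its largest possible square. -/
theorem measure_norm_lt_le (he : Set.InjOn e G) (hG : G.Nonempty) {δ : ℝ} (hδ : 0 < δ)
    (ha : ∀ h ∈ G, δ ≤ ‖a h‖ / 3) {S : ℕ} (hS : #G ≤ S) :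
    torusMeasure d {x | ‖∑ h ∈ G, a h * UnitAddTorus.mFourier (e h) x‖ < δ} ≤
      ENNReal.ofReal (1 - 1 / (2 * S)) := by
  set f : UnitAddTorus (Fin d) → ℂ := fun x => ∑ h ∈ G, a h * UnitAddTorus.mFourier (e h) x with hf
  have hfc : Continuous f := continuous_sum_mFourier G a e
  set U : Set (UnitAddTorus (Fin d)) := {x | ‖f x‖ < δ} with hU
  have hUm : MeasurableSet U := (isOpen_lt hfc.norm continuous_const).measurableSet
  set A := ∑ h ∈ G, ‖a h‖ ^ 2 with hA
  have hn : (0 : ℝ) < #G := by exact_mod_cast card_pos.2 hG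
  have hAδ : 9 * δ ^ 2 ≤ A := by
    obtain ⟨h, hh⟩ := hG
    have h1 : ‖a h‖ ^ 2 ≤ A := single_le_sum (fun h _ => sq_nonneg ‖a h‖) hh
    have h2 := ha h hh
    nlinarith
  have hbound : ∀ x, ‖f x‖ ^ 2 ≤ #G * A := by
    intro x
    have h1 : ‖f x‖ ≤ ∑ h ∈ G, ‖a h‖ := by
      refine (norm_sum_le _ _).trans (Finset.sum_le_sum fun h _ => ?_)
      rw [norm_mul]
      refine mul_le_of_le_one_right (norm_nonneg _) ?_
      exact ((UnitAddTorus.mFourier (e h)).norm_coe_le_norm x).trans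
        UnitAddTorus.mFourier_norm.le
    refine (pow_le_pow_left₀ (norm_nonneg _) h1 2).trans ?_
    exact sq_sum_le_card_mul_sum_sq
  -- The mean square is at most `δ²` from `U` plus the largest possible square from its complement.
  have hint : A ≤ δ ^ 2 + #G * A * (torusMeasure d).real Uᶜ := by
    have h1 : ∀ x, ‖f x‖ ^ 2 ≤ δ ^ 2 + Uᶜ.indicator (fun _ => (#G * A : ℝ)) x := by
      intro x
      by_cases hx : x ∈ U
      · have h2 : ‖f x‖ < δ := hx
        simp only [Set.mem_compl_iff, hx, not_true, not_false_iff, Set.indicator_of_notMem, add_zero]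
        exact pow_le_pow_left₀ (norm_nonneg _) h2.le 2
      · rw [Set.indicator_of_mem (by exact hx)]
        nlinarith [hbound x, sq_nonneg δ]
    have h2 : Integrable (Uᶜ.indicator fun _ => (#G * A : ℝ)) (torusMeasure d) :=
      (integrable_const _).indicator hUm.compl
    calc A = ∫ x, ‖f x‖ ^ 2 ∂torusMeasure d := (integral_norm_sq_sum_mFourier G a e he).symm
      _ ≤ ∫ x, (δ ^ 2 + Uᶜ.indicator (fun _ => (#G * A : ℝ)) x) ∂torusMeasure d :=
        integral_mono (integrable_of_continuous (hfc.norm.pow 2)) ((integrable_const _).add h2) h1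
      _ = _ := by
        rw [integral_add (integrable_const _) h2, integral_indicator hUm.compl]
        simp [mul_comm]
  have hA0 : 0 < A := by nlinarith [sq_nonneg δ, mul_pos hδ hδ]
  have h1 : 8 / 9 ≤ #G * (torusMeasure d).real Uᶜ := by
    have h2 : A * (8 / 9) ≤ A * (#G * (torusMeasure d).real Uᶜ) := by nlinarith
    exact le_of_mul_le_mul_left h2 hA0
  have hS' : (#G : ℝ) ≤ S := by exact_mod_cast hS
  have h2 : 1 / (2 * (S : ℝ)) ≤ (torusMeasure d).real Uᶜ := by
    have h3 : (0 : ℝ) ≤ (torusMeasure d).real Uᶜ := measureReal_nonneg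
    rw [div_le_iff₀ (by linarith)]
    nlinarith
  have h3 : (torusMeasure d).real U ≤ 1 - 1 / (2 * S) := by
    rw [probReal_compl_eq_one_sub hUm] at h2
    linarith
  rw [← ENNReal.ofReal_toReal (measure_ne_top (torusMeasure d) U)]
  exact ENNReal.ofReal_le_ofReal h3

variable {c : Freq d →₀ ℂ} {A : Finset (Fin d)} {β : Type} [DecidableEq β] {π : Freq d → β}

theorem measure_partialSum_lt_le (hπ : ∀ h h', π h = π h' → restFreq A h = restFreq A h' → h = h')
    {δ : ℝ} (hδ : 0 < δ) (hc : ∀ h ∈ c.support, δ ≤ ‖c h‖ / 3) {k : β}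
    (hk : k ∈ c.support.image π) :
    torusMeasure d {x | ‖partialSum c A (fun h => π h = k) x‖ < δ} ≤
      ENNReal.ofReal (1 - 1 / (2 * #c.support)) := by
  refine measure_norm_lt_le {h ∈ c.support | π h = k} c (restFreq A) ?_ ?_ hδ
    (fun h hh => hc h (mem_filter.1 hh).1) (card_filter_le _ _)
  · intro h hh h' hh' heq
    rw [mem_coe, mem_filter] at hh hh'
    exact hπ h h' (hh.2.trans hh'.2.symm) heq
  · obtain ⟨h, hh, rfl⟩ := mem_image.1 hk
    exact ⟨h, mem_filter.2 ⟨hh, rfl⟩⟩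

theorem partialSum_eq_zero {k : β} (hk : k ∉ c.support.image π) (x : UnitAddTorus (Fin d)) :
    partialSum c A (fun h => π h = k) x = 0 := by
  rw [partialSum, filter_false_of_mem, Finset.sum_empty]
  rintro h hh rfl
  exact hk (mem_image_of_mem _ hh)

/-- The probability that `r` iterations find all projected frequencies. -/
theorem prob_detection {p : UnitAddTorus (Fin d) → ℂ} {q : Prog d (Finset β)} {J : Finset β}
    {g : UnitAddTorus (Fin d) → β → ℂ} {δ : ℝ} {s m : ℕ} {n : UnitAddTorus (Fin d) → ℕ}
    (hq : EvaluatesOnDraw p q (fun x => (Counted.select J (g x) δ s).val) m n)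
    (hg : ∀ x, ∀ k ∈ J, g x k = partialSum c A (fun h => π h = k) x)
    (hJ : c.support.image π ⊆ J) (hδ : 0 < δ) (hs : #c.support ≤ s) {ρ : ℝ≥0∞}
    (hρ : ∀ k ∈ c.support.image π,
      torusMeasure d {x | ‖partialSum c A (fun h => π h = k) x‖ < δ} ≤ ρ) (r : ℕ) :
    1 - #c.support * ρ ^ r ≤ prob p (unionLoop q r) fun I _ _ => I = c.support.image π := by
  have hfilter : ∀ x, ({k ∈ J | δ ≤ ‖g x k‖} : Finset β) ⊆ c.support.image π := by
    refine fun x => subset_iff.2 fun k hk => ?_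
    rw [mem_filter] at hk
    by_contra hk'
    rw [hg x k hk.1, partialSum_eq_zero hk', norm_zero] at hk
    linarith [hk.2]
  refine le_trans (tsub_le_tsub_left ?_ 1) (prob_unionLoop hq
    (fun x => (Counted.val_select_subset _ _ _ _).trans (hfilter x)) (ρ := ρ) ?_ r)
  · gcongr
    exact card_image_le
  · intro k hk
    refine ⟨{x | ‖partialSum c A (fun h => π h = k) x‖ < δ}, ?_, ?_, hρ k hk⟩
    · exact (isOpen_lt (continuous_sum_mFourier _ _ _).norm continuous_const).measurableSet
    · intro x hx
      rw [Counted.val_select _ _ _ _ (((card_le_card (hfilter x)).trans card_image_le).trans hs),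
        mem_filter, hg x k (hJ hk)] at hx
      exact not_le.1 fun h => hx ⟨hJ hk, h⟩

/-- This is `(1 - 1 / (2 S)) ^ r ≤ exp(-r / (2 S))` with the choice of `r`. -/
theorem mul_pow_numDetections_le {S : ℕ} {ε : ℝ} (hd : 1 ≤ d) (hS : 1 ≤ S) (hε : 0 < ε) :
    (S : ℝ≥0∞) * ENNReal.ofReal (1 - 1 / (2 * S)) ^ numDetections d S ε ≤
      ENNReal.ofReal (ε / (3 * d)) := by
  have hS' : (1 : ℝ) ≤ S := by exact_mod_cast hS
  have hd' : (1 : ℝ) ≤ d := by exact_mod_cast hd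
  have h0 : 0 ≤ 1 - 1 / (2 * (S : ℝ)) := by
    rw [sub_nonneg, div_le_one (by linarith)]
    linarith
  set r := numDetections d S ε with hr
  have h1 : 2 * S * (Real.log 3 + Real.log d + Real.log S - Real.log ε) ≤ r := Nat.le_ceil _
  have h2 : (1 - 1 / (2 * (S : ℝ))) ^ r ≤ ε / (3 * d * S) := by
    calc (1 - 1 / (2 * (S : ℝ))) ^ r ≤ Real.exp (-(1 / (2 * S))) ^ r := by
          refine pow_le_pow_left₀ h0 ?_ r
          linarith [Real.add_one_le_exp (-(1 / (2 * (S : ℝ))))]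
      _ = Real.exp (-(r / (2 * S))) := by
          rw [← Real.exp_nat_mul]
          congr 1
          ring
      _ ≤ Real.exp (Real.log (ε / (3 * d * S))) := by
          rw [Real.exp_le_exp, Real.log_div (by positivity) (by positivity),
            Real.log_mul (by positivity) (by positivity),
            Real.log_mul (by positivity) (by positivity)]
          have h3 : Real.log 3 + Real.log d + Real.log S - Real.log ε ≤ r / (2 * S) := by
            rw [le_div_iff₀ (by linarith)]
            linarith
          linarith
      _ = ε / (3 * d * S) := Real.exp_log (by positivity)
  rw [← ENNReal.ofReal_pow h0, ← ENNReal.ofReal_natCast, ← ENNReal.ofReal_mul (by positivity)]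
  refine ENNReal.ofReal_le_ofReal ((mul_le_mul_of_nonneg_left h2 (by positivity)).trans
    (le_of_eq ?_))
  field_simp

theorem one_le_numSearches {ε : ℝ} (hε : 0 < ε) (hε1 : ε < 1) :
    1 ≤ numSearches d ε := by
  rw [numSearches, Nat.one_le_ceil_iff]
  have h1 : 0 < Real.log 3 := Real.log_pos (by norm_num)
  have h2 : 0 ≤ Real.log d := Real.log_natCast_nonneg _
  have h3 := Real.log_neg hε hε1
  have h4 : 0 < Real.log 2 := Real.log_pos (by norm_num)
  exact div_pos (by linarith) h4

theorem half_pow_numSearches_le {ε : ℝ} (hd : 1 ≤ d) (hε : 0 < ε) (hε1 : ε < 1) :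
    (1 / 2 : ℝ≥0∞) ^ (numSearches d ε - 1 + 1) ≤ ENNReal.ofReal (ε / (3 * d)) := by
  rw [Nat.sub_add_cancel (one_le_numSearches hε hε1)]
  have hd' : (1 : ℝ) ≤ d := by exact_mod_cast hd
  set b := numSearches d ε with hb
  have h1 : (Real.log 3 + Real.log d - Real.log ε) / Real.log 2 ≤ b := Nat.le_ceil _
  have h4 : 0 < Real.log 2 := Real.log_pos (by norm_num)
  rw [div_le_iff₀ h4] at h1
  have h2 : (1 / 2 : ℝ) ^ b ≤ ε / (3 * d) := by
    rw [← Real.log_le_log_iff (by positivity) (by positivity), Real.log_pow, one_div, Real.log_inv,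
      Real.log_div (by positivity) (by positivity), Real.log_mul (by positivity) (by positivity)]
    linarith
  have h3 : (1 / 2 : ℝ≥0∞) = ENNReal.ofReal (1 / 2) := by
    rw [one_div, one_div, ENNReal.ofReal_inv_of_pos (by norm_num)]
    simp
  rw [h3, ← ENNReal.ofReal_pow (by norm_num)]
  exact ENNReal.ofReal_le_ofReal h2

end Detection

/-! ### One dimension increment -/

section Increment

open Prog

variable {d N : ℕ} {c : Freq d →₀ ℂ} {Γ : Finset (Freq d)} {δ : ℝ} {s : ℕ}

/-- Bounds on the quantities that determine the cost of one increment: `n` for the number of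
detected frequencies, `L` and `Q` for the number and the sizes of the lattices, `W` for logarithms,
`r` and `b` for the numbers of detection iterations and of lattice searches. -/
structure CostBounds (N n L Q W r b : ℕ) : Prop where
  one_le_L : 1 ≤ L
  one_le_W : 1 ≤ W
  one_le_b : 1 ≤ b
  b_le_r : b ≤ r
  one_le_N : 1 ≤ N
  grid_le : 2 * N + 1 ≤ Q
  card_le : n * (2 * N + 1) ≤ Q
  clog_le : Nat.clog 2 (2 * Q) ≤ W
  maxLattices_le : ∀ {t : ℕ} {J : Finset (Freq t)}, J ⊆ fullGrid t N → #J ≤ n * (2 * N + 1) →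
    maxLattices 2 (1 / 2) J ≤ L
  latticeSize_le : ∀ {t : ℕ} {J : Finset (Freq t)}, J ⊆ fullGrid t N → #J ≤ n * (2 * N + 1) →
    ∀ j < maxLattices 2 (1 / 2) J, latticeSize 2 J j ≤ Q

theorem select_subset_image {A : Finset (Fin d)} {β : Type} [DecidableEq β] {π : Freq d → β}
    {J : Finset β} {g : UnitAddTorus (Fin d) → β → ℂ}
    (hg : ∀ x, ∀ k ∈ J, g x k = partialSum c A (fun h => π h = k) x) (hδ : 0 < δ) (s : ℕ)
    (x : UnitAddTorus (Fin d)) : (Counted.select J (g x) δ s).val ⊆ c.support.image π := by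
  refine (Counted.val_select_subset _ _ _ _).trans (subset_iff.2 fun k hk => ?_)
  rw [mem_filter] at hk
  by_contra hk'
  rw [hg x k hk.1, partialSum_eq_zero hk', norm_zero] at hk
  linarith [hk.2]

theorem card_image_component_le (hc : c.support ⊆ Γ) (hN : Γ ⊆ fullGrid d N) (τ : Fin d) :
    #(c.support.image fun h => h τ) ≤ 2 * N + 1 :=
  (card_le_card (image_subset_image hc)).trans (card_component_le hN)

theorem always_detect (hc : c.support ⊆ Γ) (hΓ : Γ.Nonempty) (hN : Γ ⊆ fullGrid d N)
    (hδ : 0 < δ) {n L Q W r b : ℕ} (hb : CostBounds N n L Q W r b) (τ : Fin d) :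
    AlwaysWithin (trigPoly c) (unionLoop (detectOnce Γ δ s τ) r)
      (· ⊆ c.support.image fun h => h τ)
      (r * (2 * N + 1)) (r * (d + (2 * N + 1) * 142 * W + (2 * N + 1))) := by
  obtain ⟨g, m, hg, hm, hq⟩ := evaluates_detectOnce hc hΓ hN δ s τ (W := W)
    ((Nat.clog_mono_right 2 (Nat.mul_le_mul_left 2 hb.grid_le)).trans hb.clog_le) hb.one_le_W
  have h1 : AlwaysWithin (trigPoly c) (detectOnce Γ δ s τ) (· ⊆ c.support.image fun h => h τ)
      (2 * N + 1) (d + (2 * N + 1) * 142 * W) :=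
    (hq.always_iff _).2 fun x => ⟨select_subset_image hg hδ s x, extent_le hΓ hN, hm x⟩
  exact (h1.unionLoop r).mono (fun _ h => h) le_rfl
    (Nat.mul_le_mul_left r (Nat.add_le_add_left (card_image_component_le hc hN τ) _))

theorem prob_detect (hc : c.support ⊆ Γ) (hΓ : Γ.Nonempty) (hN : Γ ⊆ fullGrid d N)
    (hδ : 0 < δ) (hcδ : ∀ h ∈ c.support, δ ≤ ‖c h‖ / 3) (hs : #c.support ≤ s) (r : ℕ)
    (τ : Fin d) :
    1 - #c.support * ENNReal.ofReal (1 - 1 / (2 * #c.support)) ^ r ≤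
      prob (trigPoly c) (unionLoop (detectOnce Γ δ s τ) r)
        fun A _ _ => A = c.support.image fun h => h τ := by
  obtain ⟨g, m, hg, -, hq⟩ := evaluates_detectOnce hc hΓ hN δ s τ
    (W := Nat.clog 2 (2 * (2 * N + 1)) + 1) (by omega) (by omega)
  refine prob_detection hq hg (image_subset_image hc) hδ hs (fun k hk => ?_) r
  refine measure_partialSum_lt_le (fun h h' h1 h2 => funext fun i => ?_) hδ hcδ hk
  by_cases hi : i = τ
  · subst hi; exact h1
  · simpa [restFreq, hi] using congrFun h2 i

theorem val_candidates_subset {t : ℕ} (ht : t + 1 ≤ d) (hN : Γ ⊆ fullGrid d N)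
    (I : Finset (Freq t)) (A : Finset ℤ) : (candidates Γ ht I A).val ⊆ fullGrid (t + 1) N := by
  refine inter_subset_right.trans (image_subset_iff.2 fun k hk => ?_)
  have := hN hk
  rw [fullGrid, Fintype.mem_piFinset] at this ⊢
  exact fun i => this _

theorem card_candidates_le {t : ℕ} (ht : t + 1 ≤ d) (I : Finset (Freq t)) (A : Finset ℤ) :
    #(candidates Γ ht I A).val ≤ #I * #A :=
  (card_le_card inter_subset_left).trans (card_image_le.trans (card_product I A).le)

theorem image_proj_subset_candidates {t : ℕ} (ht : t + 1 ≤ d) (hc : c.support ⊆ Γ) :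
    c.support.image (proj ht) ⊆ (candidates Γ ht (c.support.image (proj (Nat.le_of_succ_le ht)))
      (c.support.image fun h => h ⟨t, ht⟩)).val := by
  refine image_subset_iff.2 fun h hh => mem_inter.2 ⟨mem_image.2 ?_, mem_image_of_mem _ (hc hh)⟩
  refine ⟨(proj (Nat.le_of_succ_le ht) h, h ⟨t, ht⟩),
    mem_product.2 ⟨mem_image_of_mem _ hh, mem_image.2 ⟨h, hh, rfl⟩⟩, ?_⟩
  funext i
  refine Fin.lastCases ?_ (fun i => ?_) i
  · simp only [Fin.snoc_last]
    rfl
  · simp only [Fin.snoc_castSucc]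
    rfl

/-- The program for one iteration of the detection of frequencies with `t` components. -/
noncomputable def detectFreqs {t : ℕ} (J : Finset (Freq t)) (Λs : List (Rank1Lattice t)) (δ : ℝ)
    (s : ℕ) : Prog d (Finset (Freq t)) := do
  let x ← drawPoint
  let y ← sampleLattices x Λs
  let g ← Prog.lift (inverseTransform J y)
  Prog.lift (Counted.select J g δ s)

theorem always_detectFreqs {t : ℕ} (ht : t ≤ d) (ht1 : 1 ≤ t) (hδ : 0 < δ) {J : Finset (Freq t)}
    {n L Q W r b : ℕ} (hb : CostBounds N n L Q W r b) (hJ : #J ≤ n * (2 * N + 1))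
    {Λs : List (Rank1Lattice t)} (hΛs : IsLatticeFamily L Q Λs) (r' : ℕ) :
    AlwaysWithin (trigPoly c) (unionLoop (detectFreqs J Λs δ s) r')
      (fun I => #I ≤ L * #c.support) (r' * (L * Q)) (r' * (d + 142 * (L * Q * t * W) + Q)) := by
  have hJQ := hJ.trans hb.card_le
  obtain ⟨g, m, -, hg, hm, hq⟩ := evaluates_coefficients c ht δ s J hΛs hJQ hb.clog_le hb.one_le_W
    hb.one_le_L ht1
  have h1 : AlwaysWithin (trigPoly c) (detectFreqs J Λs δ s) (· ⊆ detectable c ht J Λs)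
      (L * Q) (d + 142 * (L * Q * t * W)) := by
    refine (hq.always_iff _).2 fun x => ⟨?_, ?_, hm x⟩
    · refine (Counted.val_select_subset _ _ _ _).trans (subset_iff.2 fun k hk => ?_)
      rw [mem_filter] at hk
      refine hg x k hk.1 fun h0 => ?_
      rw [h0, norm_zero] at hk
      linarith [hk.2]
    · refine (List.sum_le_card_nsmul _ Q fun m hm => ?_).trans ?_
      · obtain ⟨Λ, hΛ, rfl⟩ := List.mem_map.1 hm
        exact (hΛs.2 Λ hΛ).2
      · rw [List.length_map, smul_eq_mul]
        exact Nat.mul_le_mul_right _ hΛs.1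
  refine (h1.unionLoop r').mono (fun I hI => ?_) le_rfl
    (Nat.mul_le_mul_left r' (Nat.add_le_add_left
      ((card_le_card (detectable_subset c ht J Λs)).trans hJQ) _))
  exact (card_le_card hI).trans ((card_detectable_le c ht J Λs).trans
    (Nat.mul_le_mul_right _ hΛs.1))

theorem proj_restFreq_injective {t : ℕ} (ht : t ≤ d) (h h' : Freq d) (h1 : proj ht h = proj ht h')
    (h2 : restFreq (firstComponents ht) h = restFreq (firstComponents ht) h') : h = h' := by
  funext i
  by_cases hi : (i : ℕ) < t
  · exact congrFun h1 ⟨i, hi⟩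
  · simpa [restFreq, mem_firstComponents, hi] using congrFun h2 i

/-- If all components are determined, then every partial sum is a single coefficient of the polynomial,
so that one iteration suffices. -/
theorem measure_partialSum_lt_eq_zero {t : ℕ} (ht : t ≤ d) (htd : ¬ t < d) (hδ : 0 < δ)
    (hcδ : ∀ h ∈ c.support, δ ≤ ‖c h‖ / 3) {k : Freq t} (hk : k ∈ c.support.image (proj ht)) :
    torusMeasure d {x | ‖partialSum c (firstComponents ht) (fun h => proj ht h = k) x‖ < δ} = 0 := by
  obtain ⟨h, hh, rfl⟩ := mem_image.1 hk
  have hrest : ∀ h : Freq d, restFreq (firstComponents ht) h = 0 := fun h => funext fun i => by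
    have : (i : ℕ) < t := by omega
    simp [restFreq, mem_firstComponents, this]
  have h1 : ({h' ∈ c.support | proj ht h' = proj ht h} : Finset (Freq d)) = {h} := by
    ext h'
    rw [mem_filter, mem_singleton]
    constructor
    · exact fun h2 => proj_restFreq_injective ht _ _ h2.2 (by rw [hrest, hrest])
    · rintro rfl
      exact ⟨hh, rfl⟩
  convert MeasureTheory.measure_empty (μ := torusMeasure d)
  refine Set.eq_empty_of_forall_notMem fun x hx => ?_
  rw [Set.mem_ofPred_eq, partialSum, h1, Finset.sum_singleton, hrest, UnitAddTorus.mFourier_zero,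
    ContinuousMap.one_apply, mul_one] at hx
  linarith [hcδ h hh]

theorem prob_detectFreqs {t : ℕ} (ht : t ≤ d) (hδ : 0 < δ) (ht1 : 1 ≤ t)
    (hcδ : ∀ h ∈ c.support, δ ≤ ‖c h‖ / 3) (hs : #c.support ≤ s) (r : ℕ) {J : Finset (Freq t)}
    (hJ : c.support.image (proj ht) ⊆ J) {Λs : List (Rank1Lattice t)} {L Q : ℕ}
    (hΛs : IsLatticeFamily L Q Λs) (hcov : Covers J Λs) :
    1 - #c.support * ENNReal.ofReal (1 - 1 / (2 * #c.support)) ^ r ≤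
      prob (trigPoly c) (unionLoop (detectFreqs J Λs δ s) (if t < d then r else 1))
        fun I _ _ => I = c.support.image (proj ht) := by
  have hΛs' : IsLatticeFamily (L + 1) (Q + #J) Λs :=
    ⟨hΛs.1.trans (Nat.le_succ _), fun Λ hΛ => ⟨(hΛs.2 Λ hΛ).1, (hΛs.2 Λ hΛ).2.trans (by omega)⟩⟩
  obtain ⟨g, m, hg, -, -, hq⟩ := evaluates_coefficients c ht δ s J hΛs' (by omega)
    (W := Nat.clog 2 (2 * (Q + #J)) + 1) (by omega) (by omega) (by omega) ht1
  split_ifs with htd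
  · exact prob_detection hq (hg hcov hJ) hJ hδ hs
      (fun k hk => measure_partialSum_lt_le (proj_restFreq_injective ht) hδ hcδ hk) r
  · refine le_trans ?_ (prob_detection hq (hg hcov hJ) hJ hδ hs (ρ := 0)
      (fun k hk => (measure_partialSum_lt_eq_zero ht htd hδ hcδ hk).le) 1)
    simp

/-- The operations of the lattice search: with `b ≤ r` its cost is covered by that of the detections. -/
theorem search_ops_le {n L Q W r b t x l j : ℕ} (hb : CostBounds N n L Q W r b) (ht : t ≤ d)
    (hj : j ≤ Q) (hl : l ≤ L)
    (hx : x ≤ 12 * Q * W + (l * j + 3 * N * N) * (3 * t * W)) (hd : 1 ≤ d) :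
    (b - 1 + 1) * (8 + (x + L * (t + j * (2 * t + 3) + (j + 1)))) ≤
      31 * (r * d * W * (L * Q)) + 9 * (r * d * W * (N * N)) := by
  rw [Nat.sub_add_cancel hb.one_le_b]
  have hL := hb.one_le_L
  have hW := hb.one_le_W
  have hQ : 1 ≤ Q := le_trans (by omega) hb.grid_le
  refine (Nat.mul_le_mul_right _ hb.b_le_r).trans ?_
  have h1 : x + L * (t + j * (2 * t + 3) + (j + 1)) ≤
      12 * Q * W + (L * Q + 3 * N * N) * (3 * d * W) + L * (d + Q * (2 * d + 3) + (Q + 1)) :=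
    Nat.add_le_add (hx.trans (by gcongr)) (by gcongr)
  refine (Nat.mul_le_mul_left r (Nat.add_le_add_left h1 8)).trans ?_
  have m1 : L * Q * d ≤ L * Q * d * W := Nat.le_mul_of_pos_right _ hW
  have m2 : L * Q ≤ L * Q * d := Nat.le_mul_of_pos_right _ hd
  have m3 : Q * W * 1 ≤ Q * W * (L * d) := Nat.mul_le_mul_left _ (Nat.mul_pos hL hd)
  have m4 : L ≤ L * Q := Nat.le_mul_of_pos_right _ hQ
  have m5 : L * d ≤ L * d * Q := Nat.le_mul_of_pos_right _ hQ
  have h2 : 8 + (12 * Q * W + (L * Q + 3 * N * N) * (3 * d * W) +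
      L * (d + Q * (2 * d + 3) + (Q + 1))) ≤ 31 * (d * W * (L * Q)) + 9 * (d * W * (N * N)) := by
    linarith
  calc _ ≤ r * (31 * (d * W * (L * Q)) + 9 * (d * W * (N * N))) := Nat.mul_le_mul_left r h2
    _ = _ := by ring

/-- The operations of one stage: `e` for the lattice search and `i` for the candidates. -/
theorem stage_ops_le {n L Q W r b t e i : ℕ} (hb : CostBounds N n L Q W r b) (ht : t ≤ d)
    (hd : 1 ≤ d) (he : e ≤ 31 * (r * d * W * (L * Q)) + 9 * (r * d * W * (N * N)))
    (hi : i ≤ n * (2 * N + 1) * t) {r' : ℕ} (hr : r' ≤ r) :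
    r * (d + (2 * N + 1) * 142 * W + (2 * N + 1)) + (i + (e +
      r' * (d + 142 * (L * Q * t * W) + Q))) ≤ 330 * (r * d * W * (L * Q + N * N)) := by
  have hL := hb.one_le_L
  have hW := hb.one_le_W
  have hr1 : 1 ≤ r := hb.one_le_b.trans hb.b_le_r
  have hQ : 1 ≤ Q := le_trans (by omega) hb.grid_le
  have h1 : r' * (d + 142 * (L * Q * t * W) + Q) ≤ r * (d + 142 * (L * Q * d * W) + Q) := by gcongr
  have h2 : r * (d + (2 * N + 1) * 142 * W + (2 * N + 1)) ≤ r * (d + Q * 142 * W + Q) := by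
    have := hb.grid_le
    gcongr
  have h3 : i ≤ r * (Q * d) := by
    refine hi.trans ((Nat.mul_le_mul hb.card_le ht).trans (Nat.le_mul_of_pos_left _ hr1))
  have m1 : r * (d * 1) ≤ r * (d * (W * (L * Q))) := by
    gcongr; exact Nat.mul_pos hW (Nat.mul_pos hL hQ)
  have m2 : r * Q * W * 1 ≤ r * Q * W * (L * d) := by gcongr; exact Nat.mul_pos hL hd
  have m3 : r * Q * 1 ≤ r * Q * (W * (L * d)) := by
    gcongr; exact Nat.mul_pos hW (Nat.mul_pos hL hd)
  have m4 : r * (Q * d) * 1 ≤ r * (Q * d) * (W * L) := by gcongr; exact Nat.mul_pos hW hL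
  have m5 : 0 ≤ r * d * W * (N * N) := Nat.zero_le _
  linarith

theorem stage_samples_le {n L Q W r b : ℕ} (hb : CostBounds N n L Q W r b) {r' : ℕ}
    (hr : r' ≤ r) : r * (2 * N + 1) + (0 + (0 + r' * (L * Q))) ≤ 2 * (r * (L * Q)) := by
  have h1 : r' * (L * Q) ≤ r * (L * Q) := Nat.mul_le_mul_right _ hr
  have h2 : r * (2 * N + 1) ≤ r * (L * Q) :=
    Nat.mul_le_mul_left _ (hb.grid_le.trans (Nat.le_mul_of_pos_left _ hb.one_le_L))
  omega

theorem always_search {t : ℕ} (ht : t ≤ d) (hd : 1 ≤ d) {J : Finset (Freq t)}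
    (hJ : J ⊆ fullGrid t N) {n L Q W r b : ℕ} (hb : CostBounds N n L Q W r b)
    (hJn : #J ≤ n * (2 * N + 1)) :
    AlwaysWithin (trigPoly c) (searchLattice J (b - 1) : Prog d _) (IsLatticeFamily L Q) 0
      (31 * (r * d * W * (L * Q)) + 9 * (r * d * W * (N * N))) := by
  have hL := hb.maxLattices_le hJ hJn
  have hQ := hb.latticeSize_le hJ hJn
  have h1 := one_le_maxLattices J
  have h2 : Nat.clog 2 Q ≤ W := (Nat.clog_mono_right 2 (by omega)).trans hb.clog_le
  refine (always_searchLattice hJ hQ hL le_rfl (b - 1)).mono (fun _ h => h) le_rfl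
    (search_ops_le hb ht (hJn.trans hb.card_le) hL ?_ hd)
  refine latticeSizesOps_le hJ hb.one_le_N h1 hb.one_le_W (hQ _ (by omega)) h2 ?_
  exact (Nat.log_mono_right (hJn.trans hb.card_le)).trans ((Nat.log_le_clog 2 Q).trans h2)

/-- The cost of detecting the first `t + 1` components.  The hypothesis `L * #c.support ≤ n` keeps the
number of detected frequencies below `n` for all outcomes, by `card_detectable_le`. -/
theorem always_increment (hc : c.support ⊆ Γ) (hΓ : Γ.Nonempty) (hN : Γ ⊆ fullGrid d N)
    (hδ : 0 < δ) {n L Q W r b : ℕ} (hb : CostBounds N n L Q W r b) (hn : L * #c.support ≤ n)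
    (t : ℕ) (h : t + 1 ≤ d) :
    AlwaysWithin (trigPoly c) (increment Γ δ s s r b (t + 1) h) (fun I => #I ≤ n)
      ((t + 1) * (2 * (r * (L * Q)))) ((t + 1) * (330 * (r * d * W * (L * Q + N * N)))) := by
  have hd : 1 ≤ d := by omega
  induction t with
  | zero =>
    have h1 := (always_detect (s := s) hc hΓ hN hδ hb ⟨0, h⟩).bind (m' := 0) (n' := 0)
      (f := fun A => pure (A.image fun a _ => a)) (P' := fun I : Finset (Freq 1) => #I ≤ n)
      fun A hA => AlwaysWithin.pure (card_image_le.trans ((card_le_card hA).trans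
        (card_image_le.trans ((Nat.le_mul_of_pos_left _ hb.one_le_L).trans hn))))
    refine h1.mono (fun _ h => h) ?_ ?_
    · rw [zero_add, one_mul]
      exact (stage_samples_le hb (Nat.zero_le r)).trans' (by omega)
    · rw [zero_add, one_mul]
      exact (stage_ops_le hb (t := 0) (e := 0) (i := 0) (Nat.zero_le d) hd (Nat.zero_le _)
        (Nat.zero_le _) (Nat.zero_le r)).trans' (by omega)
  | succ t ih =>
    rw [Nat.succ_mul (t + 1), Nat.succ_mul (t + 1)]
    have hr : (if t + 2 < d then r else 1) ≤ r := by
      split_ifs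
      · exact le_rfl
      · exact hb.one_le_b.trans hb.b_le_r
    refine ((ih (by omega)).bind (f := fun I => do
      let A ← Prog.unionLoop (detectOnce Γ δ s ⟨t + 1, h⟩) r
      let J ← Prog.lift (candidates Γ h I A)
      let Λ ← searchLattice J (b - 1)
      Prog.unionLoop (detectFreqs J Λ δ (if t + 2 < d then s else s)) (if t + 2 < d then r else 1))
      (P' := fun I => #I ≤ n) (m' := 2 * (r * (L * Q)))
      (n' := 330 * (r * d * W * (L * Q + N * N))) fun I hI => ?_)
    refine ((always_detect hc hΓ hN hδ hb ⟨t + 1, h⟩).bind (m' := 0 + (0 + _))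
      (P' := fun I : Finset (Freq (t + 2)) => #I ≤ n) fun A hA => ?_).mono (fun _ h => h)
      (stage_samples_le hb hr) (stage_ops_le hb h hd le_rfl le_rfl hr)
    have hIA : #I * #A ≤ n * (2 * N + 1) :=
      Nat.mul_le_mul hI ((card_le_card hA).trans (card_image_component_le hc hN _))
    refine (AlwaysWithin.lift (P := fun J => J ⊆ fullGrid (t + 2) N ∧ #J ≤ n * (2 * N + 1))
      ⟨val_candidates_subset h hN I A, (card_candidates_le h I A).trans hIA⟩
      (Nat.mul_le_mul_right _ hIA)).bind fun J hJ => ?_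
    refine (always_search h hd hJ.1 hb hJ.2).bind fun Λs hΛs => ?_
    refine (always_detectFreqs h (by omega) hδ hb hJ.2 hΛs _).mono (fun I hI => hI.trans hn)
      le_rfl le_rfl

theorem pow_three_mul (e : ℝ≥0∞) (t : ℕ) :
    e ^ (3 * (t + 1 + 1)) = e ^ (3 * (t + 1)) * (e * (1 * (e * e))) := by
  rw [show 3 * (t + 1 + 1) = 3 * (t + 1) + 3 by ring, pow_add]
  ring

/-- Every stage consists of at most three random steps, two detections and a lattice search, each with
success probability at least `e`. -/
theorem succeeds_increment (hc : c.support ⊆ Γ) (hΓ : Γ.Nonempty) (hN : Γ ⊆ fullGrid d N)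
    (hδ : 0 < δ) (hcδ : ∀ h ∈ c.support, δ ≤ ‖c h‖ / 3) (hs : #c.support ≤ s)
    {n L Q W r b : ℕ} (hb : CostBounds N n L Q W r b) (hn : #c.support ≤ n) {e : ℝ≥0∞}
    (he1 : e ≤ 1 - #c.support * ENNReal.ofReal (1 - 1 / (2 * #c.support)) ^ r)
    (he2 : e ≤ 1 - (1 / 2) ^ (b - 1 + 1))
    (t : ℕ) (h : t + 1 ≤ d) :
    SucceedsWithin (trigPoly c) (increment Γ δ s s r b (t + 1) h) (e ^ (3 * (t + 1)))
      (fun I => I = c.support.image (proj h))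
      ((t + 1) * (2 * (r * (L * Q)))) ((t + 1) * (330 * (r * d * W * (L * Q + N * N)))) := by
  have hd : 1 ≤ d := by omega
  have he : e ≤ 1 := he2.trans tsub_le_self
  have he' : e ≠ ∞ := ne_top_of_le_ne_top ENNReal.one_ne_top he
  have hdet : ∀ τ : Fin d, SucceedsWithin (trigPoly c) (unionLoop (detectOnce Γ δ s τ) r) e
      (fun A => A ⊆ (c.support.image fun h => h τ) ∧ A = c.support.image fun h => h τ)
      (r * (2 * N + 1)) (r * (d + (2 * N + 1) * 142 * W + (2 * N + 1))) := fun τ =>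
    (always_detect hc hΓ hN hδ hb τ).succeedsWithin
      (he1.trans (prob_detect hc hΓ hN hδ hcδ hs r τ))
  induction t with
  | zero =>
    have h1 := (hdet ⟨0, h⟩).bind (m' := 0) (n' := 0) (c' := 1)
      (f := fun A => pure (A.image fun a _ => a))
      (P' := fun I : Finset (Freq 1) => I = c.support.image (proj h)) ENNReal.one_ne_top
      fun A hA => by
        have h2 : (A.image fun a _ => a : Finset (Freq 1)) = c.support.image (proj h) := by
          rw [hA.2, image_image]
          refine image_congr fun k _ => funext fun i => ?_
          rw [Subsingleton.elim i 0]
          rfl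
        change (1 : ℝ≥0∞) ≤ prob _ (Prog.ret _) _
        simp [prob, h2]
    refine h1.mono ?_ (fun _ h => h) ?_ ?_
    · rw [mul_one]
      exact pow_le_of_le_one zero_le he (by norm_num)
    · rw [zero_add, one_mul]
      exact (stage_samples_le hb (Nat.zero_le r)).trans' (by omega)
    · rw [zero_add, one_mul]
      exact (stage_ops_le hb (t := 0) (e := 0) (i := 0) (Nat.zero_le d) hd (Nat.zero_le _)
        (Nat.zero_le _) (Nat.zero_le r)).trans' (by omega)
  | succ t ih =>
    rw [Nat.succ_mul (t + 1), Nat.succ_mul (t + 1), pow_three_mul]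
    have hr : (if t + 2 < d then r else 1) ≤ r := by
      split_ifs
      · exact le_rfl
      · exact hb.one_le_b.trans hb.b_le_r
    have hee : e * e ≠ ∞ := ENNReal.mul_ne_top he' he'
    have hee' : 1 * (e * e) ≠ ∞ := by rwa [one_mul]
    refine ((ih (by omega)).bind (f := fun I => do
      let A ← Prog.unionLoop (detectOnce Γ δ s ⟨t + 1, h⟩) r
      let J ← Prog.lift (candidates Γ h I A)
      let Λ ← searchLattice J (b - 1)
      Prog.unionLoop (detectFreqs J Λ δ (if t + 2 < d then s else s)) (if t + 2 < d then r else 1))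
      (P' := fun I => I = c.support.image (proj h)) (m' := 2 * (r * (L * Q)))
      (n' := 330 * (r * d * W * (L * Q + N * N))) (ENNReal.mul_ne_top he' hee') fun I hI => ?_)
    refine ((hdet ⟨t + 1, h⟩).bind (m' := 0 + (0 + _))
      (P' := fun I : Finset (Freq (t + 2)) => I = c.support.image (proj h)) hee'
      fun A hA => ?_).mono le_rfl (fun _ h => h)
      (stage_samples_le hb hr) (stage_ops_le hb h hd le_rfl le_rfl hr)
    have hIA : #I * #A ≤ n * (2 * N + 1) := Nat.mul_le_mul
      (by rw [hI]; exact card_image_le.trans hn)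
      ((card_le_card hA.1).trans (card_image_component_le hc hN _))
    have hcand := image_proj_subset_candidates h hc
    rw [← hI, ← hA.2] at hcand
    refine (SucceedsWithin.lift (P := fun J => (J ⊆ fullGrid (t + 2) N ∧ #J ≤ n * (2 * N + 1)) ∧
      c.support.image (proj h) ⊆ J)
      ⟨⟨val_candidates_subset h hN I A, (card_candidates_le h I A).trans hIA⟩, hcand⟩
      (Nat.mul_le_mul_right _ hIA)).bind hee fun J hJ => ?_
    refine ((always_search h hd hJ.1.1 hb hJ.1.2).succeedsWithin
      (he2.trans (prob_searchLattice hJ.1.1 (b - 1)))).bind he' fun Λs hΛs => ?_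
    rw [ite_self]
    refine ((always_detectFreqs h (by omega) hδ hb hJ.1.2 hΛs.1 _).succeedsWithin
      (he1.trans (prob_detectFreqs h hδ (by omega) hcδ hs r hJ.2 hΛs.1 hΛs.2))).mono le_rfl
      (fun I hI => hI.2) le_rfl le_rfl

end Increment

/-! ### The whole algorithm -/

section Algorithm

open Prog

variable {d N : ℕ} {c : Freq d →₀ ℂ} {Γ : Finset (Freq d)} {δ ε : ℝ} {s : ℕ}

theorem numSearches_le_numDetections {S : ℕ} (hS : 1 ≤ S) (hε : 0 < ε) (hε1 : ε < 1) :
    numSearches d ε ≤ numDetections d S ε := by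
  refine Nat.ceil_le_ceil ?_
  have h1 : 0 ≤ Real.log 3 := Real.log_nonneg (by norm_num)
  have h2 : 0 ≤ Real.log d := Real.log_natCast_nonneg _
  have h3 := Real.log_neg hε hε1
  have h4 : 0 ≤ Real.log S := Real.log_natCast_nonneg _
  have h5 := Real.log_two_gt_d9
  have hS' : (1 : ℝ) ≤ S := by exact_mod_cast hS
  rw [div_le_iff₀ (by linarith)]
  calc Real.log 3 + Real.log d - Real.log ε
      ≤ Real.log 3 + Real.log d + Real.log S - Real.log ε := by linarith
    _ = 1 * (Real.log 3 + Real.log d + Real.log S - Real.log ε) := (one_mul _).symm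
    _ ≤ (2 * S * Real.log 2) * (Real.log 3 + Real.log d + Real.log S - Real.log ε) := by
        refine mul_le_mul_of_nonneg_right ?_ (by linarith)
        nlinarith
    _ = _ := by ring

theorem Admissible.card_pos (h : Admissible N c Γ δ s ε) : 1 ≤ #c.support :=
  Finset.card_pos.2 (Finsupp.support_nonempty_iff.2 h.ne_zero)

theorem Admissible.nonempty (h : Admissible N c Γ δ s ε) : Γ.Nonempty :=
  (Finsupp.support_nonempty_iff.2 h.ne_zero).mono h.support_subset

/-- Bernoulli's inequality for the `3 d` random steps. -/
theorem ofReal_one_sub_le_pow (hd : 1 ≤ d) (hε : 0 < ε) (hε1 : ε < 1) :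
    ENNReal.ofReal (1 - ε) ≤ (1 - ENNReal.ofReal (ε / (3 * d))) ^ (3 * d) := by
  have hd' : (1 : ℝ) ≤ d := by exact_mod_cast hd
  have h1 : ε / (3 * d) ≤ 1 := by
    rw [div_le_one (by linarith)]
    linarith
  rw [← ENNReal.ofReal_one, ← ENNReal.ofReal_sub _ (by positivity),
    ← ENNReal.ofReal_pow (by linarith)]
  refine ENNReal.ofReal_le_ofReal ?_
  have h2 := one_add_mul_le_pow (show -2 ≤ -(ε / (3 * d)) by linarith) (3 * d)
  have h3 : ((3 * d : ℕ) : ℝ) * -(ε / (3 * d)) = -ε := by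
    push_cast
    field_simp
  rw [h3] at h2
  simpa [sub_eq_add_neg] using h2

theorem always_tunedFFT (h : Admissible N c Γ δ s ε) {n L Q W : ℕ}
    (hb : CostBounds N n L Q W (numDetections d #c.support ε) (numSearches d ε))
    (hn : L * #c.support ≤ n) :
    AlwaysWithin (trigPoly c) (tunedFFT Γ δ s #c.support ε) (fun _ => True)
      (d * (2 * (numDetections d #c.support ε * (L * Q))))
      (d * (330 * (numDetections d #c.support ε * d * W * (L * Q + N * N)))) := by
  obtain _ | t := d
  · exact absurd h.one_le_dim (by norm_num)
  · exact (always_increment h.support_subset h.nonempty h.subset_grid h.delta_pos hb hn t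
      le_rfl).mono (fun _ _ => trivial) le_rfl le_rfl

theorem succeeds_tunedFFT (h : Admissible N c Γ δ s ε) {n L Q W : ℕ}
    (hb : CostBounds N n L Q W (numDetections d #c.support ε) (numSearches d ε))
    (hn : #c.support ≤ n) :
    SucceedsWithin (trigPoly c) (tunedFFT Γ δ s #c.support ε) (ENNReal.ofReal (1 - ε))
      (fun I => I = c.support)
      (d * (2 * (numDetections d #c.support ε * (L * Q))))
      (d * (330 * (numDetections d #c.support ε * d * W * (L * Q + N * N)))) := by
  have h1 := ofReal_one_sub_le_pow h.one_le_dim h.eps_pos h.eps_lt_one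
  have h2 := mul_pow_numDetections_le h.one_le_dim h.card_pos h.eps_pos
  have h3 := half_pow_numSearches_le h.one_le_dim h.eps_pos h.eps_lt_one
  obtain _ | t := d
  · exact absurd h.one_le_dim (by norm_num)
  · refine (succeeds_increment h.support_subset h.nonempty h.subset_grid h.delta_pos h.delta_le
      h.card_le hb hn (tsub_le_tsub_left h2 1) (tsub_le_tsub_left h3 1) t le_rfl).mono h1
      (fun I hI => ?_) le_rfl le_rfl
    rw [hI]
    exact image_id

/-! ### Asymptotic bounds -/

/-- The bound for the number of lattices, if at most `n` frequencies are detected. -/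
noncomputable def latticeBound (n N : ℕ) : ℕ :=
  ⌈2 * (Real.log (n * (2 * N + 1) : ℕ) + Real.log 2)⌉₊

/-- The bound for the lattice sizes, with the constant `C` of `exists_latticeSize_le`. -/
def sizeBound (C n N : ℕ) : ℕ := 2 * C * (n * (2 * N + 1))

/-- The bounds in terms of the number `n` of detected frequencies: at most `n (2 N + 1)` candidates have to
be reconstructed. -/
theorem exists_costBounds : ∃ C : ℕ, 1 ≤ C ∧ ∀ {N n r b : ℕ}, 1 ≤ N → 1 ≤ n → 1 ≤ b → b ≤ r →
    CostBounds N n (latticeBound n N) (sizeBound C n N) (Nat.clog 2 (2 * sizeBound C n N)) r b := by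
  obtain ⟨C, hC, h⟩ := exists_latticeSize_le
  refine ⟨C, hC, fun {N n r b} hN hn hb hbr => ?_⟩
  set B := n * (2 * N + 1) with hB
  have hBN : 2 * N + 1 ≤ B := Nat.le_mul_of_pos_left _ hn
  have hBQ : B ≤ sizeBound C n N := Nat.le_mul_of_pos_left _ (by omega)
  have hlogB : 0 ≤ Real.log B := Real.log_natCast_nonneg _
  have hlog2 : 0 < Real.log 2 := Real.log_pos (by norm_num)
  refine ⟨?_, ?_, hb, hbr, hN, hBN.trans hBQ, hBQ, le_rfl, fun {t J} hJ hJB => ?_,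
    fun {t J} hJ hJB j hj => ?_⟩
  · rw [latticeBound, Nat.one_le_ceil_iff]
    positivity
  · exact Nat.clog_pos (by norm_num) (by omega)
  · rw [maxLattices_eq, latticeBound]
    refine Nat.ceil_le_ceil ?_
    rcases Nat.eq_zero_or_pos #J with h0 | h0
    · rw [h0, Nat.cast_zero, Real.log_zero]
      gcongr
    · have h1 : Real.log #J ≤ Real.log B :=
        Real.log_le_log (by exact_mod_cast h0) (by exact_mod_cast hJB)
      linarith
  · refine (h t N J hJ hN j hj).trans ?_
    rw [sizeBound, mul_comm 2 C, mul_assoc]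
    exact Nat.mul_le_mul_left C (by omega)

theorem latticeBound_le (n N : ℕ) :
    (latticeBound n N : ℝ) ≤ 2 * Real.log (n * (2 * N + 1) : ℕ) + 3 := by
  have h1 := Nat.ceil_lt_add_one (R := ℝ)
    (a := 2 * (Real.log (n * (2 * N + 1) : ℕ) + Real.log 2))
    (by have := Real.log_natCast_nonneg (n * (2 * N + 1)); positivity)
  rw [← latticeBound] at h1
  have := Real.log_two_lt_d9
  linarith

theorem clog_two_le {x : ℕ} (hx : 2 ≤ x) : (Nat.clog 2 x : ℝ) ≤ 2 * Real.log x + 1 := by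
  have h1 := Nat.pow_pred_clog_lt_self (b := 2) (by norm_num) (x := x) (by omega)
  have h2 : 1 ≤ Nat.clog 2 x := Nat.clog_pos (by norm_num) hx
  obtain ⟨e, he⟩ := Nat.exists_eq_succ_of_ne_zero (Nat.one_le_iff_ne_zero.1 h2)
  rw [he, Nat.pred_succ] at h1
  rw [he]
  have h3 : ((2 : ℝ) ^ e) ≤ x := by exact_mod_cast h1.le
  have h4 := Real.log_le_log (by positivity) h3
  rw [Real.log_pow] at h4
  have h5 := Real.log_two_gt_d9
  push_cast
  nlinarith [(Nat.cast_nonneg e : (0 : ℝ) ≤ e)]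

theorem le_mul_of_half_le {a X : ℝ} (ha : 0 ≤ a) (hX : 1 / 2 ≤ X) : a ≤ 2 * a * X := by nlinarith

/-- As `d ≤ κ S`, the term `log d` in the number of iterations is `O(log S)`. -/
theorem numDetections_le {κ l₀ : ℝ} (hκ : 1 ≤ κ) (hl₀ : 0 < l₀) : ∃ C : ℝ, 0 < C ∧
    ∀ (d S : ℕ) (ε : ℝ), 1 ≤ d → 2 ≤ S → (d : ℝ) ≤ κ * S → 1 / 2 ≤ Real.log S →
      l₀ ≤ -Real.log ε → (numDetections d S ε : ℝ) ≤ C * (S * Real.log S * -Real.log ε) := by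
  set a := Real.log 3 + Real.log κ + 1 with ha
  have h3 : 0 < Real.log 3 := Real.log_pos (by norm_num)
  have hlκ : 0 ≤ Real.log κ := Real.log_nonneg hκ
  have ha0 : 0 < a := by positivity
  refine ⟨2 * ((2 * a + 2) / l₀ + 2), by positivity, fun d S ε hd hS hdS hX hE => ?_⟩
  set X := Real.log S with hXdef
  set E := -Real.log ε with hEdef
  have hS' : (2 : ℝ) ≤ S := by exact_mod_cast hS
  have hd' : (0 : ℝ) < d := by exact_mod_cast hd
  have hlogd : Real.log d ≤ Real.log κ + X := by
    rw [hXdef, ← Real.log_mul (by linarith) (by linarith)]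
    exact Real.log_le_log hd' hdS
  have hlogd0 : 0 ≤ Real.log d := Real.log_natCast_nonneg _
  have h1 := Nat.ceil_lt_add_one (R := ℝ) (a := 2 * S * (Real.log 3 + Real.log d + X - Real.log ε))
    (by have : 0 ≤ Real.log 3 + Real.log d + X - Real.log ε := by linarith
        positivity)
  change (numDetections d S ε : ℝ) < _ at h1
  have h2 : Real.log 3 + Real.log d + X - Real.log ε + 1 ≤ ((2 * a + 2) / l₀ + 2) * (X * E) := by
    have h4 : a ≤ 2 * a * X := le_mul_of_half_le ha0.le hX
    have h5 : (2 * a + 2) * X ≤ ((2 * a + 2) / l₀) * (X * E) := by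
      have h6 : 1 ≤ E / l₀ := by rwa [one_le_div hl₀]
      have h7 : 0 ≤ (2 * a + 2) * X := by positivity
      calc (2 * a + 2) * X = ((2 * a + 2) * X) * 1 := (mul_one _).symm
        _ ≤ ((2 * a + 2) * X) * (E / l₀) := mul_le_mul_of_nonneg_left h6 h7
        _ = _ := by ring
    have h6 : E ≤ 2 * (X * E) := by nlinarith
    have h7 : Real.log 3 + Real.log d + X - Real.log ε + 1 ≤ (2 * a + 2) * X + E := by
      rw [hEdef]; linarith
    linarith
  calc (numDetections d S ε : ℝ)
      ≤ 2 * S * (Real.log 3 + Real.log d + X - Real.log ε + 1) := by nlinarith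
    _ ≤ 2 * S * (((2 * a + 2) / l₀ + 2) * (X * E)) :=
      mul_le_mul_of_nonneg_left h2 (by positivity)
    _ = _ := by ring

theorem samples_estimate {d S n N X E Cr C₁ cL κ r A : ℝ} (hd : 0 ≤ d) (hS : 0 ≤ S) (hn : 0 ≤ n)
    (hN : 0 ≤ N) (hX : 0 ≤ X) (hE : 0 ≤ E) (hCr : 0 ≤ Cr) (hC₁ : 0 ≤ C₁) (hcL : 12 ≤ cL)
    (hκ : 0 ≤ κ) (hA : 0 ≤ A) (hr : r ≤ Cr * (S * X * E))
    (hA' : A ≤ cL * X * (6 * C₁ * (n * N))) :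
    d * (2 * (r * A)) ≤
      330 * Cr * cL * (6 * C₁ * cL + 2 * κ) * (d * S * n * N * X ^ 2 * E) := by
  have h1 : r * A ≤ Cr * (S * X * E) * (cL * X * (6 * C₁ * (n * N))) :=
    mul_le_mul hr hA' hA (by positivity)
  have h2 : 12 * C₁ ≤ 330 * (6 * C₁ * cL + 2 * κ) := by nlinarith
  have hcL0 : 0 ≤ cL := by linarith
  calc d * (2 * (r * A))
      ≤ d * (2 * (Cr * (S * X * E) * (cL * X * (6 * C₁ * (n * N))))) :=
        mul_le_mul_of_nonneg_left (mul_le_mul_of_nonneg_left h1 two_pos.le) hd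
    _ = 12 * C₁ * (Cr * cL * (d * S * n * N * X ^ 2 * E)) := by ring
    _ ≤ 330 * (6 * C₁ * cL + 2 * κ) * (Cr * cL * (d * S * n * N * X ^ 2 * E)) :=
        mul_le_mul_of_nonneg_right h2 (by positivity)
    _ = 330 * Cr * cL * (6 * C₁ * cL + 2 * κ) * (d * S * n * N * X ^ 2 * E) := by ring

theorem operations_estimate {d S n N X E Cr C₁ cL κ r W A B : ℝ} (hd : 0 ≤ d) (hS : 0 ≤ S)
    (hX : 0 ≤ X) (hE : 0 ≤ E) (hCr : 0 ≤ Cr) (hcL : 0 ≤ cL)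
    (hW : 0 ≤ W) (hA : 0 ≤ A) (hr : r ≤ Cr * (S * X * E)) (hW' : W ≤ cL * X)
    (hA' : A ≤ cL * X * (6 * C₁ * (n * N))) (hB : B ≤ 2 * κ * (X * (n * N)))
    (hB0 : 0 ≤ B) :
    d * (330 * (r * d * W * (A + B))) ≤
      330 * Cr * cL * (6 * C₁ * cL + 2 * κ) * (d ^ 2 * S * n * N * X ^ 3 * E) := by
  have h1 : r * d * W ≤ Cr * (S * X * E) * d * (cL * X) :=
    mul_le_mul (mul_le_mul_of_nonneg_right hr hd) hW' hW (by positivity)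
  have h2 : r * d * W * (A + B) ≤ Cr * (S * X * E) * d * (cL * X) *
      (cL * X * (6 * C₁ * (n * N)) + 2 * κ * (X * (n * N))) :=
    mul_le_mul h1 (add_le_add hA' hB) (add_nonneg hA hB0) (by positivity)
  calc d * (330 * (r * d * W * (A + B)))
      ≤ d * (330 * (Cr * (S * X * E) * d * (cL * X) *
        (cL * X * (6 * C₁ * (n * N)) + 2 * κ * (X * (n * N))))) :=
        mul_le_mul_of_nonneg_left (mul_le_mul_of_nonneg_left h2 (by norm_num)) hd
    _ = 330 * Cr * cL * (6 * C₁ * cL + 2 * κ) * (d ^ 2 * S * n * N * X ^ 3 * E) := by ring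

/-- The costs for at most `n` detected frequencies, where `S ≤ n ≤ K S²`. -/
theorem exists_cost_le (C₁ K : ℕ) (hC₁ : 1 ≤ C₁) (hK : 1 ≤ K) {κ l₀ : ℝ} (hκ : 1 ≤ κ)
    (hl₀ : 0 < l₀) : ∃ C : ℝ, 0 < C ∧ ∀ (d N S n : ℕ) (ε : ℝ), 1 ≤ d → 1 ≤ N → 2 ≤ S →
      (N : ℝ) ≤ κ * S → (d : ℝ) ≤ κ * S → l₀ ≤ -Real.log ε → S ≤ n → n ≤ K * S ^ 2 →
      ((d * (2 * (numDetections d S ε * (latticeBound n N * sizeBound C₁ n N))) : ℕ) : ℝ) ≤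
        C * (d * S * n * N * Real.log S ^ 2 * -Real.log ε) ∧
      ((d * (330 * (numDetections d S ε * d * Nat.clog 2 (2 * sizeBound C₁ n N) *
        (latticeBound n N * sizeBound C₁ n N + N * N))) : ℕ) : ℝ) ≤
        C * ((d : ℝ) ^ 2 * S * n * N * Real.log S ^ 3 * -Real.log ε) := by
  obtain ⟨Cr, hCr, hr⟩ := numDetections_le hκ hl₀
  have hK' : (1 : ℝ) ≤ K := by exact_mod_cast hK
  have hC₁' : (1 : ℝ) ≤ C₁ := by exact_mod_cast hC₁
  set v : ℝ := 12 * C₁ * K * κ with hv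
  have hv1 : 1 ≤ v := by
    have h1 : 1 ≤ (C₁ : ℝ) * K := one_le_mul_of_one_le_of_one_le hC₁' hK'
    have h2 : 1 ≤ (C₁ : ℝ) * K * κ := one_le_mul_of_one_le_of_one_le h1 hκ
    rw [hv]; nlinarith
  have hlv : 0 ≤ Real.log v := Real.log_nonneg hv1
  set cL : ℝ := 4 * Real.log v + 12 with hcL
  have hcL0 : 0 < cL := by positivity
  refine ⟨330 * Cr * cL * (6 * C₁ * cL + 2 * κ), by positivity,
    fun d N S n ε hd hN hS hNS hdS hE hSn hnS => ?_⟩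
  have hS' : (2 : ℝ) ≤ S := by exact_mod_cast hS
  have hN' : (1 : ℝ) ≤ N := by exact_mod_cast hN
  have hd' : (1 : ℝ) ≤ d := by exact_mod_cast hd
  have hn' : (S : ℝ) ≤ n := by exact_mod_cast hSn
  have hn1 : 1 ≤ n := by omega
  have hX : 1 / 2 ≤ Real.log S := by
    have h1 := Real.log_le_log (by norm_num) hS'
    have h2 := Real.log_two_gt_d9
    linarith
  have hr := hr d S ε hd hS hdS hX hE
  set X := Real.log S with hXdef
  set E := -Real.log ε with hEdef
  have hE0 : 0 < E := hl₀.trans_le hE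
  have hX0 : 0 < X := by linarith
  have hnS' : (n : ℝ) ≤ K * S ^ 2 := by exact_mod_cast hnS
  have hn0 : (0 : ℝ) < n := by linarith
  have hQ : (sizeBound C₁ n N : ℝ) ≤ 6 * C₁ * (n * N) := by
    rw [sizeBound]
    push_cast
    have h1 : (n : ℝ) * (2 * N + 1) ≤ 3 * (n * N) := by nlinarith
    have h2 : (0 : ℝ) ≤ 2 * C₁ := by positivity
    nlinarith [mul_le_mul_of_nonneg_left h1 h2]
  have hlogv : ∀ x : ℝ, 0 < x → x ≤ 2 * (6 * C₁ * (n * N)) → Real.log x ≤ Real.log v + 3 * X := by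
    intro x hx hxle
    have h1 : x ≤ v * S ^ 3 := by
      refine hxle.trans ?_
      have h2 : (n : ℝ) * N ≤ K * S ^ 2 * (κ * S) :=
        mul_le_mul hnS' hNS (by positivity) (by positivity)
      rw [hv]
      have h3 : (0 : ℝ) ≤ 12 * C₁ := by positivity
      nlinarith [mul_le_mul_of_nonneg_left h2 h3]
    refine (Real.log_le_log hx h1).trans ?_
    rw [Real.log_mul (by positivity) (by positivity), Real.log_pow]
    norm_num
    exact le_rfl
  have hL : (latticeBound n N : ℝ) ≤ cL * X := by
    refine (latticeBound_le n N).trans ?_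
    have h1 := hlogv (n * (2 * N + 1) : ℕ)
      (by exact_mod_cast Nat.mul_pos hn1 (Nat.succ_pos _)) (by
      push_cast
      have h1 : (n : ℝ) * (2 * N + 1) ≤ 3 * (n * N) := by nlinarith
      have h2 : (n : ℝ) * N ≤ C₁ * (n * N) := le_mul_of_one_le_left (by positivity) hC₁'
      linarith)
    rw [hcL]
    nlinarith
  have hW : (Nat.clog 2 (2 * sizeBound C₁ n N) : ℝ) ≤ cL * X := by
    have hpos : 0 < sizeBound C₁ n N := by
      rw [sizeBound]
      exact Nat.mul_pos (Nat.mul_pos two_pos hC₁) (Nat.mul_pos hn1 (Nat.succ_pos _))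
    refine (clog_two_le (by omega)).trans ?_
    have h1 := hlogv (2 * sizeBound C₁ n N : ℕ)
      (by exact_mod_cast Nat.mul_pos two_pos hpos) (by push_cast; linarith)
    rw [hcL]
    nlinarith
  have hLQ : (latticeBound n N : ℝ) * sizeBound C₁ n N ≤ cL * X * (6 * C₁ * (n * N)) :=
    mul_le_mul hL hQ (Nat.cast_nonneg _) (by positivity)
  have hNN : (N : ℝ) * N ≤ 2 * κ * (X * (n * N)) := by
    have h1 : (N : ℝ) * N ≤ κ * (n * N) := by
      calc (N : ℝ) * N ≤ (κ * S) * N := mul_le_mul_of_nonneg_right hNS (by positivity)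
        _ ≤ (κ * n) * N := by gcongr
        _ = _ := by ring
    have h2 : κ * (n * N : ℝ) ≤ 2 * (κ * (n * N)) * X := le_mul_of_half_le (by positivity) hX
    linarith
  have h12 : (12 : ℝ) ≤ cL := by rw [hcL]; linarith
  have hκ0 : 0 ≤ κ := by linarith
  have hC₁0 : (0 : ℝ) ≤ C₁ := by linarith
  clear_value cL v X E
  constructor
  · rw [Nat.cast_mul, Nat.cast_mul, Nat.cast_mul, Nat.cast_mul, Nat.cast_ofNat]
    exact samples_estimate (Nat.cast_nonneg _) (Nat.cast_nonneg _) (Nat.cast_nonneg _)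
      (Nat.cast_nonneg _) hX0.le hE0.le hCr.le hC₁0 h12 hκ0
      (mul_nonneg (Nat.cast_nonneg _) (Nat.cast_nonneg _)) hr hLQ
  · rw [Nat.cast_mul, Nat.cast_mul, Nat.cast_mul, Nat.cast_mul, Nat.cast_mul, Nat.cast_add,
      Nat.cast_mul, Nat.cast_mul, Nat.cast_ofNat]
    exact operations_estimate (Nat.cast_nonneg _) (Nat.cast_nonneg _) hX0.le hE0.le hCr.le hcL0.le
      (Nat.cast_nonneg _)
      (mul_nonneg (Nat.cast_nonneg _) (Nat.cast_nonneg _)) hr hW hLQ hNN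
      (mul_nonneg (Nat.cast_nonneg _) (Nat.cast_nonneg _))

/-- If at most `K S²` frequencies are detected, then `L ≤ K S` lattices suffice, since `L` depends only
logarithmically on `K S² N`; and with so few lattices at most `K S²` frequencies are detected. -/
theorem exists_latticeBound_mul_le {κ : ℝ} (hκ : 1 ≤ κ) : ∃ K : ℕ, 1 ≤ K ∧ ∀ N S : ℕ, 1 ≤ N →
    2 ≤ S → (N : ℝ) ≤ κ * S → latticeBound (K * S ^ 2) N * S ≤ K * S ^ 2 := by
  have hlκ : 0 ≤ Real.log (3 * κ) := Real.log_nonneg (by linarith)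
  set K := ⌈22 + 4 * Real.log (3 * κ)⌉₊ with hKdef
  have hK : 22 + 4 * Real.log (3 * κ) ≤ K := Nat.le_ceil _
  have hK1 : (1 : ℝ) ≤ K := by linarith
  have hK1' : 1 ≤ K := by exact_mod_cast hK1
  refine ⟨K, hK1', fun N S hN hS hNS => ?_⟩
  have hS' : (2 : ℝ) ≤ S := by exact_mod_cast hS
  have hN' : (1 : ℝ) ≤ N := by exact_mod_cast hN
  have h1 : (latticeBound (K * S ^ 2) N : ℝ) ≤ K * S := by
    refine (latticeBound_le _ _).trans ?_
    have h2 : ((K * S ^ 2 * (2 * N + 1) : ℕ) : ℝ) ≤ (3 * κ) * K * S ^ 3 := by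
      push_cast
      have h3 : (2 * N + 1 : ℝ) ≤ 3 * (κ * S) := by linarith
      calc (K : ℝ) * S ^ 2 * (2 * N + 1) ≤ K * S ^ 2 * (3 * (κ * S)) := by gcongr
        _ = _ := by ring
    have h3 := Real.log_le_log (by positivity) h2
    rw [Real.log_mul (by positivity) (by positivity), Real.log_mul (by positivity) (by positivity),
      Real.log_pow] at h3
    have h4 : Real.log K ≤ K / 4 + 1 := by
      have h5 := Real.log_le_sub_one_of_pos (show (0 : ℝ) < K / 4 by positivity)
      rw [Real.log_div (by positivity) (by norm_num)] at h5
      have h6 : Real.log 4 = 2 * Real.log 2 := by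
        rw [show (4 : ℝ) = 2 ^ 2 by norm_num, Real.log_pow]; norm_num
      have h7 := Real.log_two_lt_d9
      linarith
    have h5 := Real.log_le_sub_one_of_pos (show (0 : ℝ) < S by positivity)
    rw [show ((3 : ℕ) : ℝ) = 3 by norm_num] at h3
    nlinarith [mul_nonneg (show (0 : ℝ) ≤ K - 22 by linarith) (show (0 : ℝ) ≤ S - 1 by linarith)]
  have h2 : latticeBound (K * S ^ 2) N ≤ K * S := by exact_mod_cast h1
  calc latticeBound (K * S ^ 2) N * S ≤ K * S * S := Nat.mul_le_mul_right S h2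
    _ = _ := by ring

end Algorithm

theorem theorem4p6 :
    -- the index set is found with probability at least `1 - ε`
    (∀ (d N : ℕ) (c : Freq d →₀ ℂ) (Γ : Finset (Freq d)) (δ : ℝ) (s : ℕ) (ε : ℝ),
      Admissible N c Γ δ s ε →
      ENNReal.ofReal (1 - ε) ≤
        (tunedFFT Γ δ s (#c.support) ε).prob (trigPoly c) fun I _ _ => I = c.support) ∧
    -- with probability at least `1 - ε` the index set is found within the stated complexities
    (∀ κ ε₀ : ℝ, 0 < κ → ε₀ < 1 → ∃ C : ℝ, 0 < C ∧
      ∀ (d N : ℕ) (c : Freq d →₀ ℂ) (Γ : Finset (Freq d)) (δ : ℝ) (s : ℕ) (ε : ℝ),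
        Admissible N c Γ δ s ε →
        2 ≤ #c.support → (N : ℝ) ≤ κ * #c.support → (d : ℝ) ≤ κ * #c.support → ε ≤ ε₀ →
        ENNReal.ofReal (1 - ε) ≤
          (tunedFFT Γ δ s (#c.support) ε).prob (trigPoly c) fun I samples operations =>
            I = c.support ∧
            (samples : ℝ) ≤
              C * (d * (#c.support : ℝ) ^ 2 * N * Real.log #c.support ^ 2 * |Real.log ε|) ∧
            (operations : ℝ) ≤
              C * ((d : ℝ) ^ 2 * (#c.support : ℝ) ^ 2 * N * Real.log #c.support ^ 3 *
                |Real.log ε|)) ∧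
    -- the complexities in the worst case
    (∀ κ ε₀ C₀ : ℝ, 0 < κ → ε₀ < 1 → 1 ≤ C₀ → ∃ C : ℝ, 0 < C ∧
      ∀ (d N : ℕ) (c : Freq d →₀ ℂ) (Γ : Finset (Freq d)) (δ : ℝ) (s : ℕ) (ε : ℝ),
        Admissible N c Γ δ s ε →
        2 ≤ #c.support → (N : ℝ) ≤ κ * #c.support → (d : ℝ) ≤ κ * #c.support → ε ≤ ε₀ →
        (s : ℝ) ≤ C₀ * #c.support →
        (tunedFFT Γ δ s (#c.support) ε).always (trigPoly c) fun _ samples operations =>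
          (samples : ℝ) ≤
            C * (d * (#c.support : ℝ) ^ 3 * N * Real.log #c.support ^ 3 * |Real.log ε| *
              max 1 |Real.log (|Real.log ε|)|) ∧
          (operations : ℝ) ≤
            C * ((d : ℝ) ^ 2 * (#c.support : ℝ) ^ 3 * N * Real.log #c.support ^ 4 *
              |Real.log ε| ^ 2 * max 1 |Real.log (|Real.log ε|)| ^ 2)) := by
  obtain ⟨C₁, hC₁, hcost⟩ := exists_costBounds
  have hb : ∀ {d N : ℕ} {c : Freq d →₀ ℂ} {Γ : Finset (Freq d)} {δ : ℝ} {s : ℕ} {ε : ℝ} {n : ℕ},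
      Admissible N c Γ δ s ε → 1 ≤ n → CostBounds N n (latticeBound n N) (sizeBound C₁ n N)
        (Nat.clog 2 (2 * sizeBound C₁ n N)) (numDetections d #c.support ε) (numSearches d ε) :=
    fun h hn => hcost h.one_le_N hn (one_le_numSearches h.eps_pos h.eps_lt_one)
      (numSearches_le_numDetections h.card_pos h.eps_pos h.eps_lt_one)
  have hlog : ∀ {ε ε₀ : ℝ}, 0 < ε → ε < 1 → ε ≤ ε₀ → ε₀ < 1 → 0 < -Real.log (max ε₀ (1 / 2)) ∧
      -Real.log (max ε₀ (1 / 2)) ≤ -Real.log ε ∧ |Real.log ε| = -Real.log ε := by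
    intro ε ε₀ h0 h1 h2 h3
    have h4 : (0 : ℝ) < max ε₀ (1 / 2) := lt_max_of_lt_right (by norm_num)
    have h5 := Real.log_neg h4 (max_lt h3 (by norm_num))
    have h6 := Real.log_le_log h0 (h2.trans (le_max_left ε₀ (1 / 2)))
    exact ⟨by linarith, by linarith, abs_of_neg (Real.log_neg h0 h1)⟩
  refine ⟨fun d N c Γ δ s ε h => ?_, fun κ ε₀ hκ hε₀ => ?_, fun κ ε₀ C₀ hκ hε₀ hC₀ => ?_⟩
  · exact (succeeds_tunedFFT h (hb h h.card_pos) le_rfl).trans (Prog.prob_mono fun _ _ _ h => h.1)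
  · have hl₀ : 0 < -Real.log (max ε₀ (1 / 2)) := by
      have h4 : (0 : ℝ) < max ε₀ (1 / 2) := lt_max_of_lt_right (by norm_num)
      linarith [Real.log_neg h4 (max_lt hε₀ (by norm_num))]
    -- When all detections succeed, there are at most `n = S` detected frequencies.
    obtain ⟨C, hC, hCle⟩ := exists_cost_le C₁ 1 hC₁ le_rfl (le_max_right κ 1) hl₀
    refine ⟨C, hC, fun d N c Γ δ s ε h hS hN hd hε => ?_⟩
    obtain ⟨-, h2, h3⟩ := hlog h.eps_pos h.eps_lt_one hε hε₀
    have hκ' : κ * (#c.support : ℝ) ≤ max κ 1 * #c.support := by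
      gcongr
      exact le_max_left κ 1
    obtain ⟨h4, h5⟩ := hCle d N #c.support #c.support ε h.one_le_dim h.one_le_N hS
      (hN.trans hκ') (hd.trans hκ') h2 le_rfl (by nlinarith)
    refine (succeeds_tunedFFT h (hb h h.card_pos) le_rfl).trans (Prog.prob_mono ?_)
    rintro I m n ⟨hI, hm, hn⟩
    rw [h3]
    refine ⟨hI, ?_, ?_⟩
    · have h6 : (m : ℝ) ≤ _ := (Nat.cast_le.2 hm).trans h4
      refine h6.trans (le_of_eq (by ring))
    · have h6 : (n : ℝ) ≤ _ := (Nat.cast_le.2 hn).trans h5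
      refine h6.trans (le_of_eq (by ring))
  · have hl₀ : 0 < -Real.log (max ε₀ (1 / 2)) := by
      have h4 : (0 : ℝ) < max ε₀ (1 / 2) := lt_max_of_lt_right (by norm_num)
      linarith [Real.log_neg h4 (max_lt hε₀ (by norm_num))]
    set l₀ := -Real.log (max ε₀ (1 / 2)) with hl₀def
    -- For arbitrary outcomes, there are at most `n = K S²` detected frequencies.
    obtain ⟨K, hK, hKle⟩ := exists_latticeBound_mul_le (le_max_right κ 1)
    obtain ⟨C, hC, hCle⟩ := exists_cost_le C₁ K hC₁ hK (le_max_right κ 1) hl₀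
    have hK' : (1 : ℝ) ≤ K := by exact_mod_cast hK
    refine ⟨C * K * 2 * max 1 (1 / l₀), by positivity,
      fun d N c Γ δ s ε h hS hN hd hε _ => ?_⟩
    obtain ⟨-, h2, h3⟩ := hlog h.eps_pos h.eps_lt_one hε hε₀
    have hκ' : κ * (#c.support : ℝ) ≤ max κ 1 * #c.support := by
      gcongr
      exact le_max_left κ 1
    have hn : #c.support ≤ K * #c.support ^ 2 := by nlinarith
    obtain ⟨h4, h5⟩ := hCle d N #c.support (K * #c.support ^ 2) ε h.one_le_dim h.one_le_N hS
      (hN.trans hκ') (hd.trans hκ') h2 hn le_rfl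
    refine Prog.always_mono (always_tunedFFT h (hb h (h.card_pos.trans hn))
      (hKle N #c.support h.one_le_N hS (hN.trans hκ'))) ?_
    rintro I m n ⟨-, hm, hn⟩
    rw [h3]
    set E := -Real.log ε with hE
    set X := Real.log (#c.support : ℝ) with hX
    set S : ℝ := (#c.support : ℝ) with hSdef
    have hS' : (2 : ℝ) ≤ S := by rw [hSdef]; exact_mod_cast hS
    have hX2 : 1 / 2 ≤ X := by
      have h6 := Real.log_le_log (by norm_num) hS'
      have h7 := Real.log_two_gt_d9
      linarith
    have hE0 : 0 < E := hl₀.trans_le h2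
    have hX0 : 0 < X := by linarith
    set Y := max 1 |Real.log E| with hY
    have hY1 : 1 ≤ Y := le_max_left _ _
    have hm1 : (1 : ℝ) ≤ max 1 (1 / l₀) := le_max_left _ _
    -- The surplus factors `log S`, `|log ε|` and `max {1, |log |log ε||}` of the claim are bounded below.
    have hEm : 1 ≤ max 1 (1 / l₀) * E := by
      calc (1 : ℝ) ≤ (1 / l₀) * E := by rw [one_div, inv_mul_eq_div, one_le_div hl₀]; exact h2
        _ ≤ _ := by gcongr; exact le_max_right _ _
    have hXX : 1 ≤ 2 * X := by linarith
    push_cast at h4 h5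
    rw [← hSdef] at h4 h5
    constructor
    · have h6 : (m : ℝ) ≤ _ := (Nat.cast_le.2 hm).trans (by push_cast; exact h4)
      refine h6.trans ?_
      have h7 : 0 ≤ C * (d * S * (K * S ^ 2) * N * X ^ 2 * E) := by positivity
      calc C * (d * S * (K * S ^ 2) * N * X ^ 2 * E)
          = C * (d * S * (K * S ^ 2) * N * X ^ 2 * E) * (1 * 1 * 1) := by ring
        _ ≤ C * (d * S * (K * S ^ 2) * N * X ^ 2 * E) * ((2 * X) * max 1 (1 / l₀) * Y) := by
            gcongr
        _ = _ := by ring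
    · have h6 : (n : ℝ) ≤ _ := (Nat.cast_le.2 hn).trans (by push_cast; exact h5)
      refine h6.trans ?_
      have h7 : 0 ≤ C * (d ^ 2 * S * (K * S ^ 2) * N * X ^ 3 * E) := by positivity
      have hY2 : 1 ≤ Y ^ 2 := one_le_pow₀ hY1
      calc C * (d ^ 2 * S * (K * S ^ 2) * N * X ^ 3 * E)
          = C * (d ^ 2 * S * (K * S ^ 2) * N * X ^ 3 * E) * (1 * 1 * 1) := by ring
        _ ≤ C * (d ^ 2 * S * (K * S ^ 2) * N * X ^ 3 * E) *
            ((2 * X) * (max 1 (1 / l₀) * E) * Y ^ 2) := by gcongr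
        _ = _ := by ring
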